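/- Setting. Let $G$ be an undirected graph on $n$ vertices whose edges are inserted one at a time, and augment it by a pseudo root $s$ joined to all $n$ vertices. A DFS tree of the augmented graph is a spanning tree $T$ rooted at $s$ such that every edge joins a vertex to one of its ancestors; a new edge $(x,y)$ is a cross edge if neither of $x,y$ is an ancestor of the other in $T$. The stick of $T$ is the maximal path going down from $s$ on which every vertex has exactly one child; the remaining vertices of $T$ are its bristles, and the root of the bristles is the first vertex below the stick (or $s$ itself if the stick is empty). The algorithm SDFS2. It keeps adjacency lists (in the order of insertion), the tree $T$, the entry and exit times of the last traversal, and marks on the vertices of the stick, and it starts with the star around $s$ and its DFS tree. When an edge $(x,y)$ is inserted: if $x$ or $y$ lies on the stick, the edge is discarded; otherwise it is appended to the lists of $x$ and $y$, and if it is a cross edge, then the bristles are rebuilt: their vertices are marked as unvisited, a depth first search is performed from the root of the bristles, the stick is extended downwards as far as possible, and the non-tree edges incident on the stick are removed from the adjacency lists. Time is the number of elementary (constant time) steps, where a visit, a scan of one list entry, a mark, or an ancestor test costs $O(1)$. Theorem. (1) For every sequence of distinct edges, after every insertion the tree $T$ maintained by SDFS2 is a DFS tree of the current (augmented) graph, rooted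 at $s$. (2) SDFS2 rebuilds only the bristles, and only when a cross edge is inserted. That is, there is an absolute constant $K$ such that the insertion of an edge that is not a cross edge leaves $T$ unchanged and takes at most $K$ steps, while the insertion of a cross edge keeps every vertex of the stick on the stick, keeps the children of the vertices of the stick, and takes at most $K(|B|+e(B))$ steps, where $B$ is the set of bristle vertices before the insertion and $e(B)$ is the number of edges of the augmented graph, with the new edge, that have both endpoints in $B$. (3) There is a constant $C$ such that for all $n\ge 2$ and all $m\le\binom n2$, the expected total time taken by SDFS2 for maintaining a DFS tree of the random graph $G(n,m)$ incrementally, i.e. for inserting the first $m$ edges of a uniformly random permutation of all $\binom n2$ possible edges, is at most $C\,n^2\log^2 n$. -/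

import Mathlib

open scoped BigOperators

namespace SDFS2

/-! ### Rooted trees, DFS trees, broomsticks -/

section Trees

variable {W : Type*}

/-- For a rooted tree given by its parent map, `u` is an ancestor of `v` (every vertex is an
ancestor of itself). -/
def Anc (par : W → Option W) (u v : W) : Prop :=
  Relation.ReflTransGen (fun a b => par b = some a) u v

/-- `par` is the parent map of a DFS tree of `G` rooted at `s`: a spanning tree of `G`, rooted at
`s`, such that every edge of `G` joins a vertex to one of its ancestors (no cross edges). -/
structure IsDFSTree (G : SimpleGraph W) (s : W) (par : W → Option W) : Prop where
  root : par s = none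
  spanning : ∀ v, Anc par s v
  tree_edge : ∀ u v, par v = some u → G.Adj u v
  no_cross : ∀ u v, G.Adj u v → Anc par u v ∨ Anc par v u

/-- The pair `u, v` is a cross edge with respect to the tree: neither endpoint is an ancestor of
the other. -/
def IsCross (par : W → Option W) (u v : W) : Prop := ¬ Anc par u v ∧ ¬ Anc par v u

/-- The stick: the maximal path going down from the root on which every vertex has exactly one
child. A vertex lies on it iff it and all its ancestors have exactly one child each. -/
def stick (par : W → Option W) : Set W := {v | ∀ u, Anc par u v → ∃! c, par c = some u}

/-- The bristles: everything that is not on the stick. -/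
def bristles (par : W → Option W) : Set W := (stick par)ᶜ

end Trees

/-! ### Edge sequences on `n` vertices, and the graph with its pseudo root -/

/-- The `n` vertices together with the pseudo root `none`. -/
abbrev Vertex (n : ℕ) := Option (Fin n)

/-- The possible edges of a graph on `n` vertices. -/
abbrev Edge (n : ℕ) := {e : Fin n × Fin n // e.1 < e.2}

/-- The graph with edge list `l`, augmented by the pseudo root, which is joined to all vertices. -/
def graph {n : ℕ} (l : List (Edge n)) : SimpleGraph (Vertex n) :=
  SimpleGraph.fromRel fun u v => u = none ∨ ∃ e ∈ l, u = some e.1.1 ∧ v = some e.1.2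

/-- The orderings (permutations) of all possible edges. The uniformly random ordering cut after
its first `m` entries is the random graph `G(n,m)` with its insertion order. -/
abbrev Ordering (n : ℕ) := Fin (Fintype.card (Edge n)) ≃ Edge n

instance (n : ℕ) : Nonempty (Ordering n) := ⟨(Fintype.equivFin (Edge n)).symm⟩

/-- The first `m` edges of an ordering. -/
def firstEdges {n : ℕ} (σ : Ordering n) (m : ℕ) : List (Edge n) := (List.ofFn σ).take m

theorem card_edge (n : ℕ) : Fintype.card (Edge n) = n.choose 2 := by
  have h : Fintype.card (Edge n) =
      ((Finset.univ : Finset (Fin n × Fin n)).filter fun e => e.1 < e.2).card :=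
    Fintype.card_subtype _
  rw [h, Finset.card_filter, Fintype.sum_prod_type]
  simp only [← Finset.card_filter]
  have h2 : ∀ i : Fin n, ((Finset.univ : Finset (Fin n)).filter fun j => i < j).card
      = n - 1 - i := by
    intro i
    have : ((Finset.univ : Finset (Fin n)).filter fun j => i < j) = Finset.Ioi i := by
      ext; simp
    rw [this, Fin.card_Ioi]
  simp only [h2]
  rw [Fin.sum_univ_eq_sum_range (fun i => n - 1 - i) n,
    Finset.sum_range_reflect (fun i => i) n, Finset.sum_range_id, Nat.choose_two_right]

/-! ### Step counting -/

/-- The result of a computation together with the number of elementary steps it took. -/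
structure Timed (α : Type) where
  val : α
  time : ℕ

namespace Timed

instance : Monad Timed where
  pure a := ⟨a, 0⟩
  bind x f := ⟨(f x.val).val, x.time + (f x.val).time⟩

/-- One elementary step. -/
def tick : Timed Unit := ⟨(), 1⟩

end Timed

open Timed

/-! ### The algorithm

The memory consists of arrays indexed by the vertices and of linked lists with a tail pointer. The
following operations are charged one step for each bounded number of them: reading or writing an
array entry, reading or removing the head of a list, pushing onto a list at its head or appending
one entry at its end, setting a list to empty, arithmetic and comparisons of vertices and counters. -/

/-- The memory of the algorithm. -/
structure Memory (n : ℕ) where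
  /-- adjacency lists, in the order of insertion -/
  adj : Vertex n → List (Vertex n)
  /-- the parents in the tree that is maintained -/
  par : Vertex n → Option (Vertex n)
  /-- the number of children -/
  kids : Vertex n → ℕ
  /-- the times at which the last traversal entered and left a vertex -/
  enter : Vertex n → ℕ
  leave : Vertex n → ℕ
  clock : ℕ
  visited : Vertex n → Bool
  /-- the marks of the vertices on the stick -/
  onStick : Vertex n → Bool
  /-- the root of the bristles: the first vertex below the stick -/
  root : Vertex n
  /-- the vertices of the bristles -/
  bris : List (Vertex n)
  /-- the vertices that the last traversal visited, in preorder -/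
  order : List (Vertex n)

section Algorithm

variable {n : ℕ}

/-- Mark the listed vertices as unvisited. -/
def clear : List (Vertex n) → Memory n → Timed (Memory n)
  | [], M => pure M
  | v :: l, M => do
    tick
    clear l { M with
      visited := Function.update M.visited v false
      kids := Function.update M.kids v 0 }

/-- Depth first search with an explicit stack. An entry `(v, l)` of the stack says that the
traversal is at `v` and that `l` is the part of the adjacency list of `v` still to be scanned. -/
def dfs (stack : List (Vertex n × List (Vertex n))) (M : Memory n) : Timed (Memory n) :=
  match stack with
  | [] => pure M
  | (v, []) :: st => do
    tick
    dfs st { M with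
      leave := Function.update M.leave v M.clock
      clock := M.clock + 1 }
  | (v, w :: l) :: st =>
    if _h : M.visited w = true then do
      tick
      dfs ((v, l) :: st) M
    else do
      tick
      dfs ((w, M.adj w) :: (v, l) :: st) { M with
        visited := Function.update M.visited w true
        par := Function.update M.par w (some v)
        kids := Function.update M.kids v (M.kids v + 1)
        enter := Function.update M.enter w M.clock
        clock := M.clock + 1
        order := M.order ++ [w] }
termination_by
  (∑ v : Vertex n, if M.visited v = true then 0 else (M.adj v).length + 2) +
    (stack.map fun p => p.2.length + 1).sum
decreasing_by
  · simp
  · simp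
  · have key : (∑ u : Vertex n, if Function.update M.visited w true u = true then 0
          else (M.adj u).length + 2) + ((M.adj w).length + 2)
        = ∑ u : Vertex n, if M.visited u = true then 0 else (M.adj u).length + 2 := by
      rw [← Finset.add_sum_erase _ _ (Finset.mem_univ w),
        ← Finset.add_sum_erase (a := w) Finset.univ
          (fun u => if M.visited u = true then 0 else (M.adj u).length + 2) (Finset.mem_univ w)]
      have hrest : ∀ u ∈ Finset.univ.erase w,
          (if Function.update M.visited w true u = true then 0 else (M.adj u).length + 2)
            = if M.visited u = true then 0 else (M.adj u).length + 2 := by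
        intro u hu
        rw [Function.update_of_ne (Finset.ne_of_mem_erase hu)]
      rw [Finset.sum_congr rfl hrest]
      simp [_h]
      ring
    simp only [List.map_cons, List.sum_cons, List.length_cons]
    omega

/-- Extend the stick. The argument lists the vertices of the tree hanging below the present stick
in preorder; as long as they have exactly one child, each is followed by that child. The vertex at
which the walk stops is the new root of the bristles. -/
def extendStick : List (Vertex n) → Memory n → Timed (Memory n)
  | [], M => pure M
  | v :: l, M =>
    if M.kids v = 1 then do
      tick
      extendStick l { M with onStick := Function.update M.onStick v true }
    else do
      tick
      pure { M with root := v, bris := v :: l }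

/-- Put back into the adjacency list of `v`, out of its previous entries, all except the non-tree
edges incident on the stick. -/
def pruneList (v : Vertex n) : List (Vertex n) → Memory n → Timed (Memory n)
  | [], M => pure M
  | w :: l, M =>
    if (M.onStick v = true ∨ M.onStick w = true) ∧ ¬ (M.par v = some w ∨ M.par w = some v) then do
      tick
      pruneList v l M
    else do
      tick
      pruneList v l { M with adj := Function.update M.adj v (M.adj v ++ [w]) }

/-- Remove the non-tree edges incident on the stick from the lists of the given vertices. -/
def prune : List (Vertex n) → Memory n → Timed (Memory n)
  | [], M => pure M
  | v :: vs, M => do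
    tick
    let M' ← pruneList v (M.adj v) { M with adj := Function.update M.adj v [] }
    prune vs M'

/-- Rebuild the bristles: mark their vertices as unvisited, traverse them from their root, extend
the stick, and remove the non-tree edges incident on it. -/
def rebuild (M : Memory n) : Timed (Memory n) := do
  let M₁ ← clear M.bris M
  tick
  let M₂ ← dfs [(M₁.root, M₁.adj M₁.root)] { M₁ with
    visited := Function.update M₁.visited M₁.root true
    enter := Function.update M₁.enter M₁.root 0
    clock := 1
    order := [M₁.root] }
  let M₃ ← extendStick M₂.order M₂
  prune M₃.order M₃

/-- Append an edge to the adjacency lists of both endpoints. -/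
def addEdge (M : Memory n) (x y : Vertex n) : Memory n :=
  { M with
    adj := Function.update (Function.update M.adj x (M.adj x ++ [y])) y (M.adj y ++ [x]) }

/-- Constant time ancestor test, for vertices of the bristles. -/
def ancTest (M : Memory n) (x y : Vertex n) : Bool :=
  decide (M.enter x ≤ M.enter y) && decide (M.leave y ≤ M.leave x)

/-- Insertion of an edge. An edge with an endpoint on the stick is discarded, any other edge is
stored, and if it is a cross edge, then the bristles are rebuilt. -/
def insertEdge (M : Memory n) (e : Edge n) : Timed (Memory n) := do
  tick
  let x : Vertex n := some e.1.1
  let y : Vertex n := some e.1.2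
  if M.onStick x = true ∨ M.onStick y = true then
    pure M
  else if ancTest M x y = true ∨ ancTest M y x = true then
    pure (addEdge M x y)
  else
    rebuild (addEdge M x y)

/-- The memory before the first traversal: the star around the pseudo root, all of it counted as
bristles. -/
def blank (n : ℕ) : Memory n where
  adj v := if v = none then (List.finRange n).map some else [none]
  par _ := none
  kids _ := 0
  enter _ := 0
  leave _ := 0
  clock := 0
  visited _ := false
  onStick _ := false
  root := none
  bris := none :: (List.finRange n).map some
  order := []

/-- Start: the writing of the star takes `n + 1` steps, and then its DFS tree is computed. -/
def start (n : ℕ) : Timed (Memory n) := do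
  let M : Memory n ← ⟨blank n, n + 1⟩
  rebuild M

/-- SDFS2: insert the edges of `l` one after the other. -/
def run (l : List (Edge n)) : Timed (Memory n) := do
  let M ← start n
  l.foldlM insertEdge M

/-- The tree maintained by SDFS2, after the insertion of the edges of `l`. -/
def tree (l : List (Edge n)) : Vertex n → Option (Vertex n) := (run l).val.par

/-- The total time taken by SDFS2 for the sequence `l`, the start included. -/
def totalTime (l : List (Edge n)) : ℕ := (run l).time

/-- The time taken by the insertion of `e` after the insertion of the edges of `l`. -/
def insertTime (l : List (Edge n)) (e : Edge n) : ℕ := (insertEdge (run l).val e).time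

end Algorithm

end SDFS2

/-! Correctness rests on one remark: a vertex of the stick is comparable with every vertex, because
it and all its ancestors have a single child. So an edge at the stick is never a cross edge,
discarding it is harmless, and a cross edge has both ends in the bristles. The bristles are
connected by the part of the old tree below their root, so a traversal of their pruned lists reaches
all of them. Every edge inside them joins related vertices: when it is scanned towards a visited
vertex, that vertex is either still open, hence an ancestor, or closed, hence has scanned the edge
already from its own side (`DfsInv.scan`, `Ready.isDFSTree_searched`, `Ready.inv_rebuild`,
`Inv.insert`). A rebuilding is linear in the bristles and the edges inside, because the pruned list
of a bristle vertex has at most one entry on the stick, the parent (`Ready.time_rebuild_le`).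

For the expected time one needs that there are few bristles. Since the lists are in the order of
insertion, the tree has the extra property `FirstChild`, which survives both rebuildings and
insertions without rebuilding. It forces the tree to begin with the greedy path, which moves from
the root always to the first neighbour off the path until it is stuck (`gpath_up_chain`). So the
tree, although rebuilt only now and then, can be compared with a path that depends on the edge
sequence alone. If every vertex off this path has a neighbour among its last `b` vertices, then all
earlier vertices of the path lie on the stick (`drop_subset_stick`). Hence more than `2b` bristles
produce a vertex `a` without neighbours in a certain set of at least `b` vertices: `a` is the end of
the path and the set consists of the vertices left over, or `a` is off the path and the set is the
end segment of the path (`exists_witness`). This set is found without looking at the edges at `a`,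
whose positions are independent of the order of the other edges. With `N = n.choose 2`, a union
bound over polynomially many cases shows that after `i` insertions there are more than `2b` bristles
with probability at most a polynomial in `n` times `(1 - i/N)^b` (`card_many_bristles_le`). This is
`O(n⁻²)` for `b` about `6 N log n / i`, so the trivial bound `O(n + i)` on the cost suffices in the
exceptional case.

There remain three ranges. For `i ≤ n log n` the trivial bound suffices throughout. For `i ≥ N/2`
there are `O(log n)` bristles, and the cost is at most of the order of the square of their number.
In between the degrees are `O(i/n)`, so a rebuilding costs `O(b i/n)`, and the next edge, uniform
among the `N - i` remaining ones, is a cross edge with probability `O(b²/N)`; the expected cost is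
`O(1 + b³ i/(n N)) = O(1 + n³ log³ n / i²)`. Each range sums to `O(n² log² n)`. -/

namespace SDFS2

open Timed

/-! ### Ancestry, comparability and recognition of the stick. -/

section Trees

variable {W : Type*} {par : W → Option W} {s : W}

theorem Anc.refl (par : W → Option W) (u : W) : Anc par u u := Relation.ReflTransGen.refl

theorem Anc.trans {u v w : W} (h : Anc par u v) (h' : Anc par v w) : Anc par u w :=
  Relation.ReflTransGen.trans h h'

theorem Anc.child {u v w : W} (h : Anc par u v) (h' : par w = some v) : Anc par u w :=
  Relation.ReflTransGen.tail h h'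

theorem Anc.of_par {u v : W} (h : par v = some u) : Anc par u v := Relation.ReflTransGen.single h

theorem anc_iff {u v : W} : Anc par u v ↔ v = u ∨ ∃ p, Anc par u p ∧ par v = some p :=
  Relation.ReflTransGen.cases_tail_iff _ _ _

/-- A proper ancestor has a child on the way down. -/
theorem Anc.eq_or_child {u v : W} (h : Anc par u v) : u = v ∨ ∃ c, par c = some u ∧ Anc par c v :=
  Relation.ReflTransGen.cases_head h

theorem Anc.eq_or_par {u v p : W} (h : Anc par u v) (hp : par v = some p) :
    v = u ∨ Anc par u p := by
  rcases anc_iff.1 h with h | ⟨q, hq, hv⟩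
  · exact Or.inl h
  · rw [hp] at hv
    cases hv
    exact Or.inr hq

theorem Anc.eq_root {u : W} (hr : par s = none) (h : Anc par u s) : u = s := by
  rcases anc_iff.1 h with h | ⟨q, _, hv⟩
  · exact h.symm
  · rw [hr] at hv
    cases hv

/-- A parent map may have cycles away from the root. Reachability from the root excludes them, so
this and the next two lemmas go by induction along the path from the root. -/
theorem Anc.par_ne_self {v : W} (hr : par s = none) (h : Anc par s v) : par v ≠ some v := by
  induction h with
  | refl => simp [hr]
  | @tail b c hb hc ih =>
    intro h
    have : b = c := Option.some_injective _ (hc.symm.trans h)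
    subst this
    exact ih h

theorem Anc.antisymm {u v : W} (hr : par s = none) (hs : Anc par s v) (h : Anc par u v)
    (h' : Anc par v u) : u = v := by
  induction hs generalizing u with
  | refl => exact h.eq_root hr
  | @tail b c hb hc ih =>
    rcases h.eq_or_par hc with rfl | h
    · rfl
    · have hcb : c = b := ih (h'.trans h) (Anc.of_par hc)
      subst hcb
      exact ih h h'

theorem Anc.not_of_par {u v : W} (hr : par s = none) (hs : Anc par s v) (h : par v = some u) :
    ¬ Anc par v u := by
  intro h'
  have : u = v := Anc.antisymm hr hs (Anc.of_par h) h'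
  subst this
  exact Anc.par_ne_self hr hs h

/-- Ancestry of a vertex depends only on the parents in a set that is closed upwards. -/
theorem Anc.congr {par' : W → Option W} {S : Set W} (hS : ∀ v ∈ S, ∀ u, par v = some u → u ∈ S)
    (heq : ∀ v ∈ S, par' v = par v) {u v : W} (hv : v ∈ S) : Anc par' u v ↔ Anc par u v := by
  constructor
  · intro h
    induction h with
    | refl => exact Anc.refl _ _
    | @tail b c hb hc ih =>
      have hc' : par c = some b := by rw [← heq c hv]; exact hc
      exact (ih (hS c hv b hc')).child hc'
  · intro h
    induction h with
    | refl => exact Anc.refl _ _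
    | @tail b c hb hc ih =>
      have hc' : par' c = some b := by rw [heq c hv]; exact hc
      exact (ih (hS c hv b hc)).child hc'

theorem Anc.mem_of_mem {S : Set W} (hS : ∀ v ∈ S, ∀ u, par v = some u → u ∈ S) {u v : W}
    (h : Anc par u v) (hv : v ∈ S) : u ∈ S := by
  induction h with
  | refl => exact hv
  | @tail b c hb hc ih => exact ih (hS c hv b hc)

theorem mem_stick_of_anc {u v : W} (h : Anc par u v) (hv : v ∈ stick par) : u ∈ stick par :=
  fun _ hw => hv _ (hw.trans h)

theorem existsUnique_child_of_mem_stick {u : W} (h : u ∈ stick par) : ∃! c, par c = some u :=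
  h u (Anc.refl _ _)

/-- A vertex of the stick is comparable with every vertex. -/
theorem stick_comparable {u x : W} (hu : u ∈ stick par) (hsu : Anc par s u) (hsx : Anc par s x) :
    Anc par u x ∨ Anc par x u := by
  induction hsx with
  | refl => exact Or.inr hsu
  | @tail p x hp hx ih =>
    rcases ih with h | h
    · exact Or.inl (h.child hx)
    · rcases h.eq_or_child with rfl | ⟨c, hc, hcu⟩
      · exact Or.inl (Anc.of_par hx)
      · have := (existsUnique_child_of_mem_stick (mem_stick_of_anc h hu)).unique hc hx
        subst this
        exact Or.inr hcu

section Characterisation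

variable {S : Set W} {r : W}

/-- The path from the root to `v` can leave `S` only through `r`. -/
theorem anc_of_notMem (hspan : ∀ v, Anc par s v) (hs : s ∈ S ∨ s = r)
    (hchild : ∀ v ∈ S, ∀ c, par c = some v → c ∈ S ∨ c = r) {v : W} (hv : v ∉ S) :
    Anc par r v := by
  have : v ∈ S ∨ Anc par r v := by
    induction hspan v with
    | refl =>
      rcases hs with h | h
      · exact Or.inl h
      · exact Or.inr (h ▸ Anc.refl _ _)
    | @tail p x hp hx ih =>
      by_cases hpS : p ∈ S
      · rcases hchild p hpS x hx with h | h
        · exact Or.inl h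
        · exact Or.inr (h ▸ Anc.refl _ _)
      · exact Or.inr (((ih hpS).resolve_left hpS).child hx)
  exact this.resolve_left hv

/-- How to recognise the stick. -/
theorem stick_eq (hspan : ∀ v, Anc par s v) (hs : s ∈ S ∨ s = r)
    (hup : ∀ v ∈ S, ∀ u, par v = some u → u ∈ S) (hone : ∀ v ∈ S, ∃! c, par c = some v)
    (hchild : ∀ v ∈ S, ∀ c, par c = some v → c ∈ S ∨ c = r)
    (hr : ¬ ∃! c, par c = some r) : stick par = S := by
  ext v
  constructor
  · intro hv
    by_contra hvS
    exact hr (hv r (anc_of_notMem hspan hs hchild hvS))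
  · intro hv u hu
    exact hone u (hu.mem_of_mem hup hv)

end Characterisation

end Trees

/-! ### Adjacency lists in the order of insertion -/

section Lists

variable {n : ℕ}

/-- The adjacency lists of the augmented graph in the order of insertion. -/
def nbrs (l : List (Edge n)) : Vertex n → List (Vertex n)
  | none => (List.finRange n).map some
  | some v => none :: l.filterMap fun e =>
      if e.1.1 = v then some (some e.1.2) else if e.1.2 = v then some (some e.1.1) else none

theorem Edge.ends_ne (e : Edge n) : (some e.1.1 : Vertex n) ≠ some e.1.2 := by
  intro h
  exact absurd e.2 (by rw [Option.some_injective _ h]; exact lt_irrefl _)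

theorem nbrs_append (l : List (Edge n)) (e : Edge n) (v : Vertex n) :
    nbrs (l ++ [e]) v = if v = some e.1.1 then nbrs l v ++ [some e.1.2]
      else if v = some e.1.2 then nbrs l v ++ [some e.1.1] else nbrs l v := by
  cases v with
  | none => simp [nbrs]
  | some v =>
    by_cases h1 : e.1.1 = v
    · simp [nbrs, h1]
    · by_cases h2 : e.1.2 = v
      · simp [nbrs, h1, h2, Ne.symm h1]
      · simp [nbrs, h1, h2, Ne.symm h1, Ne.symm h2]

theorem graph_adj_some {l : List (Edge n)} {a b : Fin n} :
    (graph l).Adj (some a) (some b) ↔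
      ∃ e ∈ l, (e.1.1 = a ∧ e.1.2 = b) ∨ (e.1.2 = a ∧ e.1.1 = b) := by
  simp only [graph, SimpleGraph.fromRel_adj, reduceCtorEq, false_or, Option.some.injEq, ne_eq]
  constructor
  · rintro ⟨_, ⟨e, he, h1, h2⟩ | ⟨e, he, h1, h2⟩⟩
    · exact ⟨e, he, Or.inl ⟨h1.symm, h2.symm⟩⟩
    · exact ⟨e, he, Or.inr ⟨h2.symm, h1.symm⟩⟩
  · rintro ⟨e, he, ⟨rfl, rfl⟩ | ⟨rfl, rfl⟩⟩
    · exact ⟨ne_of_lt e.2, Or.inl ⟨e, he, rfl, rfl⟩⟩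
    · exact ⟨ne_of_gt e.2, Or.inr ⟨e, he, rfl, rfl⟩⟩

theorem graph_adj_none {l : List (Edge n)} {a : Fin n} : (graph l).Adj none (some a) := by
  simp [graph]

theorem mem_nbrs {l : List (Edge n)} {v w : Vertex n} : w ∈ nbrs l v ↔ (graph l).Adj v w := by
  cases v with
  | none =>
    cases w with
    | none => simp [nbrs]
    | some w => simp [nbrs, graph_adj_none]
  | some v =>
    cases w with
    | none =>
      simp only [nbrs, List.mem_cons, true_or, true_iff]
      exact graph_adj_none.symm
    | some w =>
      rw [graph_adj_some]
      simp only [nbrs, List.mem_cons, reduceCtorEq, List.mem_filterMap, false_or]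
      refine exists_congr fun e => and_congr_right fun he => ?_
      have := ne_of_lt e.2
      split_ifs with h1 h2
      · simp [h1]
        rintro rfl
        exact absurd h1 this
      · simp [h1, h2]
      · simp [h1, h2]

theorem nodup_nbrs {l : List (Edge n)} (hl : l.Nodup) (v : Vertex n) : (nbrs l v).Nodup := by
  cases v with
  | none => exact (List.nodup_finRange n).map (Option.some_injective _)
  | some v =>
    refine List.nodup_cons.2 ⟨?_, ?_⟩
    · simp only [List.mem_filterMap, not_exists, not_and]
      intro e _
      split_ifs <;> simp
    · refine hl.filterMap ?_
      intro e f w he hf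
      have h1 := e.2
      have h2 := f.2
      apply Subtype.ext
      apply Prod.ext <;>
      · simp only [Option.mem_def] at he hf
        split_ifs at he hf <;> grind

theorem graph_mono (l : List (Edge n)) (e : Edge n) : graph l ≤ graph (l ++ [e]) := by
  intro u v h
  rw [← mem_nbrs] at h ⊢
  rw [nbrs_append]
  split_ifs <;> simp [h]

theorem graph_adj_append {l : List (Edge n)} {e : Edge n} {u v : Vertex n}
    (h : (graph (l ++ [e])).Adj u v) : (graph l).Adj u v ∨
      (u = some e.1.1 ∧ v = some e.1.2) ∨ (u = some e.1.2 ∧ v = some e.1.1) := by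
  rw [← mem_nbrs, nbrs_append] at h
  rw [← mem_nbrs]
  split_ifs at h with h1 h2
  · rcases List.mem_append.1 h with h | h
    · exact Or.inl h
    · exact Or.inr (Or.inl ⟨h1, List.mem_singleton.1 h⟩)
  · rcases List.mem_append.1 h with h | h
    · exact Or.inl h
    · exact Or.inr (Or.inr ⟨h2, List.mem_singleton.1 h⟩)
  · exact Or.inl h

theorem not_graph_adj_of_notMem {l : List (Edge n)} {e : Edge n} (h : e ∉ l) :
    ¬ (graph l).Adj (some e.1.1) (some e.1.2) := by
  rw [graph_adj_some]
  rintro ⟨f, hf, ⟨h1, h2⟩ | ⟨h1, h2⟩⟩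
  · exact h (by rwa [← (Subtype.ext (Prod.ext h1 h2) : f = e)])
  · have h3 := e.2
    have h4 := f.2
    rw [h1, h2] at h4
    exact absurd (lt_trans h3 h4) (lt_irrefl _)

end Lists

/-! ### The depth first search: its invariant and its running time. -/

section Search

variable {n : ℕ}

/-- One of the two vertices is an ancestor of the other. -/
def Related {W : Type*} (par : W → Option W) (u v : W) : Prop := Anc par u v ∨ Anc par v u

theorem Related.symm {W : Type*} {par : W → Option W} {u v : W} (h : Related par u v) :
    Related par v u := Or.symm h

/-- Serves for the stack of the traversal and for the greedy path, both of which list a vertex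
followed by its ancestors. -/
theorem anc_of_chain {W : Type*} {par : W → Option W} {v : W} {L : List W}
    (h : (v :: L).IsChain fun a b => par a = some b) {u : W} (hu : u ∈ L) : Anc par u v := by
  induction L generalizing v with
  | nil => cases hu
  | cons a L ih =>
    rw [List.isChain_cons_cons] at h
    rcases List.mem_cons.1 hu with rfl | hu
    · exact Anc.of_par h.1
    · exact (ih h.2 hu).child h.1

/-- What the traversal presupposes: the lists are symmetric off the stick, and the tree above
the root of the traversal lies on the stick. -/
structure DfsBase (A : Vertex n → List (Vertex n)) (onS : Vertex n → Bool)
    (par₀ : Vertex n → Option (Vertex n)) (r : Vertex n) : Prop where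
  sym : ∀ v w, onS v = false → onS w = false → w ∈ A v → v ∈ A w
  root : onS r = false
  up : ∀ v, (onS v = true ∨ v = r) → ∀ u, par₀ v = some u → onS u = true

/-- The invariant of the traversal. -/
structure DfsInv (A : Vertex n → List (Vertex n)) (onS : Vertex n → Bool)
    (par₀ : Vertex n → Option (Vertex n)) (r : Vertex n)
    (st : List (Vertex n × List (Vertex n))) (M : Memory n) : Prop where
  adj_eq : M.adj = A
  onStick_eq : M.onStick = onS
  par_eq : ∀ v, (onS v = true ∨ v = r) → M.par v = par₀ v
  mem_order : ∀ v, v ∈ M.order ↔ M.visited v = true ∧ onS v = false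
  vis : ∀ v, onS v = true → M.visited v = true
  nodup : M.order.Nodup
  root_mem : ∃ t, M.order = r :: t
  -- The clause on `pre` is the source of `FirstChild`: what stands before a child in the list of
  -- its parent, off the stick, was entered before that child.
  tree : ∀ w ∈ M.order, w ≠ r → ∃ v, M.par w = some v ∧ v ∈ M.order ∧ M.enter v < M.enter w ∧
    ∃ pre post, A v = pre ++ w :: post ∧
      ∀ u ∈ pre, u ≠ w ∧ (onS u = false → u ∈ M.order ∧ M.enter u < M.enter w)
  -- Makes initial segments of the preorder closed under parents below `r`, which is needed where
  -- the extension of the stick reads off such a segment.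
  early : ∀ pre w post, M.order = pre ++ w :: post → w ≠ r → ∃ v ∈ pre, M.par w = some v
  chain : (st.map Prod.fst).IsChain fun a b => M.par a = some b
  st_nodup : (st.map Prod.fst).Nodup
  st_mem : ∀ v ∈ st.map Prod.fst, v ∈ M.order
  scanned : ∀ p ∈ st, ∃ done, A p.1 = done ++ p.2 ∧
    ∀ u ∈ done, M.visited u = true ∧ (onS u = false → Related M.par p.1 u)
  closed : ∀ u ∈ M.order, u ∉ st.map Prod.fst → ∀ w ∈ A u,
    M.visited w = true ∧ (onS w = false → Related M.par u w)
  enter_lt : ∀ v ∈ M.order, M.enter v < M.clock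
  leave_lt : ∀ v ∈ M.order, v ∉ st.map Prod.fst → M.leave v < M.clock
  enter_leave : ∀ v ∈ M.order, v ∉ st.map Prod.fst → M.enter v < M.leave v
  -- This field, `open_anc` and `nested` express that the intervals of entry and exit times are
  -- laminar, as the constant time ancestor test requires.
  inside : ∀ u ∈ M.order, u ∉ st.map Prod.fst → ∀ v ∈ M.order, M.enter u ≤ M.enter v →
    M.enter v < M.leave u → Anc M.par u v
  open_anc : ∀ u ∈ st.map Prod.fst, ∀ v ∈ M.order, M.enter u ≤ M.enter v → Anc M.par u v
  nested : ∀ a ∈ M.order, ∀ b ∈ M.order, M.par b = some a → a ∉ st.map Prod.fst →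
    b ∉ st.map Prod.fst ∧ M.leave b < M.leave a
  kids_eq : ∀ v, onS v = false → M.kids v = M.order.countP fun w => M.par w = some v

variable {A : Vertex n → List (Vertex n)} {onS : Vertex n → Bool}
  {par₀ : Vertex n → Option (Vertex n)} {r : Vertex n}
  {st : List (Vertex n × List (Vertex n))} {M : Memory n}

namespace DfsInv

theorem root_mem_order (h : DfsInv A onS par₀ r st M) : r ∈ M.order := by
  obtain ⟨t, ht⟩ := h.root_mem
  simp [ht]

/-- Since visited vertices have visited parents, giving a parent to an unvisited vertex does not
affect ancestry between visited ones. -/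
theorem up_visited (hb : DfsBase A onS par₀ r) (h : DfsInv A onS par₀ r st M) {v u : Vertex n}
    (hv : M.visited v = true) (hp : M.par v = some u) : M.visited u = true := by
  by_cases hS : onS v = true ∨ v = r
  · rw [h.par_eq v hS] at hp
    exact h.vis u (hb.up v hS u hp)
  · push Not at hS
    obtain ⟨x, hx, hxo, _⟩ := h.tree v ((h.mem_order v).2 ⟨hv, by simpa using hS.1⟩) hS.2
    rw [hp] at hx
    cases hx
    exact ((h.mem_order u).1 hxo).1

/-- Proper ancestors, off the stick, have been entered earlier. -/
theorem enter_le (hb : DfsBase A onS par₀ r) (h : DfsInv A onS par₀ r st M) {u v : Vertex n}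
    (huv : Anc M.par u v) (hu : onS u = false) (hv : v ∈ M.order) :
    M.enter u ≤ M.enter v ∧ (u = v ∨ M.enter u < M.enter v) := by
  induction huv with
  | refl => exact ⟨le_rfl, Or.inl rfl⟩
  | @tail p v hp hpv ih =>
    have hpv : M.par v = some p := hpv
    by_cases hr : v = r
    · exfalso
      have hup : ∀ x ∈ {x | onS x = true}, ∀ y, M.par x = some y → y ∈ {x | onS x = true} := by
        intro x hx y hxy
        rw [h.par_eq x (Or.inl hx)] at hxy
        exact hb.up x (Or.inl hx) y hxy
      rw [h.par_eq v (Or.inr hr)] at hpv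
      have := Anc.mem_of_mem hup hp (hb.up v (Or.inr hr) p hpv)
      simp [hu] at this
    · obtain ⟨x, hx, hxo, hlt, _⟩ := h.tree v hv hr
      rw [hpv] at hx
      cases hx
      have := (ih hxo).1
      exact ⟨by omega, Or.inr (by omega)⟩

theorem pop (hb : DfsBase A onS par₀ r) {v : Vertex n}
    (h : DfsInv A onS par₀ r ((v, []) :: st) M) :
    DfsInv A onS par₀ r st { M with
      leave := Function.update M.leave v M.clock
      clock := M.clock + 1 } := by
  have hnd := h.st_nodup
  rw [List.map_cons, List.nodup_cons] at hnd
  have hvo : v ∈ M.order := h.st_mem v (by simp)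
  have hold : ∀ u, u ∉ st.map Prod.fst → u ≠ v → u ∉ ((v, []) :: st).map Prod.fst := by
    intro u hu huv
    rw [List.map_cons, List.mem_cons]
    exact fun h => h.elim huv hu
  refine
    { adj_eq := h.adj_eq, onStick_eq := h.onStick_eq, par_eq := h.par_eq,
      mem_order := h.mem_order, vis := h.vis, nodup := h.nodup, root_mem := h.root_mem,
      tree := h.tree, early := h.early, kids_eq := h.kids_eq, st_nodup := hnd.2
      st_mem := fun u hu => h.st_mem u (by simp only [List.map_cons, List.mem_cons]; exact Or.inr hu)
      scanned := fun p hp => h.scanned p (List.mem_cons_of_mem _ hp)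
      open_anc := fun u hu => h.open_anc u (by
        simp only [List.map_cons, List.mem_cons]; exact Or.inr hu)
      enter_lt := fun u hu => Nat.lt_succ_of_lt (h.enter_lt u hu)
      chain := ?_, closed := ?_, leave_lt := ?_, enter_leave := ?_, inside := ?_, nested := ?_ }
  · have := h.chain
    rw [List.map_cons] at this
    exact this.tail
  · intro u hu hus
    by_cases huv : u = v
    · subst huv
      obtain ⟨done, hd, hdone⟩ := h.scanned (u, []) (by simp)
      simp only [List.append_nil] at hd
      intro w hw
      exact hdone w (hd ▸ hw)
    · exact h.closed u hu (hold u hus huv)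
  · intro u hu hus
    by_cases huv : u = v
    · subst huv
      simp
    · simp only [Function.update_of_ne huv]
      exact Nat.lt_succ_of_lt (h.leave_lt u hu (hold u hus huv))
  · intro u hu hus
    by_cases huv : u = v
    · subst huv
      simpa using h.enter_lt u hu
    · simp only [Function.update_of_ne huv]
      exact h.enter_leave u hu (hold u hus huv)
  · intro u hu hus x hx h1 h2
    by_cases huv : u = v
    · subst huv
      exact h.open_anc u (by simp) x hx h1
    · simp only [Function.update_of_ne huv] at h2
      exact h.inside u hu (hold u hus huv) x hx h1 h2
  · intro a ha b hb' hab has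
    have hab : M.par b = some a := hab
    by_cases hav : a = v
    · subst hav
      have hbr : b ≠ r := by
        rintro rfl
        rw [h.par_eq b (Or.inr rfl)] at hab
        have h1 := hb.up b (Or.inr rfl) a hab
        rw [((h.mem_order a).1 ha).2] at h1
        cases h1
      obtain ⟨x, hx, _, hlt, _⟩ := h.tree b hb' hbr
      rw [hab] at hx
      cases hx
      have hba : b ≠ a := by
        rintro rfl
        exact lt_irrefl _ hlt
      -- The vertices below the top of the stack are ancestors of `a` and were entered no later than
      -- `a`, but the child `b` was entered after `a`.
      have hbs : b ∉ st.map Prod.fst := by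
        intro hbs
        have hch := h.chain
        rw [List.map_cons] at hch
        exact absurd (h.enter_le hb (anc_of_chain hch hbs) ((h.mem_order b).1 hb').2 ha).1
          (not_le.2 hlt)
      refine ⟨hbs, ?_⟩
      simp only [Function.update_of_ne hba, Function.update_self]
      exact h.leave_lt b hb' (hold b hbs hba)
    · have := h.nested a ha b hb' hab (hold a has hav)
      rw [List.map_cons, List.mem_cons, not_or] at this
      refine ⟨this.1.2, ?_⟩
      have hbv : b ≠ v := this.1.1
      simp only [Function.update_of_ne hav, Function.update_of_ne hbv]
      exact this.2

/-- If `w` is open, it is on the stack and thus an ancestor of `v`. If it is closed and off the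
stick, its list contains `v` by symmetry and has been scanned completely, so the pair is already
known to be related. -/
theorem scan (hb : DfsBase A onS par₀ r) {v w : Vertex n} {l : List (Vertex n)}
    (h : DfsInv A onS par₀ r ((v, w :: l) :: st) M) (hw : M.visited w = true) :
    DfsInv A onS par₀ r ((v, l) :: st) M := by
  have hvo : v ∈ M.order := h.st_mem v (by simp)
  refine
    { h with
      scanned := ?_ }
  intro p hp
  rcases List.mem_cons.1 hp with rfl | hp
  · obtain ⟨done, hd, hdone⟩ := h.scanned (v, w :: l) (by simp)
    refine ⟨done ++ [w], by simpa using hd, ?_⟩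
    intro u hu
    rcases List.mem_append.1 hu with hu | hu
    · exact hdone u hu
    · have hu : u = w := by simpa using hu
      subst hu
      refine ⟨hw, fun hS => ?_⟩
      have huo : u ∈ M.order := (h.mem_order u).2 ⟨hw, hS⟩
      by_cases hus : u ∈ ((v, u :: l) :: st).map Prod.fst
      · rw [List.map_cons, List.mem_cons] at hus
        rcases hus with hus | hus
        · exact Or.inl (hus ▸ Anc.refl _ _)
        · have hch := h.chain
          rw [List.map_cons] at hch
          exact Or.inr (anc_of_chain hch hus)
      · have huA : u ∈ A v := by
          rw [show A v = done ++ u :: l from hd]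
          simp
        have hvS := ((h.mem_order v).1 hvo).2
        exact ((h.closed u huo hus v (hb.sym v u hvS hS huA)).2 hvS).symm
  · exact h.scanned p (List.mem_cons_of_mem _ hp)

theorem descend (hb : DfsBase A onS par₀ r) {v w : Vertex n} {l : List (Vertex n)}
    (h : DfsInv A onS par₀ r ((v, w :: l) :: st) M) (hw : ¬ M.visited w = true) :
    DfsInv A onS par₀ r ((w, M.adj w) :: (v, l) :: st) { M with
        visited := Function.update M.visited w true
        par := Function.update M.par w (some v)
        kids := Function.update M.kids v (M.kids v + 1)
        enter := Function.update M.enter w M.clock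
        clock := M.clock + 1
        order := M.order ++ [w] } := by
  have hvo : v ∈ M.order := h.st_mem v (by simp)
  have hwS : onS w = false := by
    by_contra hS
    exact hw (h.vis w (by simpa using hS))
  have hwo : w ∉ M.order := fun hwo => hw ((h.mem_order w).1 hwo).1
  have hne : ∀ u ∈ M.order, u ≠ w := fun u hu huw => hwo (huw ▸ hu)
  have hwr : w ≠ r := (hne r h.root_mem_order).symm
  have hvw : v ≠ w := hne v hvo
  set par' := Function.update M.par w (some v) with hpar'
  -- Only the parent of the unvisited `w` changes, so every statement about visited vertices carries
  -- over from the old tree.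
  have hanc : ∀ x y, M.visited y = true → (Anc par' x y ↔ Anc M.par x y) := by
    intro x y hy
    refine Anc.congr (S := {y | M.visited y = true}) ?_ ?_ hy
    · intro a ha b hab
      exact h.up_visited hb ha hab
    · intro a ha
      have haw : a ≠ w := by
        rintro rfl
        exact hw ha
      exact Function.update_of_ne haw _ _
  have hvis : ∀ x ∈ M.order, M.visited x = true := fun x hx => ((h.mem_order x).1 hx).1
  have hrel : ∀ x y, M.visited x = true → M.visited y = true → Related M.par x y →
      Related par' x y := by
    intro x y hx hy hxy
    exact hxy.imp (hanc x y hy).2 (hanc y x hx).2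
  have hparw : par' w = some v := Function.update_self _ _ _
  have hparne : ∀ x ∈ M.order, par' x = M.par x := fun x hx =>
    Function.update_of_ne (hne x hx) _ _
  have hvisu : ∀ x, M.visited x = true → Function.update M.visited w true x = true := by
    intro x hx
    by_cases hxw : x = w
    · rw [hxw, Function.update_self]
    · rwa [Function.update_of_ne hxw]
  have hent : ∀ x ∈ M.order, Function.update M.enter w M.clock x = M.enter x := fun x hx =>
    Function.update_of_ne (hne x hx) _ _
  have hstk : ∀ u, u ∉ ((w, M.adj w) :: (v, l) :: st).map Prod.fst →
      u ≠ w ∧ u ∉ ((v, w :: l) :: st).map Prod.fst := by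
    intro u hu
    simp only [List.map_cons, List.mem_cons, not_or] at hu ⊢
    exact hu
  have hmem : ∀ u ∈ M.order ++ [w], u ≠ w → u ∈ M.order := by
    intro u hu huw
    simpa [huw] using hu
  obtain ⟨done, hd, hdone⟩ := h.scanned (v, w :: l) (by simp)
  have hd : A v = done ++ w :: l := hd
  have hch := h.chain
  rw [List.map_cons] at hch
  refine
    { adj_eq := h.adj_eq, onStick_eq := h.onStick_eq, par_eq := ?_, mem_order := ?_, vis := ?_,
      nodup := ?_, root_mem := ?_, tree := ?_, early := ?_, chain := ?_, st_nodup := ?_,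
      st_mem := ?_, scanned := ?_, closed := ?_, enter_lt := ?_, leave_lt := ?_,
      enter_leave := ?_, inside := ?_, open_anc := ?_, nested := ?_, kids_eq := ?_ }
  · intro x hx
    have hxw : x ≠ w := by
      rintro rfl
      rcases hx with hx | hx
      · simp [hwS] at hx
      · exact hwr hx
    rw [← h.par_eq x hx]
    exact Function.update_of_ne hxw _ _
  · intro x
    simp only [List.mem_append, List.mem_singleton, h.mem_order x]
    by_cases hxw : x = w
    · subst hxw
      simp [hwS]
    · simp [hxw]
  · intro x hx
    exact hvisu x (h.vis x hx)
  · exact h.nodup.append (List.nodup_singleton _) (by simpa using hwo)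
  · obtain ⟨t, ht⟩ := h.root_mem
    exact ⟨t ++ [w], by simp [ht]⟩
  · intro x hx hxr
    by_cases hxw : x = w
    · subst hxw
      refine ⟨v, hparw, by simp [hvo], ?_, done, l, hd, ?_⟩
      · simp only [hent v hvo, Function.update_self]
        exact h.enter_lt v hvo
      · intro u hu
        have huv := (hdone u hu).1
        refine ⟨?_, fun huS => ?_⟩
        · rintro rfl
          exact hw huv
        · have huo := (h.mem_order u).2 ⟨huv, huS⟩
          refine ⟨by simp [huo], ?_⟩
          simp only [hent u huo, Function.update_self]
          exact h.enter_lt u huo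
    · have hxo := hmem x hx hxw
      obtain ⟨y, hy, hyo, hlt, pre, post, hA, hpre⟩ := h.tree x hxo hxr
      refine ⟨y, (hparne x hxo).trans hy, by simp [hyo], ?_, pre, post, hA, ?_⟩
      · simpa only [hent x hxo, hent y hyo] using hlt
      · intro u hu
        refine ⟨(hpre u hu).1, fun huS => ?_⟩
        obtain ⟨huo, hlt'⟩ := (hpre u hu).2 huS
        exact ⟨by simp [huo], by simpa only [hent x hxo, hent u huo] using hlt'⟩
  · intro pre x post hsplit hxr
    have hsplit : M.order ++ [w] = pre ++ x :: post := hsplit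
    rcases List.eq_nil_or_concat post with rfl | ⟨post', y, rfl⟩
    · have := List.append_inj' hsplit (by simp)
      obtain ⟨rfl, hx⟩ := this
      cases hx
      exact ⟨v, hvo, hparw⟩
    · have hs : M.order ++ [w] = (pre ++ x :: post') ++ [y] := by simpa using hsplit
      obtain ⟨hs, _⟩ := List.append_inj' hs (by simp)
      obtain ⟨z, hz, hzx⟩ := h.early pre x post' hs hxr
      have hxo : x ∈ M.order := by simp [hs]
      exact ⟨z, hz, (hparne x hxo).trans hzx⟩
  · have hch' : ((v :: st.map Prod.fst)).IsChain fun a b => par' a = some b := by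
      have hmemo : ∀ x ∈ v :: st.map Prod.fst, x ∈ M.order := fun x hx => h.st_mem x (by simpa using hx)
      refine hch.imp_of_mem_imp fun a b ha hb hab => ?_
      rw [hparne a (hmemo a ha)]
      exact hab
    simp only [List.map_cons] at hch' ⊢
    exact List.isChain_cons_cons.2 ⟨hparw, hch'⟩
  · simp only [List.map_cons]
    refine List.nodup_cons.2 ⟨fun hws => hwo (h.st_mem w (by simpa using hws)), ?_⟩
    simpa using h.st_nodup
  · intro x hx
    simp only [List.map_cons, List.mem_cons] at hx
    rcases hx with hx | hx
    · simp [hx]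
    · exact List.mem_append_left _ (h.st_mem x (by simpa using hx))
  · intro p hp
    rcases List.mem_cons.1 hp with rfl | hp
    · exact ⟨[], by simp [h.adj_eq], by simp⟩
    rcases List.mem_cons.1 hp with rfl | hp
    · refine ⟨done ++ [w], by simpa using hd, ?_⟩
      intro u hu
      rcases List.mem_append.1 hu with hu | hu
      · obtain ⟨h1, h2⟩ := hdone u hu
        exact ⟨hvisu u h1, fun hS => hrel v u (hvis v hvo) h1 (h2 hS)⟩
      · have hu : u = w := by simpa using hu
        subst hu
        exact ⟨Function.update_self _ _ _, fun _ => Or.inl (Anc.of_par hparw)⟩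
    · obtain ⟨done', hd', hdone'⟩ := h.scanned p (List.mem_cons_of_mem _ hp)
      refine ⟨done', hd', fun u hu => ?_⟩
      obtain ⟨h1, h2⟩ := hdone' u hu
      have hpo : p.1 ∈ M.order :=
        h.st_mem p.1 (List.mem_map_of_mem (List.mem_cons_of_mem _ hp))
      exact ⟨hvisu u h1, fun hS => hrel p.1 u (hvis _ hpo) h1 (h2 hS)⟩
  · intro u hu hus x hx
    obtain ⟨huw, hus⟩ := hstk u hus
    have huo := hmem u hu huw
    obtain ⟨h1, h2⟩ := h.closed u huo hus x hx
    exact ⟨hvisu x h1, fun hS => hrel u x (hvis u huo) h1 (h2 hS)⟩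
  · intro u hu
    by_cases huw : u = w
    · subst huw
      simp
    · have huo := hmem u hu huw
      simp only [hent u huo]
      exact Nat.lt_succ_of_lt (h.enter_lt u huo)
  · intro u hu hus
    obtain ⟨huw, hus⟩ := hstk u hus
    exact Nat.lt_succ_of_lt (h.leave_lt u (hmem u hu huw) hus)
  · intro u hu hus
    obtain ⟨huw, hus⟩ := hstk u hus
    have huo := hmem u hu huw
    simp only [hent u huo]
    exact h.enter_leave u huo hus
  · intro u hu hus x hx h1 h2
    obtain ⟨huw, hus⟩ := hstk u hus
    have huo := hmem u hu huw
    simp only [hent u huo] at h1 h2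
    by_cases hxw : x = w
    · subst hxw
      simp only [Function.update_self] at h2
      have := h.leave_lt u huo hus
      omega
    · have hxo := hmem x hx hxw
      simp only [hent x hxo] at h1 h2
      exact (hanc u x (hvis x hxo)).2 (h.inside u huo hus x hxo h1 h2)
  · intro u hu x hx h1
    simp only [List.map_cons, List.mem_cons] at hu
    by_cases hxw : x = w
    · subst hxw
      rcases hu with hu | hu
      · exact hu ▸ Anc.refl _ _
      · refine Anc.child ?_ hparw
        rw [hanc u v (hvis v hvo)]
        rcases hu with hu | hu
        · exact hu ▸ Anc.refl _ _
        · exact anc_of_chain hch hu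
    · have hxo := hmem x hx hxw
      rcases hu with hu | hu
      · subst hu
        simp only [Function.update_self, hent x hxo] at h1
        have := h.enter_lt x hxo
        omega
      · have hu : u ∈ ((v, w :: l) :: st).map Prod.fst := by simpa using hu
        simp only [hent x hxo, hent u (h.st_mem u hu)] at h1
        exact (hanc u x (hvis x hxo)).2 (h.open_anc u hu x hxo h1)
  · intro a ha b hb' hab has
    obtain ⟨haw, has'⟩ := hstk a has
    have hao := hmem a ha haw
    by_cases hbw : b = w
    · subst hbw
      exfalso
      have hab : par' b = some a := hab
      rw [hparw] at hab
      cases hab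
      simp at has
    · have hbo := hmem b hb' hbw
      have hab : M.par b = some a := (hparne b hbo).symm.trans hab
      obtain ⟨h1, h2⟩ := h.nested a hao b hbo hab has'
      refine ⟨?_, h2⟩
      simp only [List.map_cons, List.mem_cons, not_or] at h1 ⊢
      exact ⟨hbw, h1⟩
  · intro x hx
    have hcount : M.order.countP (fun y => par' y = some x) =
        M.order.countP (fun y => M.par y = some x) := by
      refine List.countP_congr fun y hy => ?_
      rw [hparne y hy]
    simp only [List.countP_append, hcount, List.countP_singleton, hparw, ← h.kids_eq x hx]
    by_cases hxv : x = v
    · subst hxv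
      simp
    · simp [Function.update_of_ne hxv, Ne.symm hxv]

end DfsInv

theorem dfs_inv (hb : DfsBase A onS par₀ r) (h : DfsInv A onS par₀ r st M) :
    DfsInv A onS par₀ r [] (dfs st M).val := by
  induction st, M using dfs.induct with
  | case1 M => rw [dfs]; exact h
  | case2 M v st ih =>
    rw [dfs]
    exact ih (h.pop hb)
  | case3 M v w l st hw ih =>
    rw [dfs, dif_pos hw]
    exact ih (h.scan hb hw)
  | case4 M v w l st hw ih =>
    rw [dfs, dif_neg hw]
    exact ih (h.descend hb hw)

/-- The potential that bounds the running time of the traversal. -/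
def potential (st : List (Vertex n × List (Vertex n))) (M : Memory n) : ℕ :=
  (∑ v : Vertex n, if M.visited v = true then 0 else (M.adj v).length + 2) +
    (st.map fun p => p.2.length + 1).sum

/-- The weight `length + 2` of an unvisited vertex pays for the stack entry of weight `length + 1`
that replaces it, with something left for the step itself. -/
theorem potential_descend {v w : Vertex n} {l : List (Vertex n)} (hw : ¬ M.visited w = true)
    {M' : Memory n} (hadj : M'.adj = M.adj) (hvis : M'.visited = Function.update M.visited w true) :
    potential ((w, M.adj w) :: (v, l) :: st) M' + 1 ≤ potential ((v, w :: l) :: st) M := by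
  have key : (∑ u : Vertex n, if Function.update M.visited w true u = true then 0
        else (M.adj u).length + 2) + ((M.adj w).length + 2)
      = ∑ u : Vertex n, if M.visited u = true then 0 else (M.adj u).length + 2 := by
    rw [← Finset.add_sum_erase _ _ (Finset.mem_univ w),
      ← Finset.add_sum_erase (a := w) Finset.univ
        (fun u => if M.visited u = true then 0 else (M.adj u).length + 2) (Finset.mem_univ w)]
    have hrest : ∀ u ∈ Finset.univ.erase w,
        (if Function.update M.visited w true u = true then 0 else (M.adj u).length + 2)
          = if M.visited u = true then 0 else (M.adj u).length + 2 := by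
      intro u hu
      rw [Function.update_of_ne (Finset.ne_of_mem_erase hu)]
    rw [Finset.sum_congr rfl hrest]
    simp [hw]
    ring
  simp only [potential, hadj, hvis, List.map_cons, List.sum_cons, List.length_cons]
  omega

theorem dfs_time (st : List (Vertex n × List (Vertex n))) (M : Memory n) :
    (dfs st M).time ≤ potential st M := by
  induction st, M using dfs.induct with
  | case1 M => rw [dfs]; exact Nat.zero_le _
  | case2 M v st ih =>
    rw [dfs]
    change 1 + (dfs _ _).time ≤ _
    simp only [potential, List.map_cons, List.sum_cons, List.length_nil] at ih ⊢
    omega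
  | case3 M v w l st hw ih =>
    rw [dfs, dif_pos hw]
    change 1 + (dfs _ _).time ≤ _
    simp only [potential, List.map_cons, List.sum_cons, List.length_cons] at ih ⊢
    omega
  | case4 M v w l st hw ih =>
    rw [dfs, dif_neg hw]
    change 1 + (dfs _ _).time ≤ _
    have := potential_descend (st := st) (v := v) (l := l) hw
      (M' := { M with
        visited := Function.update M.visited w true
        par := Function.update M.par w (some v)
        kids := Function.update M.kids v (M.kids v + 1)
        enter := Function.update M.enter w M.clock
        clock := M.clock + 1
        order := M.order ++ [w] }) rfl rfl
    omega

end Search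

/-! ### Values and running times of the remaining loops. -/

section Loops

variable {n : ℕ}

/-- The entry `w` of the adjacency list of `v` is not a non-tree edge incident on the stick. -/
def Keep (onS : Vertex n → Bool) (par : Vertex n → Option (Vertex n)) (v w : Vertex n) : Prop :=
  ¬ ((onS v = true ∨ onS w = true) ∧ ¬ (par v = some w ∨ par w = some v))

instance (onS : Vertex n → Bool) (par : Vertex n → Option (Vertex n)) (v : Vertex n) :
    DecidablePred (Keep onS par v) := fun w => by
  unfold Keep
  infer_instance

theorem clear_val (l : List (Vertex n)) (M : Memory n) :
    (clear l M).val = { M with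
      visited := fun v => if v ∈ l then false else M.visited v
      kids := fun v => if v ∈ l then 0 else M.kids v } := by
  induction l generalizing M with
  | nil => simp [clear, pure]
  | cons a l ih =>
    change (clear l _).val = _
    rw [ih]
    congr 1 <;>
    · funext v
      by_cases h1 : v = a
      · subst h1
        simp
      · simp [h1]

theorem clear_time (l : List (Vertex n)) (M : Memory n) : (clear l M).time = l.length := by
  induction l generalizing M with
  | nil => rfl
  | cons a l ih =>
    change 1 + (clear l _).time = _
    rw [ih, List.length_cons, add_comm]

theorem extendStick_val {pre rest : List (Vertex n)} {v : Vertex n} {M : Memory n}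
    (hpre : ∀ u ∈ pre, M.kids u = 1) (hv : M.kids v ≠ 1) :
    (extendStick (pre ++ v :: rest) M).val = { M with
      onStick := fun u => if u ∈ pre then true else M.onStick u
      root := v
      bris := v :: rest } := by
  induction pre generalizing M with
  | nil =>
    rw [List.nil_append, extendStick, if_neg hv]
    simp [bind, pure]
  | cons a pre ih =>
    rw [List.cons_append, extendStick, if_pos (hpre a (by simp))]
    change (extendStick (pre ++ v :: rest) _).val = _
    rw [ih (M := { M with onStick := Function.update M.onStick a true })
      (fun u hu => hpre u (List.mem_cons_of_mem _ hu)) hv]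
    congr 1
    funext u
    by_cases h1 : u = a
    · subst h1
      simp
    · simp [h1]

theorem extendStick_time (L : List (Vertex n)) (M : Memory n) :
    (extendStick L M).time ≤ L.length := by
  induction L generalizing M with
  | nil => exact le_rfl
  | cons a L ih =>
    rw [extendStick]
    split_ifs with h
    · change 1 + (extendStick L _).time ≤ _
      have := ih { M with onStick := Function.update M.onStick a true }
      rw [List.length_cons]
      omega
    · change 1 + 0 ≤ _
      simp

theorem pruneList_val (v : Vertex n) (L : List (Vertex n)) (M : Memory n) :
    (pruneList v L M).val = { M with
      adj := Function.update M.adj v (M.adj v ++ L.filter (Keep M.onStick M.par v)) } := by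
  induction L generalizing M with
  | nil => simp [pruneList, pure]
  | cons w L ih =>
    rw [pruneList]
    split_ifs with h
    · change (pruneList v L M).val = _
      rw [ih, List.filter_cons_of_neg (by rw [decide_eq_true_eq]; exact not_not.2 h)]
    · change (pruneList v L _).val = _
      rw [ih, List.filter_cons_of_pos (p := fun w => decide (Keep M.onStick M.par v w))
        (decide_eq_true (show Keep _ _ _ _ from h))]
      simp

theorem pruneList_time (v : Vertex n) (L : List (Vertex n)) (M : Memory n) :
    (pruneList v L M).time = L.length := by
  induction L generalizing M with
  | nil => rfl
  | cons w L ih =>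
    rw [pruneList]
    split_ifs with h
    · change 1 + (pruneList v L M).time = _
      rw [ih, List.length_cons, add_comm]
    · change 1 + (pruneList v L _).time = _
      rw [ih, List.length_cons, add_comm]

theorem prune_cons_val (v : Vertex n) (vs : List (Vertex n)) (M : Memory n) :
    (prune (v :: vs) M).val = (prune vs { M with
      adj := Function.update M.adj v ((M.adj v).filter (Keep M.onStick M.par v)) }).val := by
  change (prune vs (pruneList v (M.adj v) _).val).val = _
  rw [pruneList_val]
  simp

theorem prune_val {vs : List (Vertex n)} (hvs : vs.Nodup) (M : Memory n) :
    (prune vs M).val = { M with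
      adj := fun v => if v ∈ vs then (M.adj v).filter (Keep M.onStick M.par v) else M.adj v } := by
  induction vs generalizing M with
  | nil => simp [prune, pure]
  | cons a vs ih =>
    rw [List.nodup_cons] at hvs
    rw [prune_cons_val, ih hvs.2]
    congr 1
    funext v
    by_cases h1 : v = a
    · subst h1
      simp [hvs.1]
    · simp [h1]

theorem prune_time {vs : List (Vertex n)} (hvs : vs.Nodup) (M : Memory n) :
    (prune vs M).time = (vs.map fun v => 1 + (M.adj v).length).sum := by
  induction vs generalizing M with
  | nil => rfl
  | cons a vs ih =>
    rw [List.nodup_cons] at hvs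
    change 1 + ((pruneList a (M.adj a) _).time + (prune vs (pruneList a (M.adj a) _).val).time) = _
    rw [pruneList_time, ih hvs.2, pruneList_val, List.map_cons, List.sum_cons, ← add_assoc]
    congr 2
    refine List.map_congr_left fun v hv => ?_
    have : v ≠ a := fun h => hvs.1 (h ▸ hv)
    simp [this]

theorem exists_split {α : Type*} {p : α → Prop} [DecidablePred p] {L : List α}
    (h : ∃ x ∈ L, ¬ p x) : ∃ pre v rest, L = pre ++ v :: rest ∧ (∀ u ∈ pre, p u) ∧ ¬ p v := by
  induction L with
  | nil => simp at h
  | cons a L ih =>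
    by_cases ha : p a
    · obtain ⟨x, hx, hpx⟩ := h
      have hxL : x ∈ L := by
        rcases List.mem_cons.1 hx with rfl | hx
        · exact absurd ha hpx
        · exact hx
      obtain ⟨pre, v, rest, rfl, h1, h2⟩ := ih ⟨x, hxL, hpx⟩
      refine ⟨a :: pre, v, rest, rfl, ?_, h2⟩
      intro u hu
      rcases List.mem_cons.1 hu with rfl | hu
      · exact ha
      · exact h1 u hu
    · exact ⟨[], a, L, rfl, by simp, ha⟩

/-- Translates the counter of children into the unique existence used in the definition of the
stick. -/
theorem countP_eq_one_iff {α : Type*} {p : α → Prop} [DecidablePred p] {L : List α}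
    (hL : L.Nodup) : (L.countP fun x => p x) = 1 ↔ ∃! x, x ∈ L ∧ p x := by
  classical
  rw [List.countP_eq_length_filter, ← List.toFinset_card_of_nodup (hL.filter _),
    Finset.card_eq_one]
  constructor
  · rintro ⟨a, ha⟩
    have hmem : ∀ x, (x ∈ L ∧ p x) ↔ x = a := by
      intro x
      rw [← Finset.mem_singleton, ← ha]
      simp
    exact ⟨a, (hmem a).2 rfl, fun y hy => (hmem y).1 hy⟩
  · rintro ⟨a, ha, hu⟩
    refine ⟨a, ?_⟩
    ext x
    simp only [List.mem_toFinset, List.mem_filter, decide_eq_true_eq, Finset.mem_singleton]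
    exact ⟨fun h => hu x h, fun h => h ▸ ha⟩

end Loops

/-! ### The invariants of the algorithm -/

section Invariants

variable {n : ℕ}

/-- The state in which the bristles may be rebuilt. -/
structure Ready (l : List (Edge n)) (M : Memory n) : Prop where
  list_nodup : l.Nodup
  par_none : M.par none = none
  span : ∀ v, (M.onStick v = true ∨ v = M.root) → Anc M.par none v
  root : M.onStick M.root = false
  up : ∀ v, (M.onStick v = true ∨ v = M.root) → ∀ u, M.par v = some u → M.onStick u = true
  child : ∀ v, M.onStick v = true → ∃! c, M.par c = some v
  child_mem : ∀ v, M.onStick v = true → ∀ c, M.par c = some v → M.onStick c = true ∨ c = M.root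
  bris_nodup : M.bris.Nodup
  mem_bris : ∀ v, v ∈ M.bris ↔ M.onStick v = false
  vis : ∀ v, M.onStick v = true → M.visited v = true
  adj : ∀ v, M.adj v = (nbrs l v).filter (Keep M.onStick M.par v)
  conn : ∀ v, M.onStick v = false → Relation.ReflTransGen (fun a b => (graph l).Adj a b ∧
    M.onStick a = false ∧ M.onStick b = false) M.root v
  tree_edge : ∀ v, (M.onStick v = true ∨ v = M.root) → ∀ u, M.par v = some u → (graph l).Adj u v
  -- The form that `FirstChild` takes on the stick. It speaks of ancestors of `a`, which a
  -- rebuilding leaves alone, and not of the subtree of `b`, which it may replace.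
  lex : ∀ a b, M.onStick a = true → M.par b = some a → ∀ pre post, nbrs l a = pre ++ b :: post →
    ∀ u ∈ pre, M.onStick u = true ∧ Anc M.par u a

/-- Every child of a vertex `a` is the first vertex of its subtree in the list of `a`. -/
def FirstChild (l : List (Edge n)) (par : Vertex n → Option (Vertex n)) : Prop :=
  ∀ a b, par b = some a → ∀ pre post, nbrs l a = pre ++ b :: post → ∀ u ∈ pre, ¬ Anc par b u

/-- The invariant that holds after every insertion. -/
structure Inv (l : List (Edge n)) (M : Memory n) : Prop where
  list_nodup : l.Nodup
  dfsTree : IsDFSTree (graph l) none M.par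
  lex : FirstChild l M.par
  mem_stick : ∀ v, v ∈ stick M.par ↔ M.onStick v = true
  root : M.onStick M.root = false
  child_mem : ∀ v, M.onStick v = true → ∀ c, M.par c = some v → M.onStick c = true ∨ c = M.root
  below : ∀ v, M.onStick v = false → Anc M.par M.root v
  up_root : ∀ u, M.par M.root = some u → M.onStick u = true
  bris_nodup : M.bris.Nodup
  mem_bris : ∀ v, v ∈ M.bris ↔ M.onStick v = false
  vis : ∀ v, M.visited v = true
  adj : ∀ v, M.adj v = (nbrs l v).filter (Keep M.onStick M.par v)
  -- Restricted to the bristles, since each traversal restarts the clock and the times stored on the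
  -- stick may be older.
  anc_test : ∀ x y, M.onStick x = false → M.onStick y = false →
    (ancTest M x y = true ↔ Anc M.par x y)

/-- The memory when the traversal begins. -/
def searchStart (M : Memory n) : Memory n :=
  let M₁ := (clear M.bris M).val
  { M₁ with
    visited := Function.update M₁.visited M₁.root true
    enter := Function.update M₁.enter M₁.root 0
    clock := 1
    order := [M₁.root] }

/-- The memory when the traversal is over. -/
def searched (M : Memory n) : Memory n := (dfs [(M.root, M.adj M.root)] (searchStart M)).val

variable {l : List (Edge n)} {M : Memory n}

theorem Ready.mem_adj (h : Ready l M) {v w : Vertex n} (hv : M.onStick v = false)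
    (hw : M.onStick w = false) : w ∈ M.adj v ↔ (graph l).Adj v w := by
  rw [h.adj, List.mem_filter, mem_nbrs]
  simp [Keep, hv, hw]

theorem Ready.dfsBase (h : Ready l M) : DfsBase M.adj M.onStick M.par M.root where
  sym v w hv hw hvw := by
    rw [h.mem_adj hw hv]
    exact ((h.mem_adj hv hw).1 hvw).symm
  root := h.root
  up := h.up

theorem Ready.none_mem (h : Ready l M) : M.onStick none = true ∨ none = M.root := by
  have := h.span M.root (Or.inr rfl)
  rcases anc_iff.1 this with h1 | ⟨p, hp, hr⟩
  · exact Or.inr h1.symm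
  · exact Or.inl (Anc.mem_of_mem (S := {v | M.onStick v = true})
      (fun v hv u hu => h.up v (Or.inl hv) u hu) hp (h.up M.root (Or.inr rfl) p hr))

theorem Ready.dfsInv_start (h : Ready l M) :
    DfsInv M.adj M.onStick M.par M.root [(M.root, M.adj M.root)] (searchStart M) := by
  have hval := clear_val M.bris M
  have hvis : ∀ v, (searchStart M).visited v = true ↔ (M.onStick v = true ∨ v = M.root) := by
    intro v
    simp only [searchStart, hval]
    by_cases hv : v = M.root
    · simp [hv]
    · rw [Function.update_of_ne hv]
      by_cases hS : M.onStick v = true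
      · simp [h.mem_bris, hS, h.vis v hS]
      · simp [h.mem_bris, hS, hv]
  have horder : (searchStart M).order = [M.root] := by simp only [searchStart, hval]
  have hpar : (searchStart M).par = M.par := by simp only [searchStart, hval]
  have hkids : ∀ v, M.onStick v = false → (searchStart M).kids v = 0 := by
    intro v hv
    simp [searchStart, hval, h.mem_bris, hv]
  have henter : (searchStart M).enter M.root = 0 := by simp [searchStart, hval]
  have hclock : (searchStart M).clock = 1 := rfl
  refine
    { adj_eq := by simp only [searchStart, hval]
      onStick_eq := by simp only [searchStart, hval]
      par_eq := fun v _ => by rw [hpar]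
      mem_order := ?_
      vis := fun v hv => (hvis v).2 (Or.inl hv)
      nodup := by rw [horder]; exact List.nodup_singleton _
      root_mem := ⟨[], horder⟩
      tree := ?_, early := ?_
      chain := List.isChain_singleton _
      st_nodup := List.nodup_singleton _
      st_mem := ?_, scanned := ?_, closed := ?_, enter_lt := ?_, leave_lt := ?_, enter_leave := ?_,
      inside := ?_, open_anc := ?_, nested := ?_, kids_eq := ?_ }
  · intro v
    rw [horder, List.mem_singleton, hvis]
    constructor
    · rintro rfl
      exact ⟨Or.inr rfl, h.root⟩
    · rintro ⟨h1 | h1, h2⟩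
      · simp [h1] at h2
      · exact h1
  · intro w hw hwr
    rw [horder, List.mem_singleton] at hw
    exact absurd hw hwr
  · intro pre w post hs hwr
    have : w ∈ (searchStart M).order := by simp [hs]
    rw [horder, List.mem_singleton] at this
    exact absurd this hwr
  · simp [horder]
  · simp
  · simp [horder]
  · simp [horder, henter, hclock]
  · simp [horder]
  · simp [horder]
  · simp [horder]
  · simp only [List.map_cons, List.map_nil, List.mem_singleton, horder]
    rintro u rfl v rfl _
    exact Anc.refl _ _
  · simp [horder]
  · intro v hv
    rw [hkids v hv, horder, hpar, List.countP_singleton]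
    have : M.par M.root ≠ some v := by
      intro hp
      have := h.up M.root (Or.inr rfl) v hp
      simp [hv] at this
    simp [this]

theorem Ready.dfsInv (h : Ready l M) :
    DfsInv M.adj M.onStick M.par M.root [] (searched M) :=
  dfs_inv h.dfsBase h.dfsInv_start

/-- With the stack empty, the visited vertices off the stick are closed under adjacency off the
stick, and `conn` leads from the root to any vertex there. -/
theorem Ready.mem_order (h : Ready l M) (v : Vertex n) :
    v ∈ (searched M).order ↔ M.onStick v = false := by
  have hi := h.dfsInv
  refine ⟨fun hv => ((hi.mem_order v).1 hv).2, fun hv => ?_⟩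
  induction h.conn v hv with
  | refl => exact hi.root_mem_order
  | @tail a b _ hab ih =>
    obtain ⟨hadj, ha, hb⟩ := hab
    have := hi.closed a (ih ha) (by simp) b ((h.mem_adj ha hb).2 hadj)
    exact (hi.mem_order b).2 ⟨this.1, hb⟩

theorem Ready.searched_visited (h : Ready l M) (v : Vertex n) : (searched M).visited v = true := by
  by_cases hv : M.onStick v = true
  · exact h.dfsInv.vis v hv
  · exact ((h.dfsInv.mem_order v).1 ((h.mem_order v).2 (by simpa using hv))).1

theorem Ready.searched_par_eq (h : Ready l M) {v : Vertex n}
    (hv : M.onStick v = true ∨ v = M.root) : (searched M).par v = M.par v :=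
  h.dfsInv.par_eq v hv

theorem Ready.searched_par_off (h : Ready l M) {v : Vertex n} (hv : M.onStick v = false)
    (hr : v ≠ M.root) : ∃ u, (searched M).par v = some u ∧ M.onStick u = false ∧
      (graph l).Adj u v := by
  obtain ⟨u, hu, huo, _, pre, post, hA, _⟩ := h.dfsInv.tree v ((h.mem_order v).2 hv) hr
  have huS := (h.mem_order u).1 huo
  exact ⟨u, hu, huS, (h.mem_adj huS hv).1 (by rw [hA]; simp)⟩

theorem Ready.searched_up (h : Ready l M) {v u : Vertex n} (hv : M.onStick v = true ∨ v = M.root)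
    (hp : (searched M).par v = some u) : M.onStick u = true := by
  rw [h.searched_par_eq hv] at hp
  exact h.up v hv u hp

/-- The children of the vertices of the stick are kept. -/
theorem Ready.child_iff (h : Ready l M) {v : Vertex n} (hv : M.onStick v = true) (w : Vertex n) :
    (searched M).par w = some v ↔ M.par w = some v := by
  by_cases hw : M.onStick w = true ∨ w = M.root
  · rw [h.searched_par_eq hw]
  · constructor
    · intro hp
      push Not at hw
      obtain ⟨u, hu, huS, _⟩ := h.searched_par_off (by simpa using hw.1) hw.2
      rw [hp] at hu
      cases hu
      simp [hv] at huS
    · intro hp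
      exact absurd (h.child_mem v hv w hp) hw

theorem Ready.searched_none (h : Ready l M) : (searched M).par none = none :=
  (h.searched_par_eq h.none_mem).trans h.par_none

theorem Ready.anc_iff_of_mem (h : Ready l M) {u v : Vertex n}
    (hv : M.onStick v = true ∨ v = M.root) : Anc (searched M).par u v ↔ Anc M.par u v :=
  Anc.congr (S := {v | M.onStick v = true ∨ v = M.root})
    (fun v hv u hu => Or.inl (h.up v hv u hu)) (fun _ hv => h.searched_par_eq hv) hv

/-- New parents are entered strictly earlier than their children, so the induction is on the entry
time. -/
theorem Ready.searched_span (h : Ready l M) (v : Vertex n) : Anc (searched M).par none v := by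
  by_cases hv : M.onStick v = true ∨ v = M.root
  · exact (h.anc_iff_of_mem hv).2 (h.span v hv)
  · push Not at hv
    induction hk : (searched M).enter v using Nat.strong_induction_on generalizing v with
    | _ k ih =>
      obtain ⟨u, hu, huo, hlt, _⟩ :=
        h.dfsInv.tree v ((h.mem_order v).2 (by simpa using hv.1)) hv.2
      refine Anc.child ?_ hu
      by_cases hur : M.onStick u = true ∨ u = M.root
      · exact (h.anc_iff_of_mem hur).2 (h.span u hur)
      · push Not at hur
        exact ih _ (hk ▸ hlt) u hur rfl

theorem Ready.searched_related (h : Ready l M) {u v : Vertex n} (hu : M.onStick u = false)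
    (hv : M.onStick v = false) (huv : (graph l).Adj u v) : Related (searched M).par u v :=
  (h.dfsInv.closed u ((h.mem_order u).2 hu) (by simp) v ((h.mem_adj hu hv).2 huv)).2 hv

theorem Ready.searched_tree_edge (h : Ready l M) {u v : Vertex n}
    (hp : (searched M).par v = some u) : (graph l).Adj u v := by
  by_cases hv : M.onStick v = true ∨ v = M.root
  · rw [h.searched_par_eq hv] at hp
    exact h.tree_edge v hv u hp
  · push Not at hv
    obtain ⟨x, hx, _, hadj⟩ := h.searched_par_off (by simpa using hv.1) hv.2
    rw [hp] at hx
    cases hx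
    exact hadj

theorem Ready.not_anc_up (h : Ready l M) {b u : Vertex n} (hb : M.onStick b = false)
    (hu : M.onStick u = true) : ¬ Anc (searched M).par b u := by
  intro hbu
  have := Anc.mem_of_mem (S := {v | M.onStick v = true})
    (fun v hv u hu => h.searched_up (Or.inl hv) hu) hbu hu
  simp [hb] at this

/-- If `a` is on the stick, an entry before `b` is an ancestor of `a` and cannot lie below its child
`b`. If `a` is in the bristles, an entry before `b` is on the stick, which contains no descendant of
`b`, or was entered before `b`, whereas descendants are entered later. -/
theorem Ready.searched_firstChild (h : Ready l M) : FirstChild l (searched M).par := by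
  intro a b hab pre post hsplit u hu hbu
  by_cases ha : M.onStick a = true
  · have hab' := (h.child_iff ha b).1 hab
    obtain ⟨h1, h2⟩ := h.lex a b ha hab' pre post hsplit u hu
    rw [← h.anc_iff_of_mem (Or.inl ha)] at h2
    exact Anc.not_of_par h.searched_none (h.searched_span b) hab (hbu.trans h2)
  · have ha' : M.onStick a = false := by simpa using ha
    have hb : ¬ (M.onStick b = true ∨ b = M.root) := fun hb => ha (h.searched_up hb hab)
    push Not at hb
    have hb' : M.onStick b = false := by simpa using hb.1
    by_cases hus : M.onStick u = true
    · exact h.not_anc_up hb' hus hbu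
    · have hus' : M.onStick u = false := by simpa using hus
      obtain ⟨x, hx, _, _, pre', post', hA, hpre'⟩ :=
        h.dfsInv.tree b ((h.mem_order b).2 hb') hb.2
      rw [hab] at hx
      cases hx
      -- The traversal sees the pruned list. As `b` occurs only once, what precedes it there is the
      -- filtered form of what precedes it in the full list.
      rw [h.adj, hsplit, List.filter_append, List.filter_cons_of_pos (by simp [Keep, ha', hb'])] at hA
      have hnd := nodup_nbrs h.list_nodup a
      rw [hsplit] at hnd
      have hbpre : b ∉ pre := fun hbp => (List.disjoint_of_nodup_append hnd) hbp (by simp)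
      have hbpost : b ∉ post := (List.nodup_cons.1 (List.nodup_append.1 hnd).2.1).1
      have heq := (List.append_cons_inj_of_notMem
        (fun hbp => hbpre (List.mem_filter.1 hbp).1)
        (fun hbp => hbpost (List.mem_filter.1 hbp).1)).1 hA
      have hu' : u ∈ pre' := by
        rw [← heq.1]
        simp [hu, Keep, ha', hus']
      have h1 := ((hpre' u hu').2 hus').2
      have h2 := (h.dfsInv.enter_le h.dfsBase hbu hb' ((h.mem_order u).2 hus')).1
      omega

/-- One direction is laminarity. For the other, entry times increase and exit times decrease along a
path downwards. -/
theorem Ready.searched_ancTest (h : Ready l M) {x y : Vertex n} (hx : M.onStick x = false)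
    (hy : M.onStick y = false) : ancTest (searched M) x y = true ↔ Anc (searched M).par x y := by
  have hi := h.dfsInv
  have hxo := (h.mem_order x).2 hx
  have hyo := (h.mem_order y).2 hy
  simp only [ancTest, Bool.and_eq_true, decide_eq_true_eq]
  constructor
  · rintro ⟨h1, h2⟩
    exact hi.inside x hxo (by simp) y hyo h1
      (lt_of_lt_of_le (hi.enter_leave y hyo (by simp)) h2)
  · intro hxy
    refine ⟨(hi.enter_le h.dfsBase hxy hx hyo).1, ?_⟩
    induction hxy with
    | refl => exact le_rfl
    | @tail p y hxp hpy ih =>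
      have hpS : M.onStick p = false := by
        by_contra hp
        exact h.not_anc_up hx (by simpa using hp) hxp
      have hpo := (h.mem_order p).2 hpS
      exact le_trans (hi.nested p hpo y hyo hpy (by simp)).2.le (ih hpS hpo)

end Invariants

/-! ### The result of a rebuilding, and the invariant along a sequence of insertions. -/

section Rebuild

variable {n : ℕ} {l : List (Edge n)} {M : Memory n}

theorem Ready.searched_adj (h : Ready l M) : (searched M).adj = M.adj := h.dfsInv.adj_eq

theorem Ready.searched_onStick (h : Ready l M) : (searched M).onStick = M.onStick :=
  h.dfsInv.onStick_eq

theorem Ready.kids_eq_one_iff (h : Ready l M) {v : Vertex n} (hv : M.onStick v = false) :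
    (searched M).kids v = 1 ↔ ∃! c, (searched M).par c = some v := by
  rw [h.dfsInv.kids_eq v hv, countP_eq_one_iff h.dfsInv.nodup]
  refine existsUnique_congr fun c => and_iff_right_of_imp fun hc => ?_
  rw [h.mem_order]
  by_contra hS
  have := h.searched_up (Or.inl (by simpa using hS)) hc
  simp [hv] at this

/-- Where the extension of the stick stops. -/
theorem Ready.exists_last (h : Ready l M) : ∃ pre v rest, (searched M).order = pre ++ v :: rest ∧
    (∀ u ∈ pre, (searched M).kids u = 1) ∧ (searched M).kids v ≠ 1 := by
  refine exists_split ?_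
  -- The vertex entered last has no child, since a child would be entered later. So the walk stops
  -- there at the latest.
  obtain ⟨x, hx, hmax⟩ := Finset.exists_max_image (searched M).order.toFinset (searched M).enter
    ⟨M.root, by simpa using h.dfsInv.root_mem_order⟩
  rw [List.mem_toFinset] at hx
  refine ⟨x, hx, fun hk => ?_⟩
  have hxS := (h.mem_order x).1 hx
  obtain ⟨c, hc, _⟩ := (h.kids_eq_one_iff hxS).1 hk
  have hcr : ¬ (M.onStick c = true ∨ c = M.root) := by
    intro hcr
    have := h.searched_up hcr hc
    simp [hxS] at this
  push Not at hcr
  have hco : c ∈ (searched M).order := (h.mem_order c).2 (by simpa using hcr.1)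
  obtain ⟨y, hy, _, hlt, _⟩ := h.dfsInv.tree c hco hcr.2
  rw [hc] at hy
  cases hy
  have := hmax c (by simpa using hco)
  omega

theorem rebuild_val (h : Ready l M) {pre rest : List (Vertex n)} {v : Vertex n}
    (ho : (searched M).order = pre ++ v :: rest) (hpre : ∀ u ∈ pre, (searched M).kids u = 1)
    (hv : (searched M).kids v ≠ 1) :
    (rebuild M).val = { searched M with
      onStick := fun u => if u ∈ pre then true else M.onStick u
      root := v
      bris := v :: rest
      adj := fun x => if x ∈ (searched M).order then
        (M.adj x).filter (Keep (fun u => if u ∈ pre then true else M.onStick u)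
          (searched M).par x) else M.adj x } := by
  have hclear := clear_val M.bris M
  have h1 : (rebuild M).val = (prune (extendStick (searched M).order (searched M)).val.order
      (extendStick (searched M).order (searched M)).val).val := by
    change (prune (extendStick (dfs _ _).val.order (dfs _ _).val).val.order _).val = _
    simp only [searched, searchStart, hclear]
  have h2 : (extendStick (searched M).order (searched M)).val = { searched M with
      onStick := fun u => if u ∈ pre then true else (searched M).onStick u
      root := v
      bris := v :: rest } := by
    conv_lhs => rw [ho]
    exact extendStick_val hpre hv
  rw [h1, h2, prune_val h.dfsInv.nodup]
  simp only [h.searched_adj, h.searched_onStick]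

section Stop

variable {pre rest : List (Vertex n)} {v : Vertex n}

theorem Ready.root_mem_pre (h : Ready l M) (ho : (searched M).order = pre ++ v :: rest) :
    M.root ∈ pre ∨ M.root = v := by
  obtain ⟨t, ht⟩ := h.dfsInv.root_mem
  rw [ht] at ho
  cases pre with
  | nil => exact Or.inr (List.cons.inj ho).1
  | cons a pre => exact Or.inl (by rw [(List.cons.inj ho).1]; simp)

theorem Ready.par_mem_pre (h : Ready l M) (ho : (searched M).order = pre ++ v :: rest)
    {x : Vertex n} (hx : x ∈ pre ∨ x = v) (hr : x ≠ M.root) :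
    ∃ p ∈ pre, (searched M).par x = some p := by
  rcases hx with hx | rfl
  · obtain ⟨p1, p2, rfl⟩ := List.append_of_mem hx
    obtain ⟨p, hp, hpx⟩ := h.dfsInv.early p1 x (p2 ++ v :: rest) (by simpa using ho) hr
    exact ⟨p, by simp [hp], hpx⟩
  · exact h.dfsInv.early pre x rest ho hr

/-- By counting. The vertices of `pre ++ [v]` other than the root are as many as those of `pre`, and
their parents lie in `pre`. As vertices of `pre` have one child each, the parent map is injective
there, hence onto `pre`, and every only child is found in `pre ++ [v]`. -/
theorem Ready.child_mem_pre (h : Ready l M) (ho : (searched M).order = pre ++ v :: rest)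
    (hpre : ∀ u ∈ pre, (searched M).kids u = 1) {u c : Vertex n} (hu : u ∈ pre)
    (hc : (searched M).par c = some u) : c ∈ pre ∨ c = v := by
  classical
  have hS : ∀ x ∈ pre, M.onStick x = false := fun x hx => (h.mem_order x).1 (by simp [ho, hx])
  have hnd := h.dfsInv.nodup
  rw [ho] at hnd
  have hnd' : (pre ++ [v]).Nodup := by
    refine hnd.sublist ?_
    exact (List.append_sublist_append_left pre).2 (by simp)
  set X := (pre ++ [v]).toFinset.erase M.root with hX
  have hXmem : ∀ x, x ∈ X ↔ (x ∈ pre ∨ x = v) ∧ x ≠ M.root := by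
    intro x
    simp [hX, and_comm, or_comm]
  have hmaps : Set.MapsTo (fun x => ((searched M).par x).getD none) X pre.toFinset := by
    intro x hx
    rw [Finset.mem_coe, hXmem] at hx
    obtain ⟨p, hp, hpx⟩ := h.par_mem_pre ho hx.1 hx.2
    simpa [hpx] using hp
  have hinj : Set.InjOn (fun x => ((searched M).par x).getD none) X := by
    intro x hx y hy hxy
    rw [Finset.mem_coe, hXmem] at hx hy
    obtain ⟨p, hp, hpx⟩ := h.par_mem_pre ho hx.1 hx.2
    obtain ⟨q, hq, hqy⟩ := h.par_mem_pre ho hy.1 hy.2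
    simp only [hpx, hqy, Option.getD_some] at hxy
    subst hxy
    exact ((h.kids_eq_one_iff (hS p hp)).1 (hpre p hp)).unique hpx hqy
  have hcard : pre.toFinset.card ≤ X.card := by
    have hr : M.root ∈ (pre ++ [v]).toFinset := by
      simpa [or_comm] using h.root_mem_pre ho
    rw [hX, Finset.card_erase_of_mem hr, List.toFinset_card_of_nodup hnd']
    simpa using List.toFinset_card_le pre
  have hsurj := Finset.surjOn_of_injOn_of_card_le _ hmaps hinj hcard
  obtain ⟨x, hx, hxu⟩ := hsurj (show u ∈ (pre.toFinset : Set (Vertex n)) by simpa using hu)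
  rw [Finset.mem_coe, hXmem] at hx
  obtain ⟨p, hp, hpx⟩ := h.par_mem_pre ho hx.1 hx.2
  simp only [hpx, Option.getD_some] at hxu
  subst hxu
  have := ((h.kids_eq_one_iff (hS p hp)).1 (hpre p hp)).unique hpx hc
  exact this ▸ hx.1

/-- The children of the vertices of the extended stick. -/
theorem Ready.child_mem_stick (h : Ready l M) (ho : (searched M).order = pre ++ v :: rest)
    (hpre : ∀ u ∈ pre, (searched M).kids u = 1) {u c : Vertex n}
    (hu : u ∈ pre ∨ M.onStick u = true) (hc : (searched M).par c = some u) :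
    (c ∈ pre ∨ M.onStick c = true) ∨ c = v := by
  rcases hu with hu | hu
  · exact (h.child_mem_pre ho hpre hu hc).imp_left Or.inl
  · rcases h.child_mem u hu c ((h.child_iff hu c).1 hc) with h1 | rfl
    · exact Or.inl (Or.inr h1)
    · exact (h.root_mem_pre ho).imp_left Or.inl

theorem Ready.par_mem_stick (h : Ready l M) (ho : (searched M).order = pre ++ v :: rest)
    {u c : Vertex n} (hc : (c ∈ pre ∨ M.onStick c = true) ∨ c = v)
    (hp : (searched M).par c = some u) : u ∈ pre ∨ M.onStick u = true := by
  by_cases hr : M.onStick c = true ∨ c = M.root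
  · exact Or.inr (h.searched_up hr hp)
  · push Not at hr
    obtain ⟨p, hpm, hpc⟩ := h.par_mem_pre ho (x := c) (by tauto) hr.2
    rw [hp] at hpc
    cases hpc
    exact Or.inl hpm

theorem Ready.none_mem_stick (h : Ready l M) (ho : (searched M).order = pre ++ v :: rest) :
    (none ∈ pre ∨ M.onStick none = true) ∨ none = v := by
  rcases h.none_mem with h1 | h1
  · exact Or.inl (Or.inr h1)
  · exact h1 ▸ (h.root_mem_pre ho).imp_left Or.inl

theorem Ready.stick_searched (h : Ready l M) (ho : (searched M).order = pre ++ v :: rest)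
    (hpre : ∀ u ∈ pre, (searched M).kids u = 1) (hv : (searched M).kids v ≠ 1) :
    stick (searched M).par = {u | u ∈ pre ∨ M.onStick u = true} := by
  refine stick_eq (r := v) h.searched_span (h.none_mem_stick ho) ?_ ?_ ?_ ?_
  · exact fun c hc u hp => h.par_mem_stick ho (Or.inl hc) hp
  · rintro u (hu | hu)
    · exact (h.kids_eq_one_iff ((h.mem_order u).1 (by simp [ho, hu]))).1 (hpre u hu)
    · exact (existsUnique_congr fun c => h.child_iff hu c).2 (h.child u hu)
  · exact fun u hu c hc => h.child_mem_stick ho hpre hu hc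
  · exact fun hc => hv ((h.kids_eq_one_iff ((h.mem_order v).1 (by simp [ho]))).2 hc)

end Stop

/-- Edges at the old stick need not be in the lists, and need not be: the old stick is part of the
new one, whose vertices are comparable with all others. The remaining edges were scanned by the
traversal. -/
theorem Ready.isDFSTree_searched (h : Ready l M) : IsDFSTree (graph l) none (searched M).par where
  root := h.searched_none
  spanning := h.searched_span
  tree_edge _ _ hp := h.searched_tree_edge hp
  no_cross u v huv := by
    obtain ⟨pre, x, rest, ho, hpre, hx⟩ := h.exists_last
    have hst := h.stick_searched ho hpre hx
    by_cases hu : M.onStick u = true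
    · exact stick_comparable (by rw [hst]; exact Or.inr hu) (h.searched_span u) (h.searched_span v)
    by_cases hv : M.onStick v = true
    · exact (stick_comparable (by rw [hst]; exact Or.inr hv) (h.searched_span v)
        (h.searched_span u)).symm
    · exact h.searched_related (by simpa using hu) (by simpa using hv) huv

/-- Tree edges at the old stick are the same before and after, so an entry that touches it is judged
alike both times. -/
theorem Ready.keep_iff (h : Ready l M) {onS' : Vertex n → Bool}
    (hS : ∀ u, M.onStick u = true → onS' u = true) {v w : Vertex n}
    (hvw : M.onStick v = true ∨ M.onStick w = true) :
    Keep onS' (searched M).par v w ↔ Keep M.onStick M.par v w := by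
  have hvw' : onS' v = true ∨ onS' w = true := hvw.imp (hS v) (hS w)
  simp only [Keep, hvw, hvw', true_and, not_not]
  rcases hvw with hv | hw
  · rw [h.searched_par_eq (Or.inl hv), h.child_iff hv]
  · rw [h.searched_par_eq (Or.inl hw), h.child_iff hw]

theorem Ready.inv_rebuild (h : Ready l M) : Inv l (rebuild M).val := by
  obtain ⟨pre, v, rest, ho, hpre, hv⟩ := h.exists_last
  have hst := h.stick_searched ho hpre hv
  have hon : ∀ u, (if u ∈ pre then true else M.onStick u) = true ↔
      u ∈ pre ∨ M.onStick u = true := by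
    intro u
    by_cases hu : u ∈ pre <;> simp [hu]
  have hoff : ∀ u, (if u ∈ pre then true else M.onStick u) = false ↔
      u ∉ pre ∧ M.onStick u = false := by
    intro u
    by_cases hu : u ∈ pre <;> simp [hu]
  have hnd := h.dfsInv.nodup
  rw [ho] at hnd
  have hvo : v ∈ (searched M).order := by simp [ho]
  have hvpre : v ∉ pre := fun hvp => (List.disjoint_of_nodup_append hnd) hvp (by simp)
  have hvS := (h.mem_order v).1 hvo
  rw [rebuild_val h ho hpre hv]
  refine
    { list_nodup := h.list_nodup
      dfsTree := h.isDFSTree_searched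
      lex := h.searched_firstChild
      mem_stick := fun u => by
        rw [hon]
        change u ∈ stick (searched M).par ↔ _
        rw [hst]
        rfl
      root := (hoff v).2 ⟨hvpre, hvS⟩
      child_mem := fun u hu c hc => by
        rw [hon] at hu ⊢
        exact h.child_mem_stick ho hpre hu hc
      below := fun u hu => by
        rw [hoff] at hu
        refine anc_of_notMem (S := {u | u ∈ pre ∨ M.onStick u = true}) h.searched_span
          (h.none_mem_stick ho) (fun x hx c hc => h.child_mem_stick ho hpre hx hc) ?_
        rintro (h1 | h1)
        · exact hu.1 h1
        · simp [hu.2] at h1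
      up_root := fun u hu => (hon u).2 (h.par_mem_stick ho (Or.inr rfl) hu)
      bris_nodup := (List.nodup_append.1 hnd).2.1
      mem_bris := fun u => ?_
      vis := h.searched_visited
      adj := fun u => ?_
      anc_test := fun x y hx hy => h.searched_ancTest ((hoff x).1 hx).2 ((hoff y).1 hy).2 }
  · rw [hoff, ← h.mem_order, ho]
    constructor
    · intro hu
      exact ⟨fun hup => (List.disjoint_of_nodup_append hnd) hup hu, List.mem_append_right _ hu⟩
    · rintro ⟨h1, h2⟩
      exact (List.mem_append.1 h2).resolve_left h1
  · have hS : ∀ u, M.onStick u = true → (if u ∈ pre then true else M.onStick u) = true :=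
      fun u hu => (hon u).2 (Or.inr hu)
    have hadj : M.adj u = (nbrs l u).filter (Keep M.onStick M.par u) := h.adj u
    by_cases hu : u ∈ (searched M).order
    · simp only [hu, if_true, hadj, List.filter_filter]
      refine List.filter_congr fun w _ => ?_
      rw [Bool.eq_iff_iff, Bool.and_eq_true, decide_eq_true_eq, decide_eq_true_eq]
      -- Pruning again amounts to pruning the full list once with the larger stick: what survives
      -- the new filter survives the old one.
      refine and_iff_left_of_imp fun hk => ?_
      by_cases hw : M.onStick u = true ∨ M.onStick w = true
      · exact (h.keep_iff hS hw).1 hk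
      · exact fun hc => hw hc.1
    · have huS : M.onStick u = true := by
        rw [h.mem_order] at hu
        simpa using hu
      simp only [hu, if_false, hadj]
      refine List.filter_congr fun w _ => ?_
      rw [decide_eq_decide]
      exact (h.keep_iff hS (Or.inl huS)).symm

/-- Rebuilding the bristles does not touch the stick and its children. -/
theorem Ready.rebuild_par_iff (h : Ready l M) {u : Vertex n} (hu : M.onStick u = true)
    (v : Vertex n) : (rebuild M).val.par v = some u ↔ M.par v = some u := by
  obtain ⟨pre, x, rest, ho, hpre, hx⟩ := h.exists_last
  rw [rebuild_val h ho hpre hx]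
  exact h.child_iff hu v

theorem Ready.mem_stick_rebuild (h : Ready l M) {u : Vertex n} (hu : M.onStick u = true) :
    u ∈ stick (rebuild M).val.par := by
  obtain ⟨pre, x, rest, ho, hpre, hx⟩ := h.exists_last
  rw [rebuild_val h ho hpre hx]
  change u ∈ stick (searched M).par
  rw [h.stick_searched ho hpre hx]
  exact Or.inr hu

theorem ready_blank (n : ℕ) : Ready [] (blank n) where
  list_nodup := List.nodup_nil
  par_none := rfl
  span v hv := by
    rcases hv with hv | rfl
    · cases hv
    · exact Anc.refl _ _
  root := rfl
  up v _ u hp := by cases hp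
  child v hv := by cases hv
  child_mem v hv := by cases hv
  bris_nodup := List.nodup_cons.2
    ⟨by simp, (List.nodup_finRange n).map (Option.some_injective _)⟩
  mem_bris v := by
    cases v <;> simp [blank]
  vis v hv := by cases hv
  adj v := by
    have : ∀ L : List (Vertex n),
        L.filter (Keep (blank n).onStick (blank n).par v) = L := by
      intro L
      refine List.filter_eq_self.2 fun w _ => ?_
      rw [decide_eq_true_eq]
      simp [Keep, blank]
    rw [this]
    cases v <;> simp [blank, nbrs]
  conn v _ := by
    cases v with
    | none => exact Relation.ReflTransGen.refl
    | some v => exact Relation.ReflTransGen.single ⟨graph_adj_none, rfl, rfl⟩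
  tree_edge v _ u hp := by cases hp
  lex a b ha := by cases ha

theorem keep_edge_iff_of_not_adj {onS : Vertex n → Bool} {par : Vertex n → Option (Vertex n)}
    {v w : Vertex n} (h1 : par v ≠ some w) (h2 : par w ≠ some v) :
    Keep onS par v w ↔ onS v = false ∧ onS w = false := by
  simp [Keep, h1, h2]

theorem addEdge_adj (M : Memory n) (e : Edge n) (v : Vertex n) :
    (addEdge M (some e.1.1) (some e.1.2)).adj v =
      if v = some e.1.1 then M.adj v ++ [some e.1.2]
      else if v = some e.1.2 then M.adj v ++ [some e.1.1] else M.adj v := by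
  simp only [addEdge]
  by_cases h2 : v = some e.1.2
  · subst h2
    rw [Function.update_self, if_neg e.ends_ne.symm, if_pos rfl]
  · rw [Function.update_of_ne h2, if_neg h2]
    by_cases h1 : v = some e.1.1
    · subst h1
      simp
    · rw [Function.update_of_ne h1, if_neg h1]

/-! ### Insertion of a single edge. -/

section Insert

variable {e : Edge n}

theorem Inv.par_ne (h : Inv l M) (he : e ∉ l) :
    M.par (some e.1.1) ≠ some (some e.1.2) ∧ M.par (some e.1.2) ≠ some (some e.1.1) :=
  ⟨fun hp => not_graph_adj_of_notMem he (h.dfsTree.tree_edge _ _ hp).symm,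
    fun hp => not_graph_adj_of_notMem he (h.dfsTree.tree_edge _ _ hp)⟩

/-- The lists after the insertion of an edge which is stored if and only if its endpoints are not
on the stick. -/
theorem Inv.adj_append (h : Inv l M) (he : e ∉ l) (v : Vertex n) :
    (nbrs (l ++ [e]) v).filter (Keep M.onStick M.par v) =
      if M.onStick (some e.1.1) = true ∨ M.onStick (some e.1.2) = true then M.adj v
      else (addEdge M (some e.1.1) (some e.1.2)).adj v := by
  obtain ⟨h1, h2⟩ := h.par_ne he
  have k1 := keep_edge_iff_of_not_adj (onS := M.onStick) h1 h2
  have k2 := keep_edge_iff_of_not_adj (onS := M.onStick) h2 h1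
  rw [nbrs_append, addEdge_adj]
  by_cases hv1 : v = some e.1.1
  · subst hv1
    by_cases hk : M.onStick (some e.1.1) = true ∨ M.onStick (some e.1.2) = true
    · simp only [if_true, hk, List.filter_append, h.adj]
      rw [List.filter_cons_of_neg, List.filter_nil, List.append_nil]
      rw [decide_eq_true_eq, k1]
      rintro ⟨k3, k4⟩
      simp [k3, k4] at hk
    · simp only [if_true, hk, List.filter_append, h.adj, if_false]
      rw [List.filter_cons_of_pos, List.filter_nil]
      rw [decide_eq_true_eq, k1]
      simpa using hk
  · by_cases hv2 : v = some e.1.2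
    · subst hv2
      by_cases hk : M.onStick (some e.1.1) = true ∨ M.onStick (some e.1.2) = true
      · simp only [if_true, hk, List.filter_append, h.adj, if_neg hv1]
        rw [List.filter_cons_of_neg, List.filter_nil, List.append_nil]
        rw [decide_eq_true_eq, k2]
        rintro ⟨k3, k4⟩
        simp [k3, k4] at hk
      · simp only [if_true, hk, List.filter_append, h.adj, if_false, if_neg hv1]
        rw [List.filter_cons_of_pos, List.filter_nil]
        rw [decide_eq_true_eq, k2]
        simpa [and_comm] using hk
    · simp only [if_neg hv1, if_neg hv2, ← h.adj, ite_self]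

theorem Inv.isDFSTree_append (h : Inv l M)
    (hc : ¬ IsCross M.par (some e.1.1) (some e.1.2)) :
    IsDFSTree (graph (l ++ [e])) none M.par where
  root := h.dfsTree.root
  spanning := h.dfsTree.spanning
  tree_edge u v hp := graph_mono l e (h.dfsTree.tree_edge u v hp)
  no_cross u v huv := by
    simp only [IsCross, not_and_or, not_not] at hc
    rcases graph_adj_append huv with h1 | ⟨rfl, rfl⟩ | ⟨rfl, rfl⟩
    · exact h.dfsTree.no_cross u v h1
    · exact hc
    · exact hc.symm

/-- The new entry goes to the end of a list, and a child is already in the old list because it is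
joined by a tree edge. So nothing new gets in front of it. -/
theorem Inv.firstChild_append (h : Inv l M) (hl : (l ++ [e]).Nodup) :
    FirstChild (l ++ [e]) M.par := by
  intro a b hab pre post hsplit u hu
  have hb : b ∈ nbrs l a := mem_nbrs.2 (h.dfsTree.tree_edge a b hab)
  have hpre : ∃ t, nbrs (l ++ [e]) a = nbrs l a ++ t := by
    rw [nbrs_append]
    split_ifs
    · exact ⟨_, rfl⟩
    · exact ⟨_, rfl⟩
    · exact ⟨[], by simp⟩
  obtain ⟨t, ht⟩ := hpre
  obtain ⟨pre', post', hl'⟩ := List.append_of_mem hb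
  have hnd := nodup_nbrs hl a
  rw [hsplit] at hnd
  have hbpre : b ∉ pre := fun hbp => (List.disjoint_of_nodup_append hnd) hbp (by simp)
  have hbpost : b ∉ post := (List.nodup_cons.1 (List.nodup_append.1 hnd).2.1).1
  have heq : pre ++ b :: post = pre' ++ b :: (post' ++ t) := by
    rw [← hsplit, ht, hl']
    simp
  have := ((List.append_cons_inj_of_notMem hbpre hbpost).1 heq).1
  subst this
  exact h.lex a b hab pre post' hl' u hu

theorem Inv.append_of_not_cross (h : Inv l M) (hl : (l ++ [e]).Nodup)
    (hc : ¬ IsCross M.par (some e.1.1) (some e.1.2)) :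
    Inv (l ++ [e]) (if M.onStick (some e.1.1) = true ∨ M.onStick (some e.1.2) = true then M
      else addEdge M (some e.1.1) (some e.1.2)) := by
  have he : e ∉ l := by
    rw [List.nodup_append] at hl
    exact fun hel => hl.2.2 e hel e (by simp) rfl
  have hadj := fun v => (h.adj_append he v).symm
  split_ifs at hadj ⊢ with hk
  · exact { h with
      list_nodup := hl
      dfsTree := h.isDFSTree_append hc
      lex := h.firstChild_append hl
      adj := hadj }
  · exact
    { list_nodup := hl
      dfsTree := h.isDFSTree_append hc
      lex := h.firstChild_append hl
      mem_stick := h.mem_stick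
      root := h.root
      child_mem := h.child_mem
      below := h.below
      up_root := h.up_root
      bris_nodup := h.bris_nodup
      mem_bris := h.mem_bris
      vis := h.vis
      adj := hadj
      anc_test := h.anc_test }

theorem Inv.up (h : Inv l M) {v u : Vertex n} (hv : M.onStick v = true ∨ v = M.root)
    (hp : M.par v = some u) : M.onStick u = true := by
  rcases hv with hv | rfl
  · rw [← h.mem_stick] at hv ⊢
    exact mem_stick_of_anc (Anc.of_par hp) hv
  · exact h.up_root u hp

theorem Inv.not_onStick_of_cross (h : Inv l M)
    (hc : IsCross M.par (some e.1.1) (some e.1.2)) :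
    M.onStick (some e.1.1) = false ∧ M.onStick (some e.1.2) = false := by
  constructor
  · by_contra hx
    have hx : M.onStick (some e.1.1) = true := by simpa using hx
    rw [← h.mem_stick] at hx
    rcases stick_comparable (s := none) hx (h.dfsTree.spanning _)
      (h.dfsTree.spanning (some e.1.2)) with h1 | h1
    · exact hc.1 h1
    · exact hc.2 h1
  · by_contra hx
    have hx : M.onStick (some e.1.2) = true := by simpa using hx
    rw [← h.mem_stick] at hx
    rcases stick_comparable (s := none) hx (h.dfsTree.spanning _)
      (h.dfsTree.spanning (some e.1.1)) with h1 | h1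
    · exact hc.2 h1
    · exact hc.1 h1

theorem Inv.ready (h : Inv l M) (hl : (l ++ [e]).Nodup)
    (hc : IsCross M.par (some e.1.1) (some e.1.2)) :
    Ready (l ++ [e]) (addEdge M (some e.1.1) (some e.1.2)) := by
  have he : e ∉ l := by
    rw [List.nodup_append] at hl
    exact fun hel => hl.2.2 e hel e (by simp) rfl
  obtain ⟨hx, hy⟩ := h.not_onStick_of_cross hc
  have hr := h.dfsTree.root
  have hs := h.dfsTree.spanning
  refine
    { list_nodup := hl
      par_none := hr
      span := fun v _ => hs v
      root := h.root
      up := fun v hv u hp => h.up hv hp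
      child := fun v hv => existsUnique_child_of_mem_stick ((h.mem_stick v).2 hv)
      child_mem := h.child_mem
      bris_nodup := h.bris_nodup
      mem_bris := h.mem_bris
      vis := fun v _ => h.vis v
      adj := fun v => ?_
      conn := fun v hv => ?_
      tree_edge := fun v _ u hp => graph_mono l e (h.dfsTree.tree_edge u v hp)
      lex := fun a b ha hab pre post hsplit u hu => ?_ }
  · have := h.adj_append he v
    rw [if_neg (by simp [hx, hy])] at this
    exact this.symm
  · change M.onStick v = false at hv
    have hanc := h.below v hv
    change Relation.ReflTransGen _ M.root v
    induction hanc with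
    | refl => exact Relation.ReflTransGen.refl
    | @tail p c hp hpc ih =>
      have hpS : M.onStick p = false := by
        by_contra hpS
        have := Anc.mem_of_mem (S := {v | M.onStick v = true})
          (fun v hv u hu => h.up (Or.inl hv) hu) hp (by simpa using hpS)
        simp [h.root] at this
      exact (ih hpS).tail ⟨graph_mono l e (h.dfsTree.tree_edge p c hpc), hpS, hv⟩
  · change M.onStick a = true at ha
    change M.par b = some a at hab
    have hae : nbrs (l ++ [e]) a = nbrs l a := by
      rw [nbrs_append, if_neg, if_neg]
      · rintro rfl
        simp [hy] at ha
      · rintro rfl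
        simp [hx] at ha
    rw [hae] at hsplit
    have hua : (graph l).Adj a u := mem_nbrs.1 (by rw [hsplit]; simp [hu])
    have hnb := h.lex a b hab pre post hsplit u hu
    -- A neighbour of `a` is an ancestor or lies below the only child `b`. The latter contradicts
    -- `FirstChild`, as `u` stands before `b`.
    have hanc : Anc M.par u a := by
      rcases h.dfsTree.no_cross a u hua with h1 | h1
      · rcases h1.eq_or_child with rfl | ⟨c, hca, hcu⟩
        · exact Anc.refl _ _
        · have := (existsUnique_child_of_mem_stick ((h.mem_stick a).2 ha)).unique hca hab
          subst this
          exact absurd hcu hnb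
      · exact h1
    refine ⟨?_, hanc⟩
    change M.onStick u = true
    rw [← h.mem_stick] at ha ⊢
    exact mem_stick_of_anc hanc ha

theorem Inv.tests_iff (h : Inv l M) (hx : M.onStick (some e.1.1) = false)
    (hy : M.onStick (some e.1.2) = false) :
    (ancTest M (some e.1.1) (some e.1.2) = true ∨ ancTest M (some e.1.2) (some e.1.1) = true) ↔
      ¬ IsCross M.par (some e.1.1) (some e.1.2) := by
  rw [h.anc_test _ _ hx hy, h.anc_test _ _ hy hx, IsCross, not_and_or, not_not, not_not]

theorem Inv.insertEdge_of_not_cross (h : Inv l M)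
    (hc : ¬ IsCross M.par (some e.1.1) (some e.1.2)) :
    (insertEdge M e).val = (if M.onStick (some e.1.1) = true ∨ M.onStick (some e.1.2) = true then M
      else addEdge M (some e.1.1) (some e.1.2)) ∧ (insertEdge M e).time = 1 := by
  by_cases hk : M.onStick (some e.1.1) = true ∨ M.onStick (some e.1.2) = true
  · rw [if_pos hk]
    simp only [insertEdge, if_pos hk]
    exact ⟨rfl, rfl⟩
  · have hk' : M.onStick (some e.1.1) = false ∧ M.onStick (some e.1.2) = false := by
      simpa using hk
    have ht := (h.tests_iff hk'.1 hk'.2).2 hc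
    rw [if_neg hk]
    simp only [insertEdge, if_neg hk, if_pos ht]
    exact ⟨rfl, rfl⟩

theorem Inv.insertEdge_of_cross (h : Inv l M)
    (hc : IsCross M.par (some e.1.1) (some e.1.2)) :
    (insertEdge M e).val = (rebuild (addEdge M (some e.1.1) (some e.1.2))).val ∧
    (insertEdge M e).time = 1 + (rebuild (addEdge M (some e.1.1) (some e.1.2))).time := by
  obtain ⟨hx, hy⟩ := h.not_onStick_of_cross hc
  have hk : ¬ (M.onStick (some e.1.1) = true ∨ M.onStick (some e.1.2) = true) := by
    simp [hx, hy]
  have ht := fun ht => (h.tests_iff hx hy).1 ht hc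
  simp only [insertEdge, if_neg hk, if_neg ht]
  exact ⟨rfl, rfl⟩

theorem Inv.insert (h : Inv l M) (hl : (l ++ [e]).Nodup) :
    Inv (l ++ [e]) (insertEdge M e).val := by
  by_cases hc : IsCross M.par (some e.1.1) (some e.1.2)
  · rw [(h.insertEdge_of_cross hc).1]
    exact (h.ready hl hc).inv_rebuild
  · rw [(h.insertEdge_of_not_cross hc).1]
    exact h.append_of_not_cross hl hc

end Insert

theorem foldlM_append_singleton (f : Memory n → Edge n → Timed (Memory n)) (l : List (Edge n))
    (e : Edge n) (M : Memory n) :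
    ((l ++ [e]).foldlM f M).val = (f (l.foldlM f M).val e).val ∧
    ((l ++ [e]).foldlM f M).time = (l.foldlM f M).time + (f (l.foldlM f M).val e).time := by
  induction l generalizing M with
  | nil =>
    simp only [List.nil_append, List.foldlM_cons, List.foldlM_nil]
    refine ⟨rfl, ?_⟩
    change (f M e).time + 0 = 0 + (f M e).time
    omega
  | cons a l ih =>
    obtain ⟨h1, h2⟩ := ih (f M a).val
    refine ⟨h1, ?_⟩
    change (f M a).time + ((l ++ [e]).foldlM f (f M a).val).time =
      ((f M a).time + (l.foldlM f (f M a).val).time) + (f (l.foldlM f (f M a).val).val e).time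
    rw [h2, add_assoc]

theorem run_append_val (l : List (Edge n)) (e : Edge n) :
    (run (l ++ [e])).val = (insertEdge (run l).val e).val :=
  (foldlM_append_singleton insertEdge l e (start n).val).1

theorem totalTime_append (l : List (Edge n)) (e : Edge n) :
    totalTime (l ++ [e]) = totalTime l + insertTime l e := by
  change (start n).time + ((l ++ [e]).foldlM insertEdge (start n).val).time =
    ((start n).time + (l.foldlM insertEdge (start n).val).time) + _
  rw [(foldlM_append_singleton insertEdge l e (start n).val).2, add_assoc]
  rfl

theorem totalTime_nil (n : ℕ) :
    totalTime ([] : List (Edge n)) = n + 1 + (rebuild (blank n)).time := rfl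

theorem inv_run (l : List (Edge n)) (hl : l.Nodup) : Inv l (run l).val := by
  induction l using List.reverseRecOn with
  | nil => exact (ready_blank n).inv_rebuild
  | append_singleton l e ih =>
    rw [run_append_val]
    exact (ih (List.nodup_append.1 hl).1).insert hl

end Rebuild

/-! ### The time of a rebuilding, and the guarantees for a single insertion. -/

section Time

variable {n : ℕ} {l : List (Edge n)} {M : Memory n}

/-- Handshake for the edges inside a set of vertices. -/
theorem sum_card_adj_within {W : Type*} [Fintype W] (G : SimpleGraph W) (B : Finset W) :
    ∑ v ∈ B, {w | w ∈ B ∧ G.Adj v w}.ncard = 2 * {f ∈ G.edgeSet | ∀ v ∈ f, v ∈ B}.ncard := by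
  classical
  let H : SimpleGraph W :=
    { Adj := fun u v => G.Adj u v ∧ u ∈ B ∧ v ∈ B
      symm := ⟨fun u v h => ⟨h.1.symm, h.2.2, h.2.1⟩⟩
      loopless := ⟨fun u h => G.loopless.1 u h.1⟩ }
  have hE : {f ∈ G.edgeSet | ∀ v ∈ f, v ∈ B} = H.edgeSet := by
    ext f
    induction f using Sym2.ind with
    | _ x y => simp [H]
  have hcard : H.edgeSet.ncard = H.edgeFinset.card := by
    rw [← Set.ncard_coe_finset, SimpleGraph.coe_edgeFinset]
  rw [hE, hcard, ← H.sum_degrees_eq_twice_card_edges]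
  rw [← Finset.sum_subset (Finset.subset_univ B)]
  · refine Finset.sum_congr rfl fun v hv => ?_
    rw [← SimpleGraph.card_neighborFinset_eq_degree, ← Set.ncard_coe_finset]
    congr 1
    ext w
    simp [H, hv, and_comm]
  · intro v _ hv
    rw [← SimpleGraph.card_neighborFinset_eq_degree, Finset.card_eq_zero,
      Finset.eq_empty_iff_forall_notMem]
    intro w hw
    rw [SimpleGraph.mem_neighborFinset] at hw
    exact hv hw.2.1

/-- The extra 1 is for the parent. A kept entry on the stick is joined to `v` by a tree edge, and it
cannot be a child of `v`, since the stick is closed upwards. -/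
theorem Ready.length_adj_le (h : Ready l M) {v : Vertex n} (hv : M.onStick v = false) :
    (M.adj v).length ≤
      {w | w ∈ Finset.univ.filter (fun w => M.onStick w = false) ∧ (graph l).Adj v w}.ncard + 1 := by
  have hnd : (M.adj v).Nodup := by
    rw [h.adj]
    exact (nodup_nbrs h.list_nodup v).filter _
  rw [← List.toFinset_card_of_nodup hnd, ← Set.ncard_coe_finset]
  refine le_trans (Set.ncard_le_ncard (t := insert ((M.par v).getD none) _) ?_)
    (Set.ncard_insert_le _ _)
  intro w hw
  have hw : w ∈ M.adj v := by simpa using hw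
  rw [h.adj, List.mem_filter, mem_nbrs, decide_eq_true_eq] at hw
  by_cases hwS : M.onStick w = true
  · left
    have hk := hw.2
    simp only [Keep, hwS, or_true, true_and, not_not] at hk
    rcases hk with hk | hk
    · simp [hk]
    · have := h.up w (Or.inl hwS) v hk
      simp [hv] at this
  · right
    simpa [hw.1] using hwS

theorem Ready.time_rebuild_le (h : Ready l M) : (rebuild M).time ≤
    10 * ({v | M.onStick v = false}.ncard +
      {f ∈ (graph l).edgeSet | ∀ v ∈ f, v ∈ {v | M.onStick v = false}}.ncard) := by
  classical
  have hclear := clear_val M.bris M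
  obtain ⟨pre, v, rest, ho, hpre, hv⟩ := h.exists_last
  set B : Finset (Vertex n) := Finset.univ.filter fun v => M.onStick v = false with hB
  have hBset : {v | M.onStick v = false} = (B : Set (Vertex n)) := by
    ext
    simp [hB]
  have hmemB : ∀ x, x ∈ B ↔ M.onStick x = false := by simp [hB]
  have hsum := sum_card_adj_within (graph l) B
  rw [hBset, Set.ncard_coe_finset]
  simp only [Finset.mem_coe]
  set E := {f ∈ (graph l).edgeSet | ∀ v ∈ f, v ∈ B}.ncard
  have hadj : ∑ v ∈ B, (M.adj v).length ≤ 2 * E + B.card := by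
    rw [← hsum, Finset.card_eq_sum_ones, ← Finset.sum_add_distrib]
    exact Finset.sum_le_sum fun v hv => h.length_adj_le ((hmemB v).1 hv)
  have hoB : (searched M).order.toFinset = B := by
    ext x
    rw [List.mem_toFinset, h.mem_order, hmemB]
  have hlen : (searched M).order.length = B.card := by
    rw [← hoB, List.toFinset_card_of_nodup h.dfsInv.nodup]
  have hbris : M.bris.length = B.card := by
    rw [← List.toFinset_card_of_nodup h.bris_nodup]
    congr 1
    ext x
    rw [List.mem_toFinset, h.mem_bris, hmemB]
  have hrB : M.root ∈ B := (hmemB _).2 h.root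
  have htime : (rebuild M).time = (clear M.bris M).time + (1 +
      ((dfs [(M.root, M.adj M.root)] (searchStart M)).time +
        ((extendStick (searched M).order (searched M)).time +
          (prune (extendStick (searched M).order (searched M)).val.order
            (extendStick (searched M).order (searched M)).val).time))) := by
    change _ + (1 + ((dfs _ _).time + ((extendStick (dfs _ _).val.order (dfs _ _).val).time +
      (prune (extendStick (dfs _ _).val.order (dfs _ _).val).val.order _).time))) = _
    simp only [searched, searchStart, hclear]
  -- In the potential the vertices of the stick count 0, being visited, and the single stack entry
  -- is one summand of the second sum.
  have hdfs : (dfs [(M.root, M.adj M.root)] (searchStart M)).time ≤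
      ∑ v ∈ B, ((M.adj v).length + 2) + ∑ v ∈ B, ((M.adj v).length + 1) := by
    refine (dfs_time _ _).trans (add_le_add ?_ ?_)
    · rw [← Finset.sum_subset (Finset.subset_univ B)]
      · refine Finset.sum_le_sum fun v hv => ?_
        have : (searchStart M).adj = M.adj := by simp only [searchStart, hclear]
        rw [this]
        split_ifs <;> omega
      · intro v _ hv
        rw [if_pos]
        refine h.dfsInv_start.vis v ?_
        rw [hmemB] at hv
        simpa using hv
    · simp only [List.map_cons, List.map_nil, List.sum_cons, List.sum_nil, add_zero]
      exact Finset.single_le_sum (f := fun v => (M.adj v).length + 1)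
        (fun _ _ => Nat.zero_le _) hrB
  have hprune : (prune (extendStick (searched M).order (searched M)).val.order
      (extendStick (searched M).order (searched M)).val).time
      = ∑ v ∈ B, (1 + (M.adj v).length) := by
    have hext : (extendStick (searched M).order (searched M)).val = { searched M with
        onStick := fun u => if u ∈ pre then true else (searched M).onStick u
        root := v
        bris := v :: rest } := by
      conv_lhs => rw [ho]
      exact extendStick_val hpre hv
    rw [hext, prune_time h.dfsInv.nodup, ← hoB, List.sum_toFinset _ h.dfsInv.nodup,
      h.searched_adj]
  have hext := extendStick_time (searched M).order (searched M)
  -- Altogether at most `6 * E + 9 * B.card + 1` steps are counted. Since the bristles are not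
  -- empty, the last one is absorbed into the factor 10.
  have hpos : 0 < B.card := Finset.card_pos.2 ⟨_, hrB⟩
  rw [htime, clear_time, hprune]
  simp only [Finset.sum_add_distrib, Finset.sum_const, smul_eq_mul, mul_one] at hdfs ⊢
  omega

theorem Inv.bristles_eq (h : Inv l M) : bristles M.par = {v | M.onStick v = false} := by
  ext v
  simp only [bristles, Set.mem_compl_iff, h.mem_stick, Set.mem_ofPred_eq, Bool.not_eq_true]

theorem tree_isDFSTree (hl : l.Nodup) : IsDFSTree (graph l) none (tree l) :=
  (inv_run l hl).dfsTree

theorem tree_firstChild (hl : l.Nodup) : FirstChild l (tree l) := (inv_run l hl).lex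

variable {e : Edge n}

theorem insert_of_not_cross (hl : (l ++ [e]).Nodup)
    (hc : ¬ IsCross (tree l) (some e.1.1) (some e.1.2)) :
    tree (l ++ [e]) = tree l ∧ insertTime l e = 1 := by
  have h := inv_run l (List.nodup_append.1 hl).1
  obtain ⟨h1, h2⟩ := h.insertEdge_of_not_cross hc
  refine ⟨?_, h2⟩
  rw [tree, run_append_val, h1]
  split_ifs <;> rfl

theorem insertTime_le_of_cross (hl : (l ++ [e]).Nodup)
    (hc : IsCross (tree l) (some e.1.1) (some e.1.2)) :
    insertTime l e ≤ 11 * ((bristles (tree l)).ncard +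
      {f ∈ (graph (l ++ [e])).edgeSet | ∀ v ∈ f, v ∈ bristles (tree l)}.ncard) := by
  have h := inv_run l (List.nodup_append.1 hl).1
  have h2 := (h.insertEdge_of_cross hc).2
  have h3 := (h.ready hl hc).time_rebuild_le
  -- Absorbs the step of `insertEdge` itself, turning 10 into 11.
  have hpos : 0 < (bristles (tree l)).ncard := by
    refine (Set.ncard_pos (Set.toFinite _)).2 ⟨(run l).val.root, ?_⟩
    rw [tree, h.bristles_eq]
    exact h.root
  rw [insertTime, h2]
  change (rebuild _).time ≤ 10 * ({v | (run l).val.onStick v = false}.ncard +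
      {f ∈ _ | ∀ v ∈ f, v ∈ {v | (run l).val.onStick v = false}}.ncard) at h3
  rw [← h.bristles_eq] at h3
  change _ ≤ 10 * ((bristles (tree l)).ncard +
    {f ∈ _ | ∀ v ∈ f, v ∈ bristles (tree l)}.ncard) at h3
  omega

theorem stick_subset_of_cross (hl : (l ++ [e]).Nodup)
    (hc : IsCross (tree l) (some e.1.1) (some e.1.2)) :
    stick (tree l) ⊆ stick (tree (l ++ [e])) ∧
      ∀ u ∈ stick (tree l), ∀ v, tree l v = some u ↔ tree (l ++ [e]) v = some u := by
  have h := inv_run l (List.nodup_append.1 hl).1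
  have hr := h.ready hl hc
  have h1 := (h.insertEdge_of_cross hc).1
  have htree : tree (l ++ [e]) =
      (rebuild (addEdge (run l).val (some e.1.1) (some e.1.2))).val.par := by
    rw [tree, run_append_val, h1]
  rw [htree]
  exact ⟨fun u hu => hr.mem_stick_rebuild ((h.mem_stick u).1 hu),
    fun u hu v => (hr.rebuild_par_iff ((h.mem_stick u).1 hu) v).symm⟩

theorem totalTime_nil_le (n : ℕ) : totalTime ([] : List (Edge n)) ≤ 21 * (n + 1) := by
  rw [totalTime_nil]
  have h := (ready_blank n).time_rebuild_le
  have h1 : {v | (blank n).onStick v = false}.ncard = n + 1 := by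
    simp [blank, Set.ncard_univ]
  have h2 : {f ∈ (graph ([] : List (Edge n))).edgeSet |
      ∀ v ∈ f, v ∈ {v | (blank n).onStick v = false}}.ncard ≤ n := by
    have hs : {f ∈ (graph ([] : List (Edge n))).edgeSet |
        ∀ v ∈ f, v ∈ {v | (blank n).onStick v = false}} ⊆
        (fun a : Fin n => s(none, some a)) '' Set.univ := by
      rintro f ⟨hf, -⟩
      induction f using Sym2.ind with
      | _ x y =>
        rw [SimpleGraph.mem_edgeSet] at hf
        cases x with
        | none =>
          cases y with
          | none => exact absurd hf (SimpleGraph.irrefl _)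
          | some b => exact ⟨b, trivial, rfl⟩
        | some a =>
          cases y with
          | none => exact ⟨a, trivial, Sym2.eq_swap⟩
          | some b =>
            rw [graph_adj_some] at hf
            simp at hf
    refine (Set.ncard_le_ncard hs).trans ((Set.ncard_image_le).trans ?_)
    simp [Set.ncard_univ]
  omega

end Time

/-! ### The greedy path -/

section Greedy

variable {n : ℕ} {l : List (Edge n)}

/-- The first vertex off the path in the list of the head of the path. -/
def next (l : List (Edge n)) : List (Vertex n) → Option (Vertex n)
  | [] => none
  | v :: P => (nbrs l v).find? fun w => decide (w ∉ v :: P)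

/-- The first `k` steps of the traversal as long as it does not backtrack, the last vertex
first. -/
def gpath (l : List (Edge n)) : ℕ → List (Vertex n)
  | 0 => [none]
  | k + 1 => match next l (gpath l k) with
    | some w => w :: gpath l k
    | none => gpath l k

theorem next_eq_some {P : List (Vertex n)} {w : Vertex n} (h : next l P = some w) :
    ∃ v P', P = v :: P' ∧ w ∉ P ∧ ∃ as bs, nbrs l v = as ++ w :: bs ∧ ∀ u ∈ as, u ∈ P := by
  cases P with
  | nil => cases h
  | cons v P' =>
    rw [next, List.find?_eq_some_iff_append] at h
    obtain ⟨h1, as, bs, hab, has⟩ := h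
    refine ⟨v, P', rfl, by simpa only [decide_eq_true_eq] using h1, as, bs, hab, ?_⟩
    intro u hu
    simpa only [Bool.not_eq_true', decide_eq_false_iff_not, not_not] using has u hu

theorem gpath_succ_of_some {k : ℕ} {w : Vertex n} (h : next l (gpath l k) = some w) :
    gpath l (k + 1) = w :: gpath l k := by
  rw [gpath, h]

theorem gpath_succ_of_none {k : ℕ} (h : next l (gpath l k) = none) :
    gpath l (k + 1) = gpath l k := by
  rw [gpath, h]

theorem none_mem_gpath (l : List (Edge n)) (k : ℕ) : none ∈ gpath l k := by
  induction k with
  | zero => simp [gpath]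
  | succ k ih =>
    cases h : next l (gpath l k) with
    | none => rwa [gpath_succ_of_none h]
    | some w => rw [gpath_succ_of_some h]; exact List.mem_cons_of_mem _ ih

theorem gpath_nodup (l : List (Edge n)) (k : ℕ) : (gpath l k).Nodup := by
  induction k with
  | zero => simp [gpath]
  | succ k ih =>
    cases h : next l (gpath l k) with
    | none => rwa [gpath_succ_of_none h]
    | some w =>
      rw [gpath_succ_of_some h]
      obtain ⟨_, _, _, hw, _⟩ := next_eq_some h
      exact List.nodup_cons.2 ⟨hw, ih⟩

theorem length_gpath_le (l : List (Edge n)) (k : ℕ) : (gpath l k).length ≤ k + 1 := by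
  induction k with
  | zero => simp [gpath]
  | succ k ih =>
    cases h : next l (gpath l k) with
    | none => rw [gpath_succ_of_none h]; omega
    | some w => rw [gpath_succ_of_some h, List.length_cons]; omega

theorem length_le_card (P : List (Vertex n)) (hP : P.Nodup) : P.length ≤ n + 1 := by
  rw [← List.toFinset_card_of_nodup hP]
  refine (Finset.card_le_univ _).trans ?_
  simp

/-- The greedy path gets stuck. -/
theorem exists_stuck (l : List (Edge n)) :
    ∃ k ≤ n, next l (gpath l k) = none ∧ (gpath l k).length = k + 1 := by
  -- Unless it was stuck before, the path gains a vertex at every step, which is impossible `n + 1`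
  -- times, as there are only `n + 1` vertices in all.
  have key : ∀ k, (∃ j < k, next l (gpath l j) = none ∧ (gpath l j).length = j + 1) ∨
      (gpath l k).length = k + 1 := by
    intro k
    induction k with
    | zero => exact Or.inr rfl
    | succ k ih =>
      rcases ih with ⟨j, hj, hj'⟩ | ih
      · exact Or.inl ⟨j, by omega, hj'⟩
      · cases h : next l (gpath l k) with
        | none => exact Or.inl ⟨k, by omega, h, ih⟩
        | some w => exact Or.inr (by rw [gpath_succ_of_some h, List.length_cons, ih])
  rcases key (n + 1) with ⟨j, hj, hj'⟩ | h
  · exact ⟨j, by omega, hj'⟩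
  · have := length_le_card _ (gpath_nodup l (n + 1))
    omega

section Tree

variable {par : Vertex n → Option (Vertex n)}

/-- The next vertex `w` is adjacent to the head `v`. It is not an ancestor of `v`, as the path is
closed upwards, so it lies below a child `c` of `v`. If `c ≠ w`, then `c` is off the path and stands
behind `w` in the list of `v`, where `w` is the first vertex off the path. This contradicts
`FirstChild`. -/
theorem gpath_up_chain (hT : IsDFSTree (graph l) none par) (hF : FirstChild l par) (k : ℕ) :
    ((gpath l k).IsChain fun a b => par a = some b) ∧
      ∀ a ∈ gpath l k, ∀ b, par a = some b → b ∈ gpath l k := by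
  induction k with
  | zero => exact ⟨List.isChain_singleton _, by simp [gpath, hT.root]⟩
  | succ k ih =>
    cases h : next l (gpath l k) with
    | none => rwa [gpath_succ_of_none h]
    | some w =>
      rw [gpath_succ_of_some h]
      obtain ⟨v, P, hP, hw, as, bs, hab, has⟩ := next_eq_some h
      obtain ⟨hch, hup⟩ := ih
      have hup' : ∀ x ∈ {x | x ∈ gpath l k}, ∀ u, par x = some u → u ∈ {x | x ∈ gpath l k} := hup
      have hv : v ∈ gpath l k := by simp [hP]
      have hvw : (graph l).Adj v w := mem_nbrs.1 (by rw [hab]; simp)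
      have hanc : Anc par v w := (hT.no_cross v w hvw).resolve_right fun h1 =>
        hw (Anc.mem_of_mem hup' h1 hv)
      have hpar : par w = some v := by
        rcases hanc.eq_or_child with rfl | ⟨c, hc, hcw⟩
        · exact absurd hv hw
        · by_cases hcw' : c = w
          · exact hcw' ▸ hc
          exfalso
          have hcP : c ∉ gpath l k := by
            intro hcP
            have hcv : Anc par c v := by
              rw [hP] at hcP hch
              rcases List.mem_cons.1 hcP with rfl | hcP
              · exact Anc.refl _ _
              · exact anc_of_chain hch hcP
            exact Anc.not_of_par hT.root (hT.spanning c) hc hcv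
          have hcn : c ∈ nbrs l v := mem_nbrs.2 (hT.tree_edge v c hc)
          rw [hab] at hcn
          rcases List.mem_append.1 hcn with h1 | h1
          · exact hcP (has c h1)
          · have h1 := (List.mem_cons.1 h1).resolve_left hcw'
            obtain ⟨b1, b2, rfl⟩ := List.append_of_mem h1
            exact hF v c hc (as ++ w :: b1) b2 (by rw [hab]; simp) w (by simp) hcw
      constructor
      · rw [hP] at hch ⊢
        exact List.isChain_cons_cons.2 ⟨hpar, hch⟩
      · intro a ha b hb
        rcases List.mem_cons.1 ha with rfl | ha
        · rw [hpar] at hb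
          cases hb
          exact List.mem_cons_of_mem _ hv
        · exact List.mem_cons_of_mem _ (hup a ha b hb)

/-- If every vertex off the greedy path has a neighbour among its last `b` vertices, then the
other vertices of the path lie on the stick. -/
theorem drop_subset_stick (hT : IsDFSTree (graph l) none par) (hF : FirstChild l par) {k b : ℕ}
    (hb : 1 ≤ b) (h : ∀ c ∉ gpath l k, ∃ y ∈ (gpath l k).take b, (graph l).Adj c y)
    {u : Vertex n} (hu : u ∈ (gpath l k).drop b) : u ∈ stick par := by
  obtain ⟨hch, hup⟩ := gpath_up_chain hT hF k
  have hup' : ∀ x ∈ {x | x ∈ gpath l k}, ∀ u, par x = some u → u ∈ {x | x ∈ gpath l k} := hup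
  -- Let `x` follow `u` on the path and let `c` be another child of `u`. It is not below `x`, and
  -- not on the path, whose other vertices are below `x` or above `u`. Its neighbour `y` among the
  -- last `b` vertices is below `x`. If `c` is above `y`, it is on the path; if it is below `y`, it
  -- is below `x`.
  have main : ∀ P1 P2 u, gpath l k = P1 ++ u :: P2 → b ≤ P1.length → ∃! c, par c = some u := by
    intro P1 P2 u hP hlen
    rcases List.eq_nil_or_concat P1 with rfl | ⟨P1, x, rfl⟩
    · simp at hlen
      omega
    have hP : gpath l k = P1 ++ x :: u :: P2 := by simpa using hP
    rw [hP] at hch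
    have hch2 := (List.isChain_append.1 hch).2.1
    have hxu : par x = some u := (List.isChain_cons_cons.1 hch2).1
    have hxP1 : ∀ y ∈ P1 ++ [x], Anc par x y := by
      intro y hy
      rcases List.mem_append.1 hy with hy | hy
      · obtain ⟨q1, q2, rfl⟩ := List.append_of_mem hy
        have : (y :: (q2 ++ x :: u :: P2)).IsChain fun a b => par a = some b := by
          have hh : q1 ++ y :: q2 ++ x :: u :: P2 = q1 ++ (y :: (q2 ++ x :: u :: P2)) := by simp
          rw [hh] at hch
          exact (List.isChain_append.1 hch).2.1
        exact anc_of_chain this (by simp)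
      · rw [List.mem_singleton.1 hy]
        exact Anc.refl _ _
    have hcu : ∀ y ∈ u :: P2, Anc par y u := by
      intro y hy
      rcases List.mem_cons.1 hy with rfl | hy
      · exact Anc.refl _ _
      · exact anc_of_chain (List.isChain_cons_cons.1 hch2).2 hy
    refine ⟨x, hxu, fun c hc => ?_⟩
    by_contra hcx
    have hnot : ¬ Anc par x c := by
      intro hxc
      rcases hxc.eq_or_par hc with h1 | h1
      · exact hcx h1
      · exact Anc.not_of_par hT.root (hT.spanning x) hxu h1
    by_cases hcP : c ∈ gpath l k
    · have hcP' : c ∈ (P1 ++ [x]) ++ (u :: P2) := by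
        rw [hP] at hcP
        simpa using hcP
      rcases List.mem_append.1 hcP' with h1 | h1
      · exact hnot (hxP1 c h1)
      · exact Anc.not_of_par hT.root (hT.spanning c) hc (hcu c h1)
    · obtain ⟨y, hy, hcy⟩ := h c hcP
      have hyP : y ∈ gpath l k := List.mem_of_mem_take hy
      have hy1 : y ∈ P1 ++ [x] := by
        have hP' : gpath l k = (P1 ++ [x]) ++ (u :: P2) := by simpa using hP
        rw [hP', List.take_append_of_le_length (by simpa using hlen)] at hy
        exact List.mem_of_mem_take hy
      rcases hT.no_cross c y hcy with h1 | h1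
      · exact hcP (Anc.mem_of_mem hup' h1 hyP)
      · exact hnot ((hxP1 y hy1).trans h1)
  have hsplit : ∀ u ∈ (gpath l k).drop b, ∃ P1 P2, gpath l k = P1 ++ u :: P2 ∧ b ≤ P1.length ∧
      ∀ x ∈ P2, x ∈ (gpath l k).drop b := by
    intro u hu
    obtain ⟨q1, q2, hq⟩ := List.append_of_mem hu
    refine ⟨(gpath l k).take b ++ q1, q2, ?_, ?_, ?_⟩
    · rw [List.append_assoc, ← hq, List.take_append_drop]
    · have : b < (gpath l k).length := by
        by_contra hlt
        rw [List.drop_eq_nil_of_le (by omega)] at hu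
        cases hu
      rw [List.length_append, List.length_take]
      omega
    · intro x hx
      rw [hq]
      simp [hx]
  have hupd : ∀ x ∈ {x | x ∈ (gpath l k).drop b}, ∀ u, par x = some u →
      u ∈ {x | x ∈ (gpath l k).drop b} := by
    intro x hx y hy
    obtain ⟨P1, P2, hP, hlen, hP2⟩ := hsplit x hx
    rw [hP] at hch
    have hch2 := (List.isChain_append.1 hch).2.1
    cases P2 with
    | nil =>
      -- The greedy path lists the pseudo root last.
      have hx0 : x = none := by
        by_contra hx0
        have hk : ∀ k, (gpath l k).getLast? = some none := by
          intro k
          induction k with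
          | zero => rfl
          | succ k ih =>
            cases h : next l (gpath l k) with
            | none => rwa [gpath_succ_of_none h]
            | some w =>
              rw [gpath_succ_of_some h, List.getLast?_cons, ih]
              rfl
        have := hk k
        rw [hP] at this
        simp at this
        exact hx0 this
      rw [hx0, hT.root] at hy
      cases hy
    | cons z P2 =>
      have := (List.isChain_cons_cons.1 hch2).1
      rw [hy] at this
      cases this
      exact hP2 y (by simp)
  intro u' hu'
  obtain ⟨P1, P2, hP, hlen, _⟩ := hsplit u' (hu'.mem_of_mem hupd hu)
  exact main P1 P2 u' hP hlen

theorem bristles_ncard_le (hT : IsDFSTree (graph l) none par) (hF : FirstChild l par) {k b : ℕ}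
    (hb : 1 ≤ b) (h : ∀ c ∉ gpath l k, ∃ y ∈ (gpath l k).take b, (graph l).Adj c y) :
    (bristles par).ncard ≤ n + 1 - ((gpath l k).length - b) := by
  classical
  have hsub : bristles par ⊆ ((((gpath l k).drop b).toFinset)ᶜ : Finset (Vertex n)) := by
    intro v hv
    rw [Finset.mem_coe, Finset.mem_compl, List.mem_toFinset]
    exact fun hvd => hv (drop_subset_stick hT hF hb h hvd)
  refine (Set.ncard_le_ncard hsub).trans ?_
  rw [Set.ncard_coe_finset, Finset.card_compl,
    List.toFinset_card_of_nodup ((gpath_nodup l k).sublist (List.drop_sublist _ _)),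
    List.length_drop]
  simp

end Tree

/-! ### The path does not depend on the edges at a vertex that it avoids -/

/-- The edges that do not touch `a`. -/
def avoid (a : Fin n) (l : List (Edge n)) : List (Edge n) :=
  l.filter fun e => e.1.1 ≠ a ∧ e.1.2 ≠ a

theorem nbrs_avoid {a v : Fin n} (hv : v ≠ a) :
    nbrs (avoid a l) (some v) = (nbrs l (some v)).filter fun w => decide (w ≠ some a) := by
  rw [nbrs, nbrs, List.filter_cons_of_pos (by simp)]
  congr 1
  induction l with
  | nil => rfl
  | cons e l ih =>
    rw [avoid] at ih ⊢
    by_cases h1 : e.1.1 = v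
    · by_cases h2 : e.1.2 = a
      · rw [List.filter_cons_of_neg (by simp [h2]), List.filterMap_cons, if_pos h1,
          List.filter_cons_of_neg (by simp [h2]), ih]
      · rw [List.filter_cons_of_pos (by simp [h1, h2, hv]), List.filterMap_cons, if_pos h1,
          List.filterMap_cons, if_pos h1, List.filter_cons_of_pos (by simp [h2]), ih]
    · by_cases h3 : e.1.2 = v
      · by_cases h2 : e.1.1 = a
        · rw [List.filter_cons_of_neg (by simp [h2]), List.filterMap_cons, if_neg h1, if_pos h3,
            List.filter_cons_of_neg (by simp [h2]), ih]
        · rw [List.filter_cons_of_pos (by simp [h3, h2, hv]), List.filterMap_cons, if_neg h1,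
            if_pos h3, List.filterMap_cons, if_neg h1, if_pos h3,
            List.filter_cons_of_pos (by simp [h2]), ih]
      · rw [List.filterMap_cons (a := e) (l := l), if_neg h1, if_neg h3, ← ih, List.filter_cons]
        split_ifs
        · rw [List.filterMap_cons, if_neg h1, if_neg h3]
        · rfl

theorem find?_and_of_ne {α : Type*} {p q : α → Bool} {a : α} {L : List α}
    (hp : ∀ x, x ≠ a → p x = true) (h : L.find? q ≠ some a) :
    L.find? (fun x => p x && q x) = L.find? q := by
  induction L with
  | nil => rfl
  | cons w L ih =>
    rw [List.find?_cons] at h ⊢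
    rw [List.find?_cons]
    cases hq : q w with
    | true =>
      rw [hq] at h
      rw [hp w fun hw => h (by rw [hw])]
      rfl
    | false =>
      rw [hq] at h
      simpa using ih h

/-- Deleting the edges at `a` only removes `a` from the other lists, and this matters only if `a`
was the vertex found. -/
theorem next_avoid {a : Fin n} {P : List (Vertex n)} (hP : some a ∉ P)
    (h : next l P ≠ some (some a)) : next (avoid a l) P = next l P := by
  cases P with
  | nil => rfl
  | cons v P =>
    cases v with
    | none => rfl
    | some v =>
      have hva : v ≠ a := by
        rintro rfl
        simp at hP
      rw [next, next, nbrs_avoid hva, List.find?_filter]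
      rw [next] at h
      simp only [Bool.decide_and, Bool.decide_eq_true]
      exact find?_and_of_ne (fun x hx => decide_eq_true hx) h

theorem gpath_avoid {a : Fin n} {k : ℕ} (h : some a ∉ gpath l k) :
    gpath (avoid a l) k = gpath l k := by
  induction k with
  | zero => rfl
  | succ k ih =>
    cases hn : next l (gpath l k) with
    | none =>
      rw [gpath_succ_of_none hn] at h ⊢
      have hk := ih h
      rw [gpath_succ_of_none, hk]
      rw [hk, next_avoid h (by simp [hn]), hn]
    | some w =>
      rw [gpath_succ_of_some hn] at h ⊢
      rw [List.mem_cons, not_or] at h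
      have hk := ih h.2
      rw [gpath_succ_of_some, hk]
      rw [hk, next_avoid h.2, hn]
      rw [hn]
      exact fun hw => h.1 (Option.some_injective _ hw).symm

/-- Sets of vertices, determined by the edges off `a`, one of which `a` has no neighbour in if
there are many bristles. -/
def witness (l : List (Edge n)) (b : ℕ) (a : Fin n) (k : ℕ) (i : Bool) : Finset (Fin n) :=
  Finset.univ.filter fun w => w ≠ a ∧
    if i then some w ∉ gpath l k else some w ∈ (gpath l k).take b

/-- Let the path be stuck after `k` steps. If at least `b` vertices are left over, its end `a` has
no neighbour among them, and the path before its last step does not depend on the edges at `a`. If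
fewer are left over, the comparison with the stick must fail, as it would leave at most `2 * b`
bristles; so some `a` off the path has no neighbour among its last `b` vertices, and the whole path
is independent of the edges at `a`. -/
theorem exists_witness (hl : l.Nodup) {b : ℕ} (hb : 1 ≤ b)
    (hbr : 2 * b < (bristles (tree l)).ncard) :
    ∃ a, ∃ k ≤ n, ∃ i, b ≤ (witness (avoid a l) b a k i).card ∧
      ∀ w ∈ witness (avoid a l) b a k i, ¬ (graph l).Adj (some a) (some w) := by
  have hT := tree_isDFSTree hl
  have hF := tree_firstChild hl
  obtain ⟨k, hk, hstuck, hlen⟩ := exists_stuck l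
  by_cases hU : n - k < b
  · have : ∃ c ∉ gpath l k, ∀ y ∈ (gpath l k).take b, ¬ (graph l).Adj c y := by
      by_contra hcon
      push Not at hcon
      have := bristles_ncard_le hT hF hb hcon
      omega
    obtain ⟨c, hc, hy⟩ := this
    cases c with
    | none => exact absurd (none_mem_gpath l k) hc
    | some a =>
      -- The pseudo root is a neighbour of `a`, so it is not in the segment. Hence the segment is
      -- not the whole path and consists of exactly `b` proper vertices.
      have hnone : none ∉ (gpath l k).take b := fun h => hy none h graph_adj_none.symm
      have hbk : b ≤ k + 1 := by
        by_contra hbk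
        rw [List.take_of_length_le (by omega)] at hnone
        exact hnone (none_mem_gpath l k)
      refine ⟨a, k, hk, false, ?_, ?_⟩
      · have hcard : ((gpath l k).take b).toFinset.card = b := by
          rw [List.toFinset_card_of_nodup ((gpath_nodup l k).sublist (List.take_sublist _ _)),
            List.length_take]
          omega
        rw [← Finset.card_map Function.Embedding.some]
        refine hcard.symm.le.trans (Finset.card_le_card fun x hx => ?_)
        rw [List.mem_toFinset] at hx
        cases x with
        | none => exact absurd hx hnone
        | some x =>
          simp only [witness, gpath_avoid hc, Finset.mem_map, Finset.mem_filter, Finset.mem_univ,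
            true_and]
          refine ⟨x, ⟨?_, by simpa using hx⟩, rfl⟩
          rintro rfl
          exact hc (List.mem_of_mem_take hx)
      · intro w hw
        simp only [witness, gpath_avoid hc, Finset.mem_filter, Finset.mem_univ, true_and] at hw
        exact hy (some w) (by simpa using hw.2)
  · cases k with
    | zero =>
      exfalso
      -- The path cannot be stuck at the pseudo root, which is joined to every vertex.
      have : next l [none] = none := hstuck
      rw [next, List.find?_eq_none] at this
      have h0 : 0 < n := by omega
      exact this (some ⟨0, h0⟩) (by simp [nbrs]) (by simp)
    | succ k =>
      cases hn : next l (gpath l k) with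
      | none =>
        rw [gpath_succ_of_none hn] at hlen
        have := length_gpath_le l k
        omega
      | some c =>
        have hP := gpath_succ_of_some hn
        obtain ⟨_, _, _, hc, _⟩ := next_eq_some hn
        cases c with
        | none => exact absurd (none_mem_gpath l k) hc
        | some a =>
          refine ⟨a, k, by omega, true, ?_, ?_⟩
          · have hcard : (gpath l (k + 1)).toFinset.card = k + 2 := by
              rw [List.toFinset_card_of_nodup (gpath_nodup l (k + 1)), hlen]
            have hcompl : ((gpath l (k + 1)).toFinsetᶜ).card = n - (k + 1) := by
              rw [Finset.card_compl, hcard]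
              simp
            rw [← Finset.card_map Function.Embedding.some]
            refine le_trans (by omega : b ≤ ((gpath l (k + 1)).toFinsetᶜ).card)
              (Finset.card_le_card fun x hx => ?_)
            rw [Finset.mem_compl, List.mem_toFinset] at hx
            cases x with
            | none => exact absurd (none_mem_gpath l (k + 1)) hx
            | some x =>
              rw [hP, List.mem_cons, not_or] at hx
              simp only [witness, gpath_avoid hc, Finset.mem_map, Finset.mem_filter,
                Finset.mem_univ, true_and, if_true]
              exact ⟨x, ⟨fun h => hx.1 (by rw [h]), hx.2⟩, rfl⟩
          · intro w hw hadj
            simp only [witness, gpath_avoid hc, Finset.mem_filter, Finset.mem_univ,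
              true_and, if_true] at hw
            rw [hP, next, List.find?_eq_none] at hstuck
            refine hstuck (some w) (mem_nbrs.2 hadj) ?_
            rw [decide_eq_true_eq, List.mem_cons, not_or]
            exact ⟨fun h => hw.1 (Option.some_injective _ h), hw.2⟩

end Greedy

/-! ### Counting orderings -/

section Counting

open scoped Classical

variable {α : Type*} [Fintype α] [DecidableEq α]

/-- The orderings that put the elements of `T` at positions in `A`. -/
theorem card_symm_mem_le (A : Finset (Fin (Fintype.card α))) (T : Finset α) :
    (Finset.univ.filter fun σ : Fin (Fintype.card α) ≃ α => ∀ t ∈ T, σ.symm t ∈ A).card *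
        Fintype.card α ^ T.card ≤
      A.card ^ T.card * Fintype.card (Fin (Fintype.card α) ≃ α) := by
  induction T using Finset.induction_on with
  | empty => simp
  | insert t T ht ih =>
    set P := Finset.univ.filter fun σ : Fin (Fintype.card α) ≃ α => ∀ t ∈ T, σ.symm t ∈ A with hP
    set X := Finset.univ.filter fun σ : Fin (Fintype.card α) ≃ α =>
      ∀ u ∈ insert t T, σ.symm u ∈ A with hX
    have hXP : X ⊆ P := by
      intro σ hσ
      simp only [hX, hP, Finset.mem_filter, Finset.mem_univ, true_and] at hσ ⊢
      exact fun u hu => hσ u (Finset.mem_insert_of_mem hu)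
    -- Exchanging the values `t` and `t'` gives `t'` the position of `t` and respects the condition
    -- on `T`. Averaging over all `t'` yields the factor `A.card / Fintype.card α` for the new
    -- element.
    have key : ∀ t', X.card ≤ (P.filter fun σ => σ.symm t' ∈ A).card := by
      intro t'
      by_cases ht' : t' ∈ T
      · rw [Finset.filter_true_of_mem]
        · exact Finset.card_le_card hXP
        · intro σ hσ
          simp only [hP, Finset.mem_filter, Finset.mem_univ, true_and] at hσ
          exact hσ t' ht'
      · refine Finset.card_le_card_of_injOn (fun σ => σ.trans (Equiv.swap t t')) ?_ ?_
        · intro σ hσ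
          simp only [hX, hP, Finset.coe_filter, Finset.mem_filter, Finset.mem_univ, true_and,
            Finset.mem_insert, forall_eq_or_imp, Set.mem_ofPred_eq] at hσ ⊢
          refine ⟨fun u hu => ?_, ?_⟩
          · have h1 : u ≠ t := fun h => ht (h ▸ hu)
            have h2 : u ≠ t' := fun h => ht' (h ▸ hu)
            simpa [Equiv.swap_apply_of_ne_of_ne h1 h2] using hσ.2 u hu
          · simpa using hσ.1
        · intro σ _ τ _ h
          have h : σ.trans (Equiv.swap t t') = τ.trans (Equiv.swap t t') := h
          ext x
          have := congrArg (fun e => Equiv.swap t t' (e x)) h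
          simpa using this
    have hsum : ∑ t' : α, (P.filter fun σ => σ.symm t' ∈ A).card = P.card * A.card := by
      have h1 := Finset.sum_card_bipartiteAbove_eq_sum_card_bipartiteBelow
        (fun (t' : α) (σ : Fin (Fintype.card α) ≃ α) => σ.symm t' ∈ A) (s := Finset.univ) (t := P)
      simp only [Finset.bipartiteAbove, Finset.bipartiteBelow] at h1
      rw [h1]
      have h2 : ∀ σ ∈ P, (Finset.univ.filter fun t' : α => σ.symm t' ∈ A).card = A.card := by
        intro σ _
        rw [← Finset.card_map σ.toEmbedding]
        congr 1
        ext x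
        simp only [Finset.mem_filter, Finset.mem_univ, true_and, Finset.mem_map_equiv]
      rw [Finset.sum_congr rfl h2, Finset.sum_const, smul_eq_mul]
    have h3 : Fintype.card α * X.card ≤ P.card * A.card := by
      calc Fintype.card α * X.card = ∑ _t' : α, X.card := by
            rw [Finset.sum_const, Finset.card_univ, smul_eq_mul]
        _ ≤ P.card * A.card := hsum ▸ Finset.sum_le_sum fun t' _ => key t'
    rw [Finset.card_insert_of_notMem ht, pow_succ, pow_succ]
    calc X.card * (Fintype.card α ^ T.card * Fintype.card α)
        = (Fintype.card α * X.card) * Fintype.card α ^ T.card := by ring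
      _ ≤ (P.card * A.card) * Fintype.card α ^ T.card := Nat.mul_le_mul_right _ h3
      _ = (P.card * Fintype.card α ^ T.card) * A.card := by ring
      _ ≤ (A.card ^ T.card * Fintype.card (Fin (Fintype.card α) ≃ α)) * A.card :=
          Nat.mul_le_mul_right _ ih
      _ = _ := by ring

/-- Two lists without repetitions and with the same members differ by a permutation of the
members. -/
theorem exists_perm_map {α : Type*} [DecidableEq α] {L L' : List α} (h : L.Perm L') (hL : L.Nodup) :
    ∃ θ : Equiv.Perm α, L.map θ = L' ∧ ∀ x ∉ L, θ x = x := by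
  induction h with
  | nil => exact ⟨1, rfl, fun _ _ => rfl⟩
  | @cons x l₁ l₂ h ih =>
    rw [List.nodup_cons] at hL
    obtain ⟨θ, h1, h2⟩ := ih hL.2
    refine ⟨θ, ?_, fun y hy => h2 y fun h => hy (List.mem_cons_of_mem _ h)⟩
    rw [List.map_cons, h1, h2 x hL.1]
  | swap x y l =>
    refine ⟨Equiv.swap x y, ?_, ?_⟩
    · simp only [List.nodup_cons, List.mem_cons, not_or] at hL
      simp only [List.map_cons, Equiv.swap_apply_right, Equiv.swap_apply_left, List.cons.injEq,
        true_and]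
      conv_rhs => rw [← List.map_id l]
      refine List.map_congr_left fun z hz => ?_
      refine Equiv.swap_apply_of_ne_of_ne ?_ ?_
      · rintro rfl
        exact hL.2.1 hz
      · rintro rfl
        exact hL.1.2 hz
    · intro z hz
      simp only [List.mem_cons, not_or] at hz
      exact Equiv.swap_apply_of_ne_of_ne hz.2.1 hz.1
  | @trans l₁ l₂ l₃ h1 h2 ih1 ih2 =>
    obtain ⟨θ₁, h3, h4⟩ := ih1 hL
    obtain ⟨θ₂, h5, h6⟩ := ih2 (h1.nodup_iff.1 hL)
    refine ⟨θ₁.trans θ₂, ?_, ?_⟩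
    · rw [← h5, ← h3, List.map_map]
      rfl
    · intro x hx
      rw [Equiv.trans_apply, h4 x hx, h6 x fun h => hx (h1.mem_iff.2 h)]

/-- The order of the elements off `D`. -/
def relOrder (D : Finset α) (σ : Fin (Fintype.card α) ≃ α) : List α :=
  (List.ofFn σ).filter fun x => decide (x ∉ D)

theorem mem_relOrder {D : Finset α} {σ : Fin (Fintype.card α) ≃ α} {x : α} :
    x ∈ relOrder D σ ↔ x ∉ D := by
  simp only [relOrder, List.mem_filter, List.mem_ofFn, decide_eq_true_eq, and_iff_right_iff_imp]
  exact fun _ => ⟨σ.symm x, by simp⟩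

theorem relOrder_nodup (D : Finset α) (σ : Fin (Fintype.card α) ≃ α) : (relOrder D σ).Nodup :=
  (List.nodup_ofFn.2 σ.injective).filter _

theorem relOrder_trans {D : Finset α} (σ : Fin (Fintype.card α) ≃ α) {θ : Equiv.Perm α}
    (hθ : ∀ x ∈ D, θ x = x) : relOrder D (σ.trans θ) = (relOrder D σ).map θ := by
  have h1 : List.ofFn (σ.trans θ) = (List.ofFn σ).map θ := by
    rw [List.map_ofFn]
    rfl
  rw [relOrder, h1, List.filter_map, relOrder]
  congr 1
  refine List.filter_congr fun x _ => ?_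
  rw [Function.comp_apply, decide_eq_decide, not_iff_not]
  constructor
  · intro hx
    have : θ (θ x) = θ x := hθ _ hx
    rwa [θ.injective this] at hx
  · intro hx
    rwa [hθ x hx]

/-- The positions of the elements of `D` are independent of the order of the other elements. -/
theorem card_fiber_le {D T : Finset α} (hT : T ⊆ D) (A : Finset (Fin (Fintype.card α)))
    (σ₀ σ₁ : Fin (Fintype.card α) ≃ α) :
    (Finset.univ.filter fun σ : Fin (Fintype.card α) ≃ α =>
      relOrder D σ = relOrder D σ₀ ∧ ∀ t ∈ T, σ.symm t ∈ A).card ≤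
    (Finset.univ.filter fun σ : Fin (Fintype.card α) ≃ α =>
      relOrder D σ = relOrder D σ₁ ∧ ∀ t ∈ T, σ.symm t ∈ A).card := by
  have hperm : (relOrder D σ₀).Perm (relOrder D σ₁) :=
    (List.perm_ext_iff_of_nodup (relOrder_nodup D σ₀) (relOrder_nodup D σ₁)).2 fun x => by
      rw [mem_relOrder, mem_relOrder]
  obtain ⟨θ, h1, h2⟩ := exists_perm_map hperm (relOrder_nodup D σ₀)
  have hθ : ∀ x ∈ D, θ x = x := fun x hx => h2 x fun h => mem_relOrder.1 h hx
  refine Finset.card_le_card_of_injOn (fun σ => σ.trans θ) ?_ ?_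
  · intro σ hσ
    simp only [Finset.coe_filter, Finset.mem_univ, true_and, Set.mem_ofPred_eq] at hσ ⊢
    refine ⟨by rw [relOrder_trans σ hθ, hσ.1, h1], fun t ht => ?_⟩
    have : θ.symm t = t := by
      rw [Equiv.symm_apply_eq, hθ t (hT ht)]
    rw [Equiv.symm_trans_apply, this]
    exact hσ.2 t ht
  · intro σ _ τ _ h
    have h : σ.trans θ = τ.trans θ := h
    ext x
    have := congrArg (fun e => θ.symm (e x)) h
    simpa using this

/-- The bound for a fixed set of `b` elements persists if the set is chosen within `D` by looking at
the order of the elements off `D` only: condition on that order and apply the bound for fixed sets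
in each fibre. -/
theorem card_relOrder_le (D : Finset α) (A : Finset (Fin (Fintype.card α))) (b : ℕ)
    (cond : List α → Prop) [DecidablePred cond] (f : List α → Finset α)
    (hf : ∀ ρ, cond ρ → f ρ ⊆ D ∧ b ≤ (f ρ).card) :
    (Finset.univ.filter fun σ : Fin (Fintype.card α) ≃ α =>
        cond (relOrder D σ) ∧ ∀ t ∈ f (relOrder D σ), σ.symm t ∈ A).card * Fintype.card α ^ b ≤
      A.card ^ b * Fintype.card (Fin (Fintype.card α) ≃ α) := by
  set R := (Finset.univ : Finset (Fin (Fintype.card α) ≃ α)).image (relOrder D) with hR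
  let c : List α → Finset α → ℕ := fun ρ T =>
    (Finset.univ.filter fun σ : Fin (Fintype.card α) ≃ α =>
      relOrder D σ = ρ ∧ ∀ t ∈ T, σ.symm t ∈ A).card
  have hsum : ∀ T, ∑ ρ ∈ R, c ρ T =
      (Finset.univ.filter fun σ : Fin (Fintype.card α) ≃ α => ∀ t ∈ T, σ.symm t ∈ A).card := by
    intro T
    rw [Finset.card_eq_sum_card_fiberwise (f := relOrder D) (t := R)]
    · refine Finset.sum_congr rfl fun ρ _ => ?_
      rw [Finset.filter_filter]
      simp only [c, and_comm]
    · intro σ _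
      simp [hR]
  -- All fibres contain equally many orderings that put `T` into `A`. This is the independence,
  -- written without division.
  have hconst : ∀ T ⊆ D, ∀ ρ ∈ R, R.card * c ρ T =
      (Finset.univ.filter fun σ : Fin (Fintype.card α) ≃ α => ∀ t ∈ T, σ.symm t ∈ A).card := by
    intro T hT ρ hρ
    rw [← hsum, ← smul_eq_mul, ← Finset.sum_const]
    refine Finset.sum_congr rfl fun ρ' hρ' => ?_
    simp only [hR, Finset.mem_image, Finset.mem_univ, true_and] at hρ hρ'
    obtain ⟨σ, rfl⟩ := hρ
    obtain ⟨σ', rfl⟩ := hρ'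
    exact le_antisymm (card_fiber_le hT A σ σ') (card_fiber_le hT A σ' σ)
  have hpt : ∀ ρ ∈ R, (if cond ρ then c ρ (f ρ) else 0) * Fintype.card α ^ b ≤
      A.card ^ b * c ρ ∅ := by
    intro ρ hρ
    split_ifs with hc
    · obtain ⟨hfD, hfb⟩ := hf ρ hc
      obtain ⟨T, hTf, hTb⟩ := Finset.exists_subset_card_eq hfb
      have h1 := hconst T (hTf.trans hfD) ρ hρ
      have h2 := hconst ∅ (Finset.empty_subset _) ρ hρ
      have h3 := card_symm_mem_le A T
      rw [← h1, hTb] at h3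
      have h4 : R.card * c ρ ∅ = Fintype.card (Fin (Fintype.card α) ≃ α) := by
        rw [h2]
        simp
      rw [← h4] at h3
      have hRpos : 0 < R.card := Finset.card_pos.2 ⟨ρ, hρ⟩
      have h5 : c ρ (f ρ) ≤ c ρ T := by
        refine Finset.card_le_card fun σ hσ => ?_
        simp only [Finset.mem_filter, Finset.mem_univ, true_and] at hσ ⊢
        exact ⟨hσ.1, fun t ht => hσ.2 t (hTf ht)⟩
      refine le_trans (Nat.mul_le_mul_right _ h5) ?_
      refine Nat.le_of_mul_le_mul_left ?_ hRpos
      calc R.card * (c ρ T * Fintype.card α ^ b) = R.card * c ρ T * Fintype.card α ^ b := by ring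
        _ ≤ A.card ^ b * (R.card * c ρ ∅) := h3
        _ = _ := by ring
    · simp
  have hbad : (Finset.univ.filter fun σ : Fin (Fintype.card α) ≃ α =>
      cond (relOrder D σ) ∧ ∀ t ∈ f (relOrder D σ), σ.symm t ∈ A).card =
      ∑ ρ ∈ R, if cond ρ then c ρ (f ρ) else 0 := by
    rw [Finset.card_eq_sum_card_fiberwise (f := relOrder D) (t := R)]
    · refine Finset.sum_congr rfl fun ρ _ => ?_
      rw [Finset.filter_filter]
      split_ifs with hc
      · refine congrArg Finset.card (Finset.filter_congr fun σ _ => ?_)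
        constructor
        · rintro ⟨⟨h1, h2⟩, rfl⟩
          exact ⟨rfl, h2⟩
        · rintro ⟨rfl, h2⟩
          exact ⟨⟨hc, h2⟩, rfl⟩
      · rw [Finset.card_eq_zero, Finset.filter_eq_empty_iff]
        rintro σ _ ⟨⟨h1, h2⟩, rfl⟩
        exact hc h1
    · intro σ _
      simp [hR]
  rw [hbad, Finset.sum_mul]
  refine (Finset.sum_le_sum hpt).trans ?_
  rw [← Finset.mul_sum, hsum]
  simp

end Counting

/-! ### Random orderings: many bristles, large degrees, the next edge. -/

section Orderings

open scoped Classical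

variable {n : ℕ}

theorem mem_firstEdges {σ : Ordering n} {m : ℕ} {e : Edge n} :
    e ∈ firstEdges σ m ↔ (σ.symm e : ℕ) < m := by
  rw [firstEdges, List.mem_take_iff_getElem]
  constructor
  · rintro ⟨i, hi, rfl⟩
    simp only [List.getElem_ofFn, Equiv.symm_apply_apply]
    omega
  · intro h
    refine ⟨σ.symm e, ?_, by simp⟩
    rw [List.length_ofFn]
    exact lt_min h (σ.symm e).2

theorem firstEdges_nodup (σ : Ordering n) (m : ℕ) : (firstEdges σ m).Nodup :=
  (List.nodup_ofFn.2 σ.injective).sublist (List.take_sublist _ _)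

theorem firstEdges_succ (σ : Ordering n) {i : ℕ} (hi : i < Fintype.card (Edge n)) :
    firstEdges σ (i + 1) = firstEdges σ i ++ [σ ⟨i, hi⟩] := by
  rw [firstEdges, firstEdges, List.take_add_one, List.getElem?_eq_getElem (by simpa using hi)]
  simp

/-- The edges at a vertex. -/
def star (a : Fin n) : Finset (Edge n) :=
  Finset.univ.filter fun e => e.1.1 = a ∨ e.1.2 = a

theorem relOrder_star (a : Fin n) (σ : Ordering n) :
    relOrder (star a) σ = avoid a (List.ofFn σ) := by
  rw [relOrder, avoid]
  refine List.filter_congr fun e _ => ?_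
  rw [decide_eq_decide]
  simp [star]

/-- The cut `j` depends on where the edges at `a` are placed, so it is not determined by the order
of the other edges. It becomes one more parameter of the union bound. -/
theorem exists_avoid_firstEdges (a : Fin n) (σ : Ordering n) (m : ℕ) :
    ∃ j ≤ Fintype.card (Edge n), avoid a (firstEdges σ m) = (relOrder (star a) σ).take j := by
  refine ⟨(avoid a (firstEdges σ m)).length, ?_, ?_⟩
  · refine (List.length_filter_le _ _).trans ?_
    rw [firstEdges, List.length_take, List.length_ofFn]
    exact min_le_right _ _
  · rw [relOrder_star]
    conv_rhs => rw [← List.take_append_drop m (List.ofFn σ)]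
    rw [avoid, avoid, List.filter_append, firstEdges, List.take_left]

/-- The other endpoint of an edge at `a`. -/
def other (a : Fin n) (e : Edge n) : Fin n := if e.1.1 = a then e.1.2 else e.1.1

theorem card_star_le (a : Fin n) : (star a).card ≤ n := by
  have : (star a).card ≤ (Finset.univ : Finset (Fin n)).card := by
    refine Finset.card_le_card_of_injOn (other a) (fun _ _ => Finset.mem_coe.2 (Finset.mem_univ _)) ?_
    intro e he f hf h
    simp only [star, Finset.coe_filter, Finset.mem_univ, true_and, Set.mem_ofPred_eq] at he hf
    have h1 := e.2
    have h2 := f.2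
    simp only [other] at h
    apply Subtype.ext
    apply Prod.ext <;> grind
  simpa using this

/-- Union bound over the vertex `a`, the number `k` of steps, the two kinds of witness and the cut
`j`, which give the factors `n`, `n + 1`, `2` and `N + 1`. For fixed parameters the witness depends
only on the order of the edges off `star a`, and its at least `b` edges to `a` must all come at
position `m` or later. -/
theorem card_many_bristles_le {m b : ℕ} (hm : m ≤ Fintype.card (Edge n)) (hb : 1 ≤ b) :
    (Finset.univ.filter fun σ : Ordering n =>
        2 * b < (bristles (tree (firstEdges σ m))).ncard).card * Fintype.card (Edge n) ^ b ≤
      n * ((n + 1) * (2 * (Fintype.card (Edge n) + 1))) *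
        ((Fintype.card (Edge n) - m) ^ b * Fintype.card (Ordering n)) := by
  set N := Fintype.card (Edge n) with hN
  let A : Finset (Fin N) := Finset.univ.filter fun p => m ≤ (p : ℕ)
  have hA : A.card = N - m := by
    have h1 : (Finset.univ.filter fun p : Fin N => (p : ℕ) < m).card = m := by
      rw [Fin.card_filter_val_lt]
      exact min_eq_right hm
    have h2 := Finset.card_filter_add_card_filter_not (s := (Finset.univ : Finset (Fin N)))
      (fun p : Fin N => (p : ℕ) < m)
    simp only [not_lt, Finset.card_univ, Fintype.card_fin] at h2
    change (Finset.univ.filter fun p : Fin N => m ≤ (p : ℕ)).card = _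
    omega
  let W : Fin n × ℕ × Bool × ℕ → List (Edge n) → Finset (Fin n) := fun x ρ =>
    witness (ρ.take x.2.2.2) b x.1 x.2.1 x.2.2.1
  let f : Fin n × ℕ × Bool × ℕ → List (Edge n) → Finset (Edge n) := fun x ρ =>
    (star x.1).filter fun e => other x.1 e ∈ W x ρ
  let S : Finset (Fin n × ℕ × Bool × ℕ) :=
    Finset.univ ×ˢ (Finset.range (n + 1) ×ˢ (Finset.univ ×ˢ Finset.range (N + 1)))
  let bad : Fin n × ℕ × Bool × ℕ → Finset (Ordering n) := fun x =>
    Finset.univ.filter fun σ : Ordering n => b ≤ (W x (relOrder (star x.1) σ)).card ∧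
      ∀ t ∈ f x (relOrder (star x.1) σ), σ.symm t ∈ A
  have hScard : S.card = n * ((n + 1) * (2 * (N + 1))) := by
    simp [S, Finset.card_product]
  have hbad : ∀ x ∈ S, (bad x).card * N ^ b ≤ (N - m) ^ b * Fintype.card (Ordering n) := by
    intro x _
    rw [← hA]
    refine card_relOrder_le (star x.1) A b (fun ρ => b ≤ (W x ρ).card) (f x) fun ρ hρ => ?_
    refine ⟨Finset.filter_subset _ _, hρ.trans ?_⟩
    have hsub : W x ρ ⊆ (f x ρ).image (other x.1) := by
      intro w hw
      have hwa : w ≠ x.1 := by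
        simp only [W, witness, Finset.mem_filter] at hw
        exact hw.2.1
      rw [Finset.mem_image]
      rcases lt_or_gt_of_ne hwa with h | h
      · exact ⟨⟨(w, x.1), h⟩, Finset.mem_filter.2 ⟨Finset.mem_filter.2
          ⟨Finset.mem_univ _, Or.inr rfl⟩, by rw [other, if_neg hwa]; exact hw⟩, if_neg hwa⟩
      · exact ⟨⟨(x.1, w), h⟩, Finset.mem_filter.2 ⟨Finset.mem_filter.2
          ⟨Finset.mem_univ _, Or.inl rfl⟩, by rw [other, if_pos rfl]; exact hw⟩, if_pos rfl⟩
    exact (Finset.card_le_card hsub).trans Finset.card_image_le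
  have hcover : (Finset.univ.filter fun σ : Ordering n =>
      2 * b < (bristles (tree (firstEdges σ m))).ncard) ⊆ S.biUnion bad := by
    intro σ hσ
    simp only [Finset.mem_filter, Finset.mem_univ, true_and] at hσ
    obtain ⟨a, k, hk, i, hcard, hadj⟩ := exists_witness (firstEdges_nodup σ m) hb hσ
    obtain ⟨j, hj, hav⟩ := exists_avoid_firstEdges a σ m
    rw [Finset.mem_biUnion]
    refine ⟨(a, k, i, j), ?_, ?_⟩
    · simp only [S, Finset.mem_product, Finset.mem_univ, true_and, Finset.mem_range]
      omega
    · simp only [bad, W, f, Finset.mem_filter, Finset.mem_univ, true_and, ← hav]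
      refine ⟨hcard, ?_⟩
      rintro e ⟨he, hw⟩
      by_contra hlt
      simp only [A, Finset.mem_filter, Finset.mem_univ, true_and, not_le] at hlt
      refine hadj _ hw (graph_adj_some.2 ⟨e, mem_firstEdges.2 hlt, ?_⟩)
      simp only [star, Finset.mem_filter, Finset.mem_univ, true_and] at he
      simp only [other]
      split_ifs with h1
      · exact Or.inl ⟨h1, rfl⟩
      · exact Or.inr ⟨he.resolve_left h1, rfl⟩
  calc _ ≤ (∑ x ∈ S, (bad x).card) * N ^ b :=
        Nat.mul_le_mul_right _ ((Finset.card_le_card hcover).trans Finset.card_biUnion_le)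
    _ = ∑ x ∈ S, (bad x).card * N ^ b := Finset.sum_mul _ _ _
    _ ≤ ∑ x ∈ S, (N - m) ^ b * Fintype.card (Ordering n) := Finset.sum_le_sum hbad
    _ = _ := by rw [Finset.sum_const, hScard, smul_eq_mul]

/-- The number of edges at `a` in a list. -/
def deg (l : List (Edge n)) (a : Fin n) : ℕ := ((star a).filter fun e => e ∈ l).card

/-- Union bound over the vertex and over the sets of `k` possible edges at it that all fall among
the first `m`. -/
theorem card_large_degree_le {m k : ℕ} (hm : m ≤ Fintype.card (Edge n)) :
    (Finset.univ.filter fun σ : Ordering n =>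
        ∃ a, k ≤ deg (firstEdges σ m) a).card * Fintype.card (Edge n) ^ k ≤
      n * n.choose k * (m ^ k * Fintype.card (Ordering n)) := by
  set N := Fintype.card (Edge n) with hN
  let A : Finset (Fin N) := Finset.univ.filter fun p => (p : ℕ) < m
  have hA : A.card = m := by
    change (Finset.univ.filter fun p : Fin N => (p : ℕ) < m).card = m
    rw [Fin.card_filter_val_lt]
    exact min_eq_right hm
  let bad : Finset (Edge n) → Finset (Ordering n) := fun T =>
    Finset.univ.filter fun σ : Ordering n => ∀ t ∈ T, σ.symm t ∈ A
  have hcover : (Finset.univ.filter fun σ : Ordering n => ∃ a, k ≤ deg (firstEdges σ m) a) ⊆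
      (Finset.univ : Finset (Fin n)).biUnion fun a => ((star a).powersetCard k).biUnion bad := by
    intro σ hσ
    simp only [Finset.mem_filter, Finset.mem_univ, true_and] at hσ
    obtain ⟨a, ha⟩ := hσ
    obtain ⟨T, hT, hTk⟩ := Finset.exists_subset_card_eq ha
    simp only [Finset.mem_biUnion, Finset.mem_univ, true_and, Finset.mem_powersetCard]
    refine ⟨a, T, ⟨hT.trans (Finset.filter_subset _ _), hTk⟩, ?_⟩
    simp only [bad, A, Finset.mem_filter, Finset.mem_univ, true_and]
    intro t ht
    exact mem_firstEdges.1 (Finset.mem_filter.1 (hT ht)).2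
  have hbad : ∀ T : Finset (Edge n), T.card = k →
      (bad T).card * N ^ k ≤ m ^ k * Fintype.card (Ordering n) := by
    intro T hT
    have := card_symm_mem_le A T
    rwa [hA, hT] at this
  have hstar : ∀ a : Fin n, (((star a).powersetCard k).biUnion bad).card * N ^ k ≤
      n.choose k * (m ^ k * Fintype.card (Ordering n)) := by
    intro a
    calc _ ≤ (∑ T ∈ (star a).powersetCard k, (bad T).card) * N ^ k :=
          Nat.mul_le_mul_right _ Finset.card_biUnion_le
      _ = ∑ T ∈ (star a).powersetCard k, (bad T).card * N ^ k := Finset.sum_mul _ _ _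
      _ ≤ ∑ T ∈ (star a).powersetCard k, m ^ k * Fintype.card (Ordering n) :=
          Finset.sum_le_sum fun T hT => hbad T (Finset.mem_powersetCard.1 hT).2
      _ = (star a).card.choose k * (m ^ k * Fintype.card (Ordering n)) := by
          rw [Finset.sum_const, Finset.card_powersetCard, smul_eq_mul]
      _ ≤ _ := Nat.mul_le_mul_right _ (Nat.choose_le_choose k (card_star_le a))
  calc _ ≤ (∑ a : Fin n, (((star a).powersetCard k).biUnion bad).card) * N ^ k :=
        Nat.mul_le_mul_right _ ((Finset.card_le_card hcover).trans Finset.card_biUnion_le)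
    _ = ∑ a : Fin n, (((star a).powersetCard k).biUnion bad).card * N ^ k := Finset.sum_mul _ _ _
    _ ≤ ∑ a : Fin n, n.choose k * (m ^ k * Fintype.card (Ordering n)) :=
        Finset.sum_le_sum fun a _ => hstar a
    _ = _ := by
        rw [Finset.sum_const, Finset.card_univ, Fintype.card_fin, smul_eq_mul, mul_assoc]

theorem firstEdges_swap (σ : Ordering n) {i : ℕ} {p q : Fin (Fintype.card (Edge n))}
    (hp : i ≤ p) (hq : i ≤ q) : firstEdges ((Equiv.swap p q).trans σ) i = firstEdges σ i := by
  apply List.ext_getElem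
  · simp [firstEdges]
  · intro j h1 h2
    have hj : j < i := by
      rw [firstEdges, List.length_take] at h2
      exact lt_of_lt_of_le h2 (min_le_left _ _)
    simp only [firstEdges, List.getElem_take, List.getElem_ofFn, Equiv.trans_apply]
    congr 1
    refine Equiv.swap_apply_of_ne_of_ne ?_ ?_
    · intro h
      rw [← h] at hp
      exact absurd hp (by simpa using hj)
    · intro h
      rw [← h] at hq
      exact absurd hq (by simpa using hj)

/-- The next edge is uniformly distributed over the remaining ones. -/
theorem card_next_edge_le {i c : ℕ} (hi : i < Fintype.card (Edge n))
    (R : List (Edge n) → Edge n → Prop)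
    (hR : ∀ l, (Finset.univ.filter fun e => R l e).card ≤ c) :
    (Finset.univ.filter fun σ : Ordering n => R (firstEdges σ i) (σ ⟨i, hi⟩)).card *
      (Fintype.card (Edge n) - i) ≤ c * Fintype.card (Ordering n) := by
  set N := Fintype.card (Edge n) with hN
  let J : Finset (Fin N) := Finset.univ.filter fun p => i ≤ (p : ℕ)
  have hJ : J.card = N - i := by
    have h1 : (Finset.univ.filter fun p : Fin N => (p : ℕ) < i).card = i := by
      rw [Fin.card_filter_val_lt]
      exact min_eq_right hi.le
    have h2 := Finset.card_filter_add_card_filter_not (s := (Finset.univ : Finset (Fin N)))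
      (fun p : Fin N => (p : ℕ) < i)
    simp only [not_lt, Finset.card_univ, Fintype.card_fin] at h2
    change (Finset.univ.filter fun p : Fin N => i ≤ (p : ℕ)).card = _
    omega
  -- Exchanging the positions `i` and `j ≥ i` keeps the prefix, so any later entry may stand for the
  -- next edge.
  have hswap : ∀ j ∈ J, (Finset.univ.filter fun σ : Ordering n =>
      R (firstEdges σ i) (σ ⟨i, hi⟩)).card ≤
      (Finset.univ.filter fun σ : Ordering n => R (firstEdges σ i) (σ j)).card := by
    intro j hj
    have hj : i ≤ (j : ℕ) := (Finset.mem_filter.1 hj).2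
    refine Finset.card_le_card_of_injOn (fun σ => (Equiv.swap ⟨i, hi⟩ j).trans σ) ?_ ?_
    · intro σ hσ
      simp only [Finset.coe_filter, Finset.mem_univ, true_and, Set.mem_ofPred_eq] at hσ ⊢
      rw [firstEdges_swap σ (le_refl i) hj]
      simpa using hσ
    · intro σ _ τ _ h
      have h : (Equiv.swap ⟨i, hi⟩ j).trans σ = (Equiv.swap ⟨i, hi⟩ j).trans τ := h
      ext1 x
      have := congrArg (fun e => e (Equiv.swap ⟨i, hi⟩ j x)) h
      simpa using this
  have hcount := Finset.sum_card_bipartiteAbove_eq_sum_card_bipartiteBelow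
    (fun (j : Fin N) (σ : Ordering n) => R (firstEdges σ i) (σ j)) (s := J) (t := Finset.univ)
  simp only [Finset.bipartiteAbove, Finset.bipartiteBelow] at hcount
  calc _ = ∑ j ∈ J, (Finset.univ.filter fun σ : Ordering n =>
        R (firstEdges σ i) (σ ⟨i, hi⟩)).card := by
        rw [Finset.sum_const, hJ, smul_eq_mul, mul_comm]
    _ ≤ ∑ j ∈ J, (Finset.univ.filter fun σ : Ordering n => R (firstEdges σ i) (σ j)).card :=
        Finset.sum_le_sum hswap
    _ = ∑ σ : Ordering n, (J.filter fun j => R (firstEdges σ i) (σ j)).card := hcount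
    _ ≤ ∑ σ : Ordering n, c := by
        refine Finset.sum_le_sum fun σ _ => ?_
        refine le_trans ?_ (hR (firstEdges σ i))
        refine Finset.card_le_card_of_injOn σ ?_ σ.injective.injOn
        intro j hj
        simp only [Finset.coe_filter, Set.mem_ofPred_eq, Finset.mem_univ, true_and] at hj ⊢
        exact hj.2
    _ = _ := by rw [Finset.sum_const, Finset.card_univ, smul_eq_mul, mul_comm]

end Orderings

/-! ### The cost of one insertion -/

section Cost

open scoped Classical

variable {n : ℕ}

theorem ncard_within_le_sq {W : Type*} [Fintype W] (G : SimpleGraph W) (B : Finset W) :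
    {f ∈ G.edgeSet | ∀ v ∈ f, v ∈ B}.ncard ≤ B.card * B.card := by
  have h := sum_card_adj_within G B
  have h1 : ∑ v ∈ B, {w | w ∈ B ∧ G.Adj v w}.ncard ≤ ∑ v ∈ B, B.card := by
    refine Finset.sum_le_sum fun v _ => ?_
    rw [← Set.ncard_coe_finset B]
    exact Set.ncard_le_ncard fun w hw => hw.1
  rw [Finset.sum_const, smul_eq_mul] at h1
  omega

theorem ncard_adj_le_deg (l : List (Edge n)) (a : Fin n) (B : Finset (Vertex n)) :
    {w | w ∈ B ∧ (graph l).Adj (some a) w}.ncard ≤ deg l a + 1 := by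
  have hsub : {w | w ∈ B ∧ (graph l).Adj (some a) w} ⊆
      insert none ((((star a).filter fun e => e ∈ l).image fun e => some (other a e) :
        Finset (Vertex n)) : Set (Vertex n)) := by
    rintro w ⟨_, hw⟩
    cases w with
    | none => exact Set.mem_insert _ _
    | some w =>
      right
      obtain ⟨e, he, h⟩ := graph_adj_some.1 hw
      have hlt := ne_of_lt e.2
      refine Finset.mem_coe.2 (Finset.mem_image.2 ⟨e, ?_, ?_⟩)
      · exact Finset.mem_filter.2 ⟨Finset.mem_filter.2 ⟨Finset.mem_univ _, by tauto⟩, he⟩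
      · rcases h with ⟨h1, h2⟩ | ⟨h1, h2⟩
        · rw [other, if_pos h1, h2]
        · rw [other, if_neg, h2]
          rw [← h1]
          exact hlt
  refine (Set.ncard_le_ncard hsub).trans ((Set.ncard_insert_le _ _).trans ?_)
  rw [Set.ncard_coe_finset]
  exact Nat.add_le_add_right Finset.card_image_le 1

/-- The degree of the pseudo root is not bounded by `k`. Its at most `B.card` edges within `B` are
counted apart, as one more for each vertex of `B`. -/
theorem ncard_within_le_deg (l : List (Edge n)) (B : Finset (Vertex n)) {k : ℕ}
    (hk : ∀ a, deg l a ≤ k) :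
    {f ∈ (graph l).edgeSet | ∀ v ∈ f, v ∈ B}.ncard ≤ B.card * (k + 2) := by
  have h := sum_card_adj_within (graph l) B
  have h1 : ∑ v ∈ B, {w | w ∈ B ∧ (graph l).Adj v w}.ncard ≤
      ∑ v ∈ B, ((k + 1) + if v = none then B.card else 0) := by
    refine Finset.sum_le_sum fun v _ => ?_
    cases v with
    | none =>
      rw [if_pos rfl, ← Set.ncard_coe_finset B]
      refine le_trans (Set.ncard_le_ncard fun w hw => hw.1) (Nat.le_add_left _ _)
    | some a =>
      have := ncard_adj_le_deg l a B
      have := hk a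
      omega
  have h2 : ∑ v ∈ B, (if v = none then B.card else 0) ≤ B.card := by
    rw [Finset.sum_ite_eq']
    split_ifs <;> simp
  rw [Finset.sum_add_distrib, Finset.sum_const, smul_eq_mul] at h1
  have h3 : B.card * (k + 2) = B.card * (k + 1) + B.card := by ring
  omega

theorem ncard_within_le_length (l : List (Edge n)) (B : Finset (Vertex n)) :
    {f ∈ (graph l).edgeSet | ∀ v ∈ f, v ∈ B}.ncard ≤ n + l.length := by
  have hsub : {f ∈ (graph l).edgeSet | ∀ v ∈ f, v ∈ B} ⊆
      ((Finset.univ.image (fun a : Fin n => (s(none, some a) : Sym2 (Vertex n))) ∪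
        l.toFinset.image (fun e => s(some e.1.1, some e.1.2)) :
          Finset (Sym2 (Vertex n))) : Set (Sym2 (Vertex n))) := by
    rintro f ⟨hf, -⟩
    rw [Finset.mem_coe, Finset.mem_union, Finset.mem_image, Finset.mem_image]
    induction f using Sym2.ind with
    | _ x y =>
      rw [SimpleGraph.mem_edgeSet] at hf
      cases x with
      | none =>
        cases y with
        | none => exact absurd hf (SimpleGraph.irrefl _)
        | some b => exact Or.inl ⟨b, Finset.mem_univ _, rfl⟩
      | some a =>
        cases y with
        | none => exact Or.inl ⟨a, Finset.mem_univ _, Sym2.eq_swap⟩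
        | some b =>
          rw [graph_adj_some] at hf
          obtain ⟨e, he, ⟨h1, h2⟩ | ⟨h1, h2⟩⟩ := hf
          · exact Or.inr ⟨e, by simpa using he, by rw [h1, h2]⟩
          · exact Or.inr ⟨e, by simpa using he, by rw [h1, h2, Sym2.eq_swap]⟩
  refine (Set.ncard_le_ncard hsub).trans ?_
  rw [Set.ncard_coe_finset]
  refine (Finset.card_union_le _ _).trans (add_le_add ?_ ?_)
  · exact Finset.card_image_le.trans (by simp)
  · exact Finset.card_image_le.trans (List.toFinset_card_le l)

theorem deg_append_le (l : List (Edge n)) (e : Edge n) (a : Fin n) :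
    deg (l ++ [e]) a ≤ deg l a + 1 := by
  rw [deg, deg]
  refine (Finset.card_le_card (t := insert e ((star a).filter fun f => f ∈ l)) ?_).trans
    (Finset.card_insert_le _ _)
  intro f hf
  rw [Finset.mem_filter, List.mem_append, List.mem_singleton] at hf
  rw [Finset.mem_insert, Finset.mem_filter]
  tauto

theorem bristles_ncard_le_succ (l : List (Edge n)) : (bristles (tree l)).ncard ≤ n + 1 := by
  have := Set.ncard_le_card (bristles (tree l))
  simpa using this

variable {l : List (Edge n)} {e : Edge n}

theorem insertTime_le (hl : (l ++ [e]).Nodup) : insertTime l e ≤ 11 * (2 * n + 2 + l.length) := by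
  by_cases hc : IsCross (tree l) (some e.1.1) (some e.1.2)
  · have h := insertTime_le_of_cross hl hc
    have h1 := bristles_ncard_le_succ l
    have h2 := ncard_within_le_length (l ++ [e]) (bristles (tree l)).toFinset
    simp only [Set.mem_toFinset, List.length_append, List.length_singleton] at h2
    omega
  · rw [(insert_of_not_cross hl hc).2]
    omega

/-- The constant comes from `11 * (2b + 4b²) ≤ 66b²`. -/
theorem insertTime_le_of_bristles (hl : (l ++ [e]).Nodup) {b : ℕ} (hb : 1 ≤ b)
    (hB : (bristles (tree l)).ncard ≤ 2 * b) : insertTime l e ≤ 66 * b ^ 2 := by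
  by_cases hc : IsCross (tree l) (some e.1.1) (some e.1.2)
  · have h := insertTime_le_of_cross hl hc
    have h2 := ncard_within_le_sq (graph (l ++ [e])) (bristles (tree l)).toFinset
    simp only [Set.mem_toFinset, ← Set.ncard_eq_toFinset_card'] at h2
    have h3 : (bristles (tree l)).ncard * (bristles (tree l)).ncard ≤ (2 * b) * (2 * b) :=
      Nat.mul_le_mul hB hB
    have h4 : b ≤ b ^ 2 := Nat.le_self_pow two_ne_zero b
    have h5 : (2 * b) * (2 * b) = 4 * b ^ 2 := by ring
    omega
  · rw [(insert_of_not_cross hl hc).2]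
    have : 1 ≤ b ^ 2 := Nat.one_le_pow _ _ hb
    omega

/-- The degrees are bounded before the insertion, hence by `k + 1` after it. This gives `11 * (2b +
2b(k + 3)) = 22b(k + 4)`. -/
theorem insertTime_le_of_deg (hl : (l ++ [e]).Nodup) {b k : ℕ}
    (hB : (bristles (tree l)).ncard ≤ 2 * b) (hk : ∀ a, deg l a ≤ k) : insertTime l e ≤
      1 + if (bristles (tree l)).ncard ≤ 2 * b ∧ IsCross (tree l) (some e.1.1) (some e.1.2) then
        22 * b * (k + 4) else 0 := by
  by_cases hc : IsCross (tree l) (some e.1.1) (some e.1.2)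
  · rw [if_pos ⟨hB, hc⟩]
    have h := insertTime_le_of_cross hl hc
    have h2 := ncard_within_le_deg (l ++ [e]) (bristles (tree l)).toFinset (k := k + 1)
      fun a => (deg_append_le l e a).trans (Nat.add_le_add_right (hk a) 1)
    simp only [Set.mem_toFinset, ← Set.ncard_eq_toFinset_card'] at h2
    have h3 : (bristles (tree l)).ncard * (k + 1 + 2) ≤ (2 * b) * (k + 1 + 2) :=
      Nat.mul_le_mul_right _ hB
    have h5 : 22 * b * (k + 4) = 11 * ((2 * b) * (k + 1 + 2)) + 11 * (2 * b) := by ring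
    omega
  · rw [(insert_of_not_cross hl hc).2]
    omega

theorem card_cross_le (hl : l.Nodup) : (Finset.univ.filter fun e : Edge n =>
    IsCross (tree l) (some e.1.1) (some e.1.2)).card ≤ (bristles (tree l)).ncard ^ 2 := by
  rw [Set.ncard_eq_toFinset_card', sq, ← Finset.card_product]
  refine Finset.card_le_card_of_injOn (fun e => (some e.1.1, some e.1.2)) ?_ ?_
  · intro e he
    have hc : IsCross (tree l) (some e.1.1) (some e.1.2) := by simpa using he
    have h := inv_run l hl
    have hoff := h.not_onStick_of_cross hc
    rw [Finset.mem_coe, Finset.mem_product, Set.mem_toFinset, Set.mem_toFinset, tree,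
      h.bristles_eq]
    exact hoff
  · intro e _ f _ h
    simp only [Prod.mk.injEq, Option.some.injEq] at h
    exact Subtype.ext (Prod.ext h.1 h.2)

/-- The time of the insertion of the edge number `i`. -/
def cost (i : ℕ) (σ : Ordering n) : ℕ :=
  if h : i < Fintype.card (Edge n) then insertTime (firstEdges σ i) (σ ⟨i, h⟩) else 0

theorem totalTime_firstEdges (σ : Ordering n) {m : ℕ} (hm : m ≤ Fintype.card (Edge n)) :
    totalTime (firstEdges σ m) =
      totalTime ([] : List (Edge n)) + ∑ i ∈ Finset.range m, cost i σ := by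
  induction m with
  | zero => simp [firstEdges]
  | succ m ih =>
    rw [firstEdges_succ σ (by omega), totalTime_append, ih (by omega), Finset.sum_range_succ,
      cost, dif_pos (by omega : m < Fintype.card (Edge n)), add_assoc]

theorem nodup_firstEdges_append (σ : Ordering n) {i : ℕ} (hi : i < Fintype.card (Edge n)) :
    (firstEdges σ i ++ [σ ⟨i, hi⟩]).Nodup := by
  rw [← firstEdges_succ]
  exact firstEdges_nodup σ (i + 1)

theorem length_firstEdges_le (σ : Ordering n) (i : ℕ) : (firstEdges σ i).length ≤ i := by
  rw [firstEdges, List.length_take]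
  exact min_le_left _ _

theorem cost_le (i : ℕ) (σ : Ordering n) : cost i σ ≤ 11 * (2 * n + 2 + i) := by
  rw [cost]
  split_ifs with hi
  · have h1 := insertTime_le (nodup_firstEdges_append σ hi)
    have h2 := length_firstEdges_le σ i
    omega
  · omega

theorem sum_cost_le_sq {i b : ℕ} (hi : i < Fintype.card (Edge n)) (hb : 1 ≤ b) :
    ∑ σ : Ordering n, cost i σ ≤ 66 * b ^ 2 * Fintype.card (Ordering n) +
      11 * (2 * n + 2 + i) * (Finset.univ.filter fun σ : Ordering n =>
        2 * b < (bristles (tree (firstEdges σ i))).ncard).card := by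
  have hpt : ∀ σ : Ordering n, cost i σ ≤ 66 * b ^ 2 +
      if 2 * b < (bristles (tree (firstEdges σ i))).ncard then 11 * (2 * n + 2 + i) else 0 := by
    intro σ
    split_ifs with h
    · exact (cost_le i σ).trans (Nat.le_add_left _ _)
    · rw [cost, dif_pos hi]
      exact insertTime_le_of_bristles (nodup_firstEdges_append σ hi) hb (not_lt.1 h)
  refine (Finset.sum_le_sum fun σ _ => hpt σ).trans (le_of_eq ?_)
  rw [Finset.sum_add_distrib, Finset.sum_const, ← Finset.sum_filter, Finset.sum_const,
    Finset.card_univ]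
  simp only [smul_eq_mul]
  ring

/-- The trivial bound is charged on the two rare events, many bristles and a large degree. Off them
an insertion costs more than one step only if the next edge is a cross edge. -/
theorem sum_cost_le_deg {i b k : ℕ} (hi : i < Fintype.card (Edge n)) :
    ∑ σ : Ordering n, cost i σ ≤ Fintype.card (Ordering n) +
      11 * (2 * n + 2 + i) * (Finset.univ.filter fun σ : Ordering n =>
        2 * b < (bristles (tree (firstEdges σ i))).ncard).card +
      11 * (2 * n + 2 + i) * (Finset.univ.filter fun σ : Ordering n =>
        ∃ a, k ≤ deg (firstEdges σ i) a).card +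
      22 * b * (k + 4) * (Finset.univ.filter fun σ : Ordering n =>
        (bristles (tree (firstEdges σ i))).ncard ≤ 2 * b ∧
        IsCross (tree (firstEdges σ i)) (some (σ ⟨i, hi⟩).1.1) (some (σ ⟨i, hi⟩).1.2)).card := by
  have hpt : ∀ σ : Ordering n, cost i σ ≤ 1 +
      (if 2 * b < (bristles (tree (firstEdges σ i))).ncard then 11 * (2 * n + 2 + i) else 0) +
      (if ∃ a, k ≤ deg (firstEdges σ i) a then 11 * (2 * n + 2 + i) else 0) +
      (if (bristles (tree (firstEdges σ i))).ncard ≤ 2 * b ∧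
        IsCross (tree (firstEdges σ i)) (some (σ ⟨i, hi⟩).1.1) (some (σ ⟨i, hi⟩).1.2) then
        22 * b * (k + 4) else 0) := by
    intro σ
    by_cases h1 : 2 * b < (bristles (tree (firstEdges σ i))).ncard
    · rw [if_pos h1]
      have := cost_le i σ
      omega
    by_cases h2 : ∃ a, k ≤ deg (firstEdges σ i) a
    · rw [if_pos h2]
      have := cost_le i σ
      omega
    · rw [if_neg h1, if_neg h2, cost, dif_pos hi]
      push Not at h2
      exact insertTime_le_of_deg (nodup_firstEdges_append σ hi) (not_lt.1 h1)
        fun a => (h2 a).le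
  refine (Finset.sum_le_sum fun σ _ => hpt σ).trans (le_of_eq ?_)
  rw [Finset.sum_add_distrib, Finset.sum_add_distrib, Finset.sum_add_distrib, Finset.sum_const,
    ← Finset.sum_filter, ← Finset.sum_filter, ← Finset.sum_filter, Finset.sum_const,
    Finset.sum_const, Finset.sum_const, Finset.card_univ]
  simp only [smul_eq_mul]
  ring

theorem card_cross_next_le {i b : ℕ} (hi : i < Fintype.card (Edge n)) :
    (Finset.univ.filter fun σ : Ordering n =>
        (bristles (tree (firstEdges σ i))).ncard ≤ 2 * b ∧
        IsCross (tree (firstEdges σ i)) (some (σ ⟨i, hi⟩).1.1) (some (σ ⟨i, hi⟩).1.2)).card *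
      (Fintype.card (Edge n) - i) ≤ 4 * b ^ 2 * Fintype.card (Ordering n) := by
  have h := card_next_edge_le (c := 4 * b ^ 2) hi
    -- The bound on the number of cross edges needs the invariant, hence distinct edges, while
    -- `card_next_edge_le` asks for a bound for every list.
    (fun l e => l.Nodup ∧ (bristles (tree l)).ncard ≤ 2 * b ∧
      IsCross (tree l) (some e.1.1) (some e.1.2)) ?_
  · refine le_trans (Nat.mul_le_mul_right _ (Finset.card_le_card fun σ hσ => ?_)) h
    simp only [Finset.mem_filter, Finset.mem_univ, true_and] at hσ ⊢
    exact ⟨firstEdges_nodup σ i, hσ⟩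
  · intro l
    by_cases hl : l.Nodup ∧ (bristles (tree l)).ncard ≤ 2 * b
    · refine (Finset.card_le_card fun e he => ?_).trans ((card_cross_le hl.1).trans ?_)
      · simp only [Finset.mem_filter, Finset.mem_univ, true_and] at he ⊢
        exact he.2.2
      · calc (bristles (tree l)).ncard ^ 2 ≤ (2 * b) ^ 2 := Nat.pow_le_pow_left hl.2 2
          _ = 4 * b ^ 2 := by ring
    · refine (Finset.card_eq_zero.2 (Finset.eq_empty_of_forall_notMem fun e he => ?_)).le.trans
        (Nat.zero_le _)
      simp only [Finset.mem_filter, Finset.mem_univ, true_and] at he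
      exact hl ⟨he.1, he.2.1⟩

end Cost

/-! ### The expected total time -/

section Expectation

open scoped Classical

variable {n : ℕ}

theorem half_le_log (hn : 2 ≤ n) : (1 / 2 : ℝ) ≤ Real.log n := by
  have h1 : Real.log 2 ≤ Real.log n :=
    Real.log_le_log (by norm_num) (by exact_mod_cast hn)
  have := Real.log_two_gt_d9
  linarith

theorem card_edge_cast (n : ℕ) : (Fintype.card (Edge n) : ℝ) = n * (n - 1) / 2 := by
  rw [card_edge, Nat.cast_choose_two]

theorem card_edge_le (n : ℕ) : (Fintype.card (Edge n) : ℝ) ≤ n ^ 2 / 2 := by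
  rw [card_edge_cast]
  have : (0 : ℝ) ≤ n := Nat.cast_nonneg n
  nlinarith

theorem le_card_edge (hn : 2 ≤ n) : (n : ℝ) ^ 2 / 4 ≤ Fintype.card (Edge n) := by
  rw [card_edge_cast]
  have : (2 : ℝ) ≤ n := by exact_mod_cast hn
  nlinarith

theorem exp_mul_log (hn : 2 ≤ n) (k : ℕ) : Real.exp (-(k * Real.log n)) * (n : ℝ) ^ k = 1 := by
  have h0 : (0 : ℝ) < n := by
    have : 0 < n := by omega
    exact_mod_cast this
  rw [Real.exp_neg, ← Real.log_pow, Real.exp_log (pow_pos h0 k)]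
  exact inv_mul_cancel₀ (pow_pos h0 k).ne'

/-- There are rarely many bristles. -/
theorem prob_many_bristles (hn : 2 ≤ n) {i b : ℕ} (hi : i < Fintype.card (Edge n)) (hb : 1 ≤ b)
    (hib : 6 * Fintype.card (Edge n) * Real.log n ≤ i * b) :
    ((Finset.univ.filter fun σ : Ordering n =>
      2 * b < (bristles (tree (firstEdges σ i))).ncard).card : ℝ) * n ^ 2 ≤
      4 * Fintype.card (Ordering n) := by
  have h := card_many_bristles_le hi.le hb
  set x := (Finset.univ.filter fun σ : Ordering n =>
      2 * b < (bristles (tree (firstEdges σ i))).ncard).card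
  set N := Fintype.card (Edge n)
  have hN : (0 : ℝ) < N := by
    have : 0 < N := by omega
    exact_mod_cast this
  have hn' : (2 : ℝ) ≤ n := by exact_mod_cast hn
  have h' : (x : ℝ) * N ^ b ≤
      n * ((n + 1) * (2 * (N + 1))) * ((N - i) ^ b * Fintype.card (Ordering n)) := by
    have h1 : ((Fintype.card (Edge n) - i : ℕ) : ℝ) = (Fintype.card (Edge n) : ℝ) - i :=
      Nat.cast_sub hi.le
    have h2 : ((x * N ^ b : ℕ) : ℝ) ≤ _ := Nat.cast_le.2 h
    push_cast [h1] at h2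
    exact h2
  -- `(1 - i/N)^b ≤ exp(-ib/N) ≤ n⁻⁶` by the choice of `b`. The union bound costs at most `4n⁴`, and
  -- `n⁻²` is left.
  have hpow : ((N : ℝ) - i) ^ b * n ^ 6 ≤ N ^ b := by
    have h1 : (N : ℝ) - i ≤ N * Real.exp (-(i / N)) := by
      have := Real.one_sub_le_exp_neg ((i : ℝ) / N)
      calc (N : ℝ) - i = N * (1 - i / N) := by field_simp
        _ ≤ _ := mul_le_mul_of_nonneg_left this hN.le
    have h2 : (0 : ℝ) ≤ (N : ℝ) - i := by
      have : (i : ℝ) ≤ N := by exact_mod_cast hi.le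
      linarith
    have h3 : Real.exp (-(i / N)) ^ b ≤ Real.exp (-((6 : ℕ) * Real.log n)) := by
      rw [← Real.exp_nat_mul]
      apply Real.exp_le_exp.2
      have : 6 * Real.log n ≤ b * (i / N) := by
        rw [← mul_div_assoc, le_div_iff₀ hN]
        linarith
      push_cast
      linarith
    calc ((N : ℝ) - i) ^ b * n ^ 6 ≤ (N * Real.exp (-(i / N))) ^ b * n ^ 6 := by gcongr
      _ = (N : ℝ) ^ b * (Real.exp (-(i / N)) ^ b * n ^ 6) := by rw [mul_pow]; ring
      _ ≤ (N : ℝ) ^ b * (Real.exp (-((6 : ℕ) * Real.log n)) * n ^ 6) := by gcongr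
      _ = (N : ℝ) ^ b := by rw [exp_mul_log hn, mul_one]
  have hK : (n : ℝ) * ((n + 1) * (2 * (N + 1))) ≤ 4 * n ^ 4 := by
    have h1 := card_edge_le n
    have h2 : (N : ℝ) + 1 ≤ n ^ 2 := by nlinarith
    calc (n : ℝ) * ((n + 1) * (2 * (N + 1))) ≤ (n : ℝ) * ((n + n) * (2 * n ^ 2)) := by
          gcongr
          linarith
      _ = 4 * (n : ℝ) ^ 4 := by ring
  have hNb : (0 : ℝ) < N ^ b := pow_pos hN b
  have hn4 : (0 : ℝ) < (n : ℝ) ^ 4 := by positivity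
  refine le_of_mul_le_mul_right ?_ (mul_pos hNb hn4)
  calc (x : ℝ) * n ^ 2 * (N ^ b * n ^ 4) = (x * N ^ b) * n ^ 6 := by ring
    _ ≤ ((n : ℝ) * ((n + 1) * (2 * (N + 1))) * (((N : ℝ) - i) ^ b * Fintype.card (Ordering n))) * n ^ 6 := by
        gcongr
    _ = (n : ℝ) * ((n + 1) * (2 * (N + 1))) * Fintype.card (Ordering n) * (((N : ℝ) - i) ^ b * n ^ 6) := by
        ring
    _ ≤ 4 * (n : ℝ) ^ 4 * Fintype.card (Ordering n) * N ^ b := by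
        refine mul_le_mul (mul_le_mul_of_nonneg_right hK (Nat.cast_nonneg _)) hpow ?_ (by positivity)
        have h0 : (0 : ℝ) ≤ (N : ℝ) - i := sub_nonneg.2 (by exact_mod_cast hi.le)
        positivity
    _ = _ := by ring

/-- There is rarely a vertex of large degree. -/
theorem prob_large_degree (hn : 2 ≤ n) {i k : ℕ} (hi : i < Fintype.card (Edge n))
    (hin : n * Real.log n ≤ i) (hk : 32 * (i : ℝ) / n ≤ k) :
    ((Finset.univ.filter fun σ : Ordering n =>
      ∃ a, k ≤ deg (firstEdges σ i) a).card : ℝ) * n ^ 2 ≤ Fintype.card (Ordering n) := by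
  have h := card_large_degree_le (k := k) hi.le
  set x := (Finset.univ.filter fun σ : Ordering n => ∃ a, k ≤ deg (firstEdges σ i) a).card
  set N := Fintype.card (Edge n)
  have hN : (0 : ℝ) < N := by
    have : 0 < N := by omega
    exact_mod_cast this
  have hn' : (2 : ℝ) ≤ n := by exact_mod_cast hn
  have hn0 : (0 : ℝ) < n := by linarith
  have hL := half_le_log hn
  have h' : (x : ℝ) * N ^ k ≤
      n * n.choose k * (i ^ k * Fintype.card (Ordering n)) := by exact_mod_cast h
  have hkL : 3 * Real.log n ≤ k := by
    have h1 : Real.log n ≤ i / n := by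
      rw [le_div_iff₀ hn0]
      linarith
    have h2 : 32 * (i : ℝ) / n = 32 * (i / n) := by ring
    linarith
  have hni : (n : ℝ) * i ≤ N * (k / 8) := by
    have h1 := le_card_edge hn
    rw [div_le_iff₀ hn0] at hk
    have h2 : (i : ℝ) ≤ k * n / 32 := by linarith
    calc (n : ℝ) * i ≤ (n : ℝ) * (k * n / 32) := by gcongr
      _ = (n : ℝ) ^ 2 / 4 * (k / 8) := by ring
      _ ≤ (N : ℝ) * (k / 8) := by gcongr
  have hfact : (k : ℝ) ^ k / k.factorial ≤ Real.exp k :=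
    Real.pow_div_factorial_le_exp k (Nat.cast_nonneg k) k
  -- The probability for one vertex is at most `(ni/N)^k / k! ≤ (k/8)^k / k! ≤ (e/8)^k ≤ e^(-k) ≤
  -- n⁻³`, where `e² ≤ 8`.
  have hchoose : (n.choose k : ℝ) * i ^ k * n ^ 3 ≤ N ^ k := by
    have h1 : (n.choose k : ℝ) ≤ n ^ k / k.factorial := Nat.choose_le_pow_div k n
    have h2 : Real.exp k * (1 / 8) ^ k ≤ Real.exp (-((3 : ℕ) * Real.log n)) := by
      have h3 : Real.exp k * (1 / 8) ^ k ≤ Real.exp (-k) := by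
        have h4 : Real.exp k = Real.exp 1 ^ k := by rw [← Real.exp_nat_mul, mul_one]
        have h5 : Real.exp (-k) = Real.exp (-1) ^ k := by rw [← Real.exp_nat_mul]; simp
        rw [h4, h5, ← mul_pow]
        refine pow_le_pow_left₀ (by positivity) ?_ k
        rw [Real.exp_neg, ← one_div, le_div_iff₀ (Real.exp_pos 1)]
        have h6 := Real.exp_one_lt_d9
        have h7 := Real.exp_pos 1
        nlinarith
      refine h3.trans (Real.exp_le_exp.2 ?_)
      push_cast
      linarith
    calc (n.choose k : ℝ) * i ^ k * n ^ 3 ≤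
        (n : ℝ) ^ k / k.factorial * i ^ k * n ^ 3 := by gcongr
      _ = ((n : ℝ) * i) ^ k / k.factorial * n ^ 3 := by rw [mul_pow]; ring
      _ ≤ ((N : ℝ) * (k / 8)) ^ k / k.factorial * n ^ 3 := by gcongr
      _ = (N : ℝ) ^ k * (((k : ℝ) ^ k / k.factorial) * (1 / 8) ^ k * n ^ 3) := by
          rw [mul_pow, div_pow, one_div, inv_pow]
          ring
      _ ≤ (N : ℝ) ^ k * (Real.exp k * (1 / 8) ^ k * n ^ 3) := by gcongr
      _ ≤ (N : ℝ) ^ k * (Real.exp (-((3 : ℕ) * Real.log n)) * n ^ 3) := by gcongr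
      _ = (N : ℝ) ^ k := by rw [exp_mul_log hn, mul_one]
  have hNk : (0 : ℝ) < N ^ k := pow_pos hN k
  refine le_of_mul_le_mul_right ?_ (mul_pos hNk hn0)
  calc (x : ℝ) * n ^ 2 * (N ^ k * n) = (x * N ^ k) * n ^ 3 := by ring
    _ ≤ ((n : ℝ) * n.choose k * ((i : ℝ) ^ k * Fintype.card (Ordering n))) * n ^ 3 := by gcongr
    _ = (n : ℝ) * Fintype.card (Ordering n) * (n.choose k * (i : ℝ) ^ k * n ^ 3) := by ring
    _ ≤ (n : ℝ) * Fintype.card (Ordering n) * (N : ℝ) ^ k := by gcongr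
    _ = _ := by ring

/-- The expected time of a late insertion is at most logarithmic, up to a square. -/
theorem sum_cost_late (hn : 2 ≤ n) {i : ℕ} (hi : i < Fintype.card (Edge n))
    (hhalf : (Fintype.card (Edge n) : ℝ) ≤ 2 * i) :
    ((∑ σ : Ordering n, cost i σ : ℕ) : ℝ) ≤
      (221 + 16896 * Real.log n ^ 2) * Fintype.card (Ordering n) := by
  set N := Fintype.card (Edge n) with hNdef
  have hL := half_le_log hn
  set L := Real.log n
  have hN : (0 : ℝ) < N := by
    have : 0 < N := by omega
    exact_mod_cast this
  have hi0 : (0 : ℝ) < i := by linarith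
  have hiN : (i : ℝ) ≤ N := by exact_mod_cast hi.le
  have hpos : 0 < 6 * N * L / i := by positivity
  have hb : 1 ≤ ⌈6 * N * L / i⌉₊ := Nat.one_le_ceil_iff.2 hpos
  set b := ⌈6 * N * L / i⌉₊ with hbdef
  -- Since `N ≤ 2i`, the quotient is at most `12L`, and `L ≥ 1/2` absorbs the rounding. The square
  -- then gives `66 * 256 = 16896`.
  have hble : (b : ℝ) ≤ 16 * L := by
    have h1 : (b : ℝ) < 6 * N * L / i + 1 := Nat.ceil_lt_add_one hpos.le
    have h2 : 6 * N * L / i ≤ 12 * L := by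
      rw [div_le_iff₀ hi0]
      nlinarith
    linarith
  have hib : 6 * N * L ≤ i * b := by
    have := Nat.le_ceil (6 * N * L / i)
    rw [div_le_iff₀ hi0] at this
    linarith
  have h1 := prob_many_bristles hn hi hb hib
  have h2 := sum_cost_le_sq hi hb
  set x := (Finset.univ.filter fun σ : Ordering n =>
      2 * b < (bristles (tree (firstEdges σ i))).ncard).card
  have h2' : ((∑ σ : Ordering n, cost i σ : ℕ) : ℝ) ≤
      66 * b ^ 2 * Fintype.card (Ordering n) + 11 * (2 * n + 2 + i) * x := by exact_mod_cast h2
  have hn' : (2 : ℝ) ≤ n := by exact_mod_cast hn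
  have hcost : 11 * (2 * (n : ℝ) + 2 + i) ≤ 44 * n ^ 2 := by
    have := card_edge_le n
    nlinarith
  have hb2 : (b : ℝ) ^ 2 ≤ 256 * L ^ 2 := by
    calc (b : ℝ) ^ 2 ≤ (16 * L) ^ 2 := by gcongr
      _ = _ := by ring
  have hx : 11 * (2 * (n : ℝ) + 2 + i) * x ≤ 176 * Fintype.card (Ordering n) := by
    calc 11 * (2 * (n : ℝ) + 2 + i) * x ≤ 44 * (n : ℝ) ^ 2 * x := by gcongr
      _ = 44 * ((x : ℝ) * n ^ 2) := by ring
      _ ≤ 44 * (4 * (Fintype.card (Ordering n) : ℝ)) := by gcongr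
      _ = _ := by ring
  have hall : (0 : ℝ) ≤ Fintype.card (Ordering n) := Nat.cast_nonneg _
  have hb3 : 66 * (b : ℝ) ^ 2 * Fintype.card (Ordering n) ≤
      16896 * L ^ 2 * Fintype.card (Ordering n) := by
    have : 66 * (b : ℝ) ^ 2 ≤ 16896 * L ^ 2 := by linarith
    gcongr
  nlinarith

/-- The estimate behind `sum_cost_middle`. -/
theorem middle_estimate {n i N L b k x y z M : ℝ} (hn : 2 ≤ n) (hL : 1 / 2 ≤ L)
    (hin : n * L ≤ i) (hhalf : 2 * i ≤ N) (hN : 2 * N ≤ n ^ 2) (hb0 : 0 ≤ b) (hk0 : 0 ≤ k)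
    (hb : b ≤ 6 * N * L / i + 1) (hk : k ≤ 32 * i / n + 1) (hx0 : 0 ≤ x) (hy0 : 0 ≤ y) (hz0 : 0 ≤ z)
    (hM : 0 ≤ M) (hx : x * n ^ 2 ≤ 4 * M) (hy : y * n ^ 2 ≤ M)
    (hz : z * (N - i) ≤ 4 * b ^ 2 * M) :
    M + 11 * (2 * n + 2 + i) * x + 11 * (2 * n + 2 + i) * y + 22 * b * (k + 4) * z ≤
      (221 + 1000000 * n ^ 3 * L ^ 3 * (i ^ 2)⁻¹) * M := by
  have hn0 : 0 < n := by linarith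
  have hL0 : 0 < L := by linarith
  have hi0 : 0 < i := (mul_pos hn0 hL0).trans_le hin
  have hN0 : 0 < N := by linarith
  -- The rounding terms here and in `hkle` are absorbed by means of `L ≥ 1/2`, with `i ≤ N` here and
  -- `i ≥ nL` there.
  have hble : b ≤ 8 * N * L / i := by
    have h2 : 1 ≤ 2 * N * L / i := by
      rw [le_div_iff₀ hi0]
      nlinarith
    have h3 : 8 * N * L / i = 6 * N * L / i + 2 * N * L / i := by ring
    linarith
  have hkle : k + 4 ≤ 42 * i / n := by
    have h2 : 5 ≤ 10 * i / n := by
      rw [le_div_iff₀ hn0]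
      nlinarith
    have h3 : 42 * i / n = 32 * i / n + 10 * i / n := by ring
    linarith
  have hcost : 11 * (2 * n + 2 + i) ≤ 44 * n ^ 2 := by nlinarith
  have hx' : 11 * (2 * n + 2 + i) * x ≤ 176 * M := by
    have := mul_le_mul_of_nonneg_right hcost hx0
    linarith
  have hy' : 11 * (2 * n + 2 + i) * y ≤ 44 * M := by
    have := mul_le_mul_of_nonneg_right hcost hy0
    linarith
  have hz' : z ≤ 8 * b ^ 2 / N * M := by
    have h7 : z * (N / 2) ≤ z * (N - i) := mul_le_mul_of_nonneg_left (by linarith) hz0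
    rw [div_mul_eq_mul_div, le_div_iff₀ hN0]
    linarith
  -- Cost of a rebuilding times probability of a cross edge. The constant `176 * 8³ * 42 = 3784704`
  -- is rounded up to four million, and the split-off factor 4 is used up by `4N² ≤ n⁴`.
  have hmain : 22 * b * (k + 4) * (8 * b ^ 2 / N) ≤
      1000000 * (4 * (N ^ 2 / n)) * L ^ 3 * (i ^ 2)⁻¹ := by
    calc 22 * b * (k + 4) * (8 * b ^ 2 / N) = 176 / N * b ^ 3 * (k + 4) := by ring
      _ ≤ 176 / N * (8 * N * L / i) ^ 3 * (42 * i / n) := by gcongr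
      _ = 3784704 * (N ^ 2 / n * L ^ 3 * (i ^ 2)⁻¹) := by
          field_simp
          norm_num
      _ ≤ 4000000 * (N ^ 2 / n * L ^ 3 * (i ^ 2)⁻¹) :=
          mul_le_mul_of_nonneg_right (by norm_num) (by positivity)
      _ = _ := by ring
  have hN2 : 4 * (N ^ 2 / n) ≤ n ^ 3 := by
    rw [← mul_div_assoc, div_le_iff₀ hn0]
    calc 4 * N ^ 2 = (2 * N) ^ 2 := by ring
      _ ≤ (n ^ 2) ^ 2 := by gcongr
      _ = n ^ 3 * n := by ring
  have hmain' : 22 * b * (k + 4) * z ≤ 1000000 * n ^ 3 * L ^ 3 * (i ^ 2)⁻¹ * M := by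
    calc 22 * b * (k + 4) * z ≤ 22 * b * (k + 4) * (8 * b ^ 2 / N * M) := by gcongr
      _ = 22 * b * (k + 4) * (8 * b ^ 2 / N) * M := by ring
      _ ≤ 1000000 * (4 * (N ^ 2 / n)) * L ^ 3 * (i ^ 2)⁻¹ * M :=
          mul_le_mul_of_nonneg_right hmain hM
      _ ≤ _ := by gcongr
  linarith

/-- The expected time of an insertion in between. -/
theorem sum_cost_middle (hn : 2 ≤ n) {i : ℕ} (hi : i < Fintype.card (Edge n))
    (hin : n * Real.log n ≤ i) (hhalf : 2 * (i : ℝ) ≤ Fintype.card (Edge n)) :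
    ((∑ σ : Ordering n, cost i σ : ℕ) : ℝ) ≤
      (221 + 1000000 * (n : ℝ) ^ 3 * Real.log n ^ 3 * ((i : ℝ) ^ 2)⁻¹) *
        Fintype.card (Ordering n) := by
  have hL := half_le_log hn
  have hn' : (2 : ℝ) ≤ n := by exact_mod_cast hn
  have hN : (0 : ℝ) < Fintype.card (Edge n) := by exact_mod_cast (Nat.zero_le i).trans_lt hi
  have hi0 : (0 : ℝ) < i := by nlinarith
  have hN2 := card_edge_le n
  have hpos : 0 < 6 * Fintype.card (Edge n) * Real.log n / i := by positivity
  obtain ⟨b, hbdef⟩ : ∃ b, b = ⌈6 * Fintype.card (Edge n) * Real.log n / i⌉₊ := ⟨_, rfl⟩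
  obtain ⟨k, hkdef⟩ : ∃ k, k = ⌈32 * (i : ℝ) / n⌉₊ := ⟨_, rfl⟩
  have hb : 1 ≤ b := hbdef ▸ Nat.one_le_ceil_iff.2 hpos
  have hble : (b : ℝ) ≤ 6 * Fintype.card (Edge n) * Real.log n / i + 1 :=
    hbdef ▸ (Nat.ceil_lt_add_one hpos.le).le
  have hkle : (k : ℝ) ≤ 32 * (i : ℝ) / n + 1 :=
    hkdef ▸ (Nat.ceil_lt_add_one (by positivity)).le
  have hib : 6 * Fintype.card (Edge n) * Real.log n ≤ i * b := by
    have : _ ≤ (b : ℝ) := hbdef ▸ Nat.le_ceil (6 * Fintype.card (Edge n) * Real.log n / i)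
    rw [div_le_iff₀ hi0] at this
    linarith
  have h1 := prob_many_bristles hn hi hb hib
  have h2 := prob_large_degree hn hi hin (k := k) (hkdef ▸ Nat.le_ceil (32 * (i : ℝ) / n))
  have h3 := card_cross_next_le (b := b) hi
  have h4 := sum_cost_le_deg (b := b) (k := k) hi
  generalize (∑ σ : Ordering n, cost i σ) = S at *
  generalize (Finset.univ.filter fun σ : Ordering n =>
      2 * b < (bristles (tree (firstEdges σ i))).ncard).card = x at *
  generalize (Finset.univ.filter fun σ : Ordering n =>
      ∃ a, k ≤ deg (firstEdges σ i) a).card = y at *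
  generalize (Finset.univ.filter fun σ : Ordering n =>
      (bristles (tree (firstEdges σ i))).ncard ≤ 2 * b ∧
      IsCross (tree (firstEdges σ i)) (some (σ ⟨i, hi⟩).1.1) (some (σ ⟨i, hi⟩).1.2)).card = z at *
  generalize Fintype.card (Ordering n) = M at *
  have h5 : ((Fintype.card (Edge n) - i : ℕ) : ℝ) = (Fintype.card (Edge n) : ℝ) - i :=
    Nat.cast_sub hi.le
  have h3' : (z : ℝ) * (Fintype.card (Edge n) - i) ≤ 4 * b ^ 2 * M := by
    rw [← h5]
    exact_mod_cast h3
  have h4' : (S : ℝ) ≤ M + 11 * (2 * n + 2 + i) * x + 11 * (2 * n + 2 + i) * y +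
        22 * b * (k + 4) * z := by exact_mod_cast h4
  exact h4'.trans (middle_estimate hn' hL hin hhalf (by linarith) (Nat.cast_nonneg b)
    (Nat.cast_nonneg k) hble hkle (Nat.cast_nonneg x) (Nat.cast_nonneg y) (Nat.cast_nonneg z)
    (Nat.cast_nonneg M) h1 h2 h3')

/-- A bound on the expected time of the insertion of the edge number `i`. -/
noncomputable def costBound (n i : ℕ) : ℝ :=
  (221 + 16896 * Real.log n ^ 2) +
  (if i ∈ Finset.range (⌊n * Real.log n⌋₊ + 1) then 77 * (n * Real.log n) else 0) +
  (if i ∈ Finset.Ioo ⌊n * Real.log n⌋₊ (Fintype.card (Edge n)) then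
    1000000 * (n : ℝ) ^ 3 * Real.log n ^ 3 * ((i : ℝ) ^ 2)⁻¹ else 0)

theorem sum_cost_le (hn : 2 ≤ n) {i : ℕ} (hi : i < Fintype.card (Edge n)) :
    ((∑ σ : Ordering n, cost i σ : ℕ) : ℝ) ≤ costBound n i * Fintype.card (Ordering n) := by
  have hL := half_le_log hn
  have hn' : (2 : ℝ) ≤ n := by exact_mod_cast hn
  have hall : (0 : ℝ) ≤ Fintype.card (Ordering n) := Nat.cast_nonneg _
  have hL0 : (0 : ℝ) ≤ Real.log n := by linarith
  have hfl : (0 : ℝ) ≤ n * Real.log n := by positivity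
  rw [costBound]
  by_cases h1 : (i : ℝ) ≤ n * Real.log n
  · rw [if_pos (Finset.mem_range.2 (Nat.lt_succ_of_le (Nat.le_floor h1)))]
    have h2 : ∑ σ : Ordering n, cost i σ ≤ Fintype.card (Ordering n) * (11 * (2 * n + 2 + i)) := by
      refine (Finset.sum_le_sum fun σ _ => cost_le i σ).trans (le_of_eq ?_)
      rw [Finset.sum_const, Finset.card_univ, smul_eq_mul]
    have h3 : ((∑ σ : Ordering n, cost i σ : ℕ) : ℝ) ≤
        Fintype.card (Ordering n) * (11 * (2 * n + 2 + i)) := by exact_mod_cast h2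
    refine h3.trans ?_
    rw [mul_comm]
    refine mul_le_mul_of_nonneg_right ?_ hall
    have h4 : 0 ≤ (if i ∈ Finset.Ioo ⌊n * Real.log n⌋₊ (Fintype.card (Edge n)) then
        1000000 * (n : ℝ) ^ 3 * Real.log n ^ 3 * ((i : ℝ) ^ 2)⁻¹ else 0) := by
      split_ifs <;> positivity
    -- With `i ≤ n log n` this gives `2n + 2 + i ≤ 3n + i ≤ 7 n log n`, whence the constant 77.
    have h5 : (n : ℝ) ≤ 2 * (n * Real.log n) := by nlinarith
    nlinarith [sq_nonneg (Real.log n)]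
  · push Not at h1
    have h2 : ⌊n * Real.log n⌋₊ < i := (Nat.floor_lt hfl).2 h1
    rw [if_neg (by rw [Finset.mem_range]; omega), if_pos (Finset.mem_Ioo.2 ⟨h2, hi⟩), add_zero]
    rcases le_total (2 * (i : ℝ)) (Fintype.card (Edge n)) with h3 | h3
    · refine (sum_cost_middle hn hi h1.le h3).trans (mul_le_mul_of_nonneg_right ?_ hall)
      nlinarith [sq_nonneg (Real.log n)]
    · refine (sum_cost_late hn hi h3).trans (mul_le_mul_of_nonneg_right ?_ hall)
      have : 0 ≤ 1000000 * (n : ℝ) ^ 3 * Real.log n ^ 3 * ((i : ℝ) ^ 2)⁻¹ := by positivity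
      linarith

theorem sum_costBound_le (hn : 2 ≤ n) : ∑ i ∈ Finset.range (Fintype.card (Edge n)), costBound n i ≤
    2100000 * (n : ℝ) ^ 2 * Real.log n ^ 2 := by
  have hL := half_le_log hn
  have hn' : (2 : ℝ) ≤ n := by exact_mod_cast hn
  have hN := card_edge_le n
  have hL0 : (0 : ℝ) < Real.log n := by linarith
  have hnL : 1 ≤ n * Real.log n := by nlinarith
  have hL2 : 1 ≤ 4 * Real.log n ^ 2 := by nlinarith
  simp only [costBound, Finset.sum_add_distrib]
  have h1 : ∑ i ∈ Finset.range (Fintype.card (Edge n)), (221 : ℝ) +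
      ∑ i ∈ Finset.range (Fintype.card (Edge n)), 16896 * Real.log n ^ 2 ≤
      (n ^ 2 / 2) * (17780 * Real.log n ^ 2) := by
    rw [Finset.sum_const, Finset.sum_const, Finset.card_range, nsmul_eq_mul, nsmul_eq_mul, ← mul_add]
    gcongr
    linarith
  have h2 : ∑ i ∈ Finset.range (Fintype.card (Edge n)),
      (if i ∈ Finset.range (⌊n * Real.log n⌋₊ + 1) then 77 * (n * Real.log n) else 0) ≤
      154 * ((n : ℝ) ^ 2 * Real.log n ^ 2) := by
    rw [← Finset.sum_filter, Finset.sum_const, nsmul_eq_mul]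
    have h3 : ((Finset.range (Fintype.card (Edge n))).filter fun i =>
        i ∈ Finset.range (⌊n * Real.log n⌋₊ + 1)).card ≤ ⌊n * Real.log n⌋₊ + 1 := by
      refine (Finset.card_le_card (t := Finset.range (⌊n * Real.log n⌋₊ + 1))
        fun i hi => (Finset.mem_filter.1 hi).2).trans ?_
      rw [Finset.card_range]
    have h4 : ((((Finset.range (Fintype.card (Edge n))).filter fun i =>
        i ∈ Finset.range (⌊n * Real.log n⌋₊ + 1)).card : ℕ) : ℝ) ≤ 2 * (n * Real.log n) := by
      have h5 : ((⌊n * Real.log n⌋₊ + 1 : ℕ) : ℝ) ≤ n * Real.log n + 1 := by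
        push_cast
        have := Nat.floor_le (by positivity : (0 : ℝ) ≤ n * Real.log n)
        linarith
      refine (Nat.cast_le.2 h3).trans (h5.trans (by linarith))
    calc _ ≤ 2 * (n * Real.log n) * (77 * (n * Real.log n)) := by gcongr
      _ = _ := by ring
  have h3 : ∑ i ∈ Finset.range (Fintype.card (Edge n)),
      (if i ∈ Finset.Ioo ⌊n * Real.log n⌋₊ (Fintype.card (Edge n)) then
        1000000 * (n : ℝ) ^ 3 * Real.log n ^ 3 * ((i : ℝ) ^ 2)⁻¹ else 0) ≤
      2000000 * ((n : ℝ) ^ 2 * Real.log n ^ 2) := by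
    rw [← Finset.sum_filter]
    calc _ ≤ ∑ i ∈ Finset.Ioo ⌊n * Real.log n⌋₊ (Fintype.card (Edge n)),
          1000000 * (n : ℝ) ^ 3 * Real.log n ^ 3 * ((i : ℝ) ^ 2)⁻¹ := by
          refine Finset.sum_le_sum_of_subset_of_nonneg
            (fun i hi => (Finset.mem_filter.1 hi).2) fun i _ _ => by positivity
      _ = 1000000 * (n : ℝ) ^ 3 * Real.log n ^ 3 *
          ∑ i ∈ Finset.Ioo ⌊n * Real.log n⌋₊ (Fintype.card (Edge n)), ((i : ℝ) ^ 2)⁻¹ :=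
          (Finset.mul_sum _ _ _).symm
      -- The tail of the sum of `1/i²` beyond `n log n` is at most `2/(n log n)`. This cancels one
      -- factor `n log n` and is why the middle range starts there.
      _ ≤ 1000000 * (n : ℝ) ^ 3 * Real.log n ^ 3 * (2 / (⌊n * Real.log n⌋₊ + 1)) := by
          gcongr
          exact sum_Ioo_inv_sq_le _ _
      _ ≤ 1000000 * (n : ℝ) ^ 3 * Real.log n ^ 3 * (2 / (n * Real.log n)) := by
          gcongr
          exact (Nat.lt_floor_add_one _).le
      _ = _ := by
          field_simp
          ring
  nlinarith

theorem expect_totalTime_le (hn : 2 ≤ n) {m : ℕ} (hm : m ≤ n.choose 2) :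
    Finset.expect (Finset.univ : Finset (Ordering n))
      (fun σ => (totalTime (firstEdges σ m) : ℝ)) ≤
      2200000 * (n : ℝ) ^ 2 * Real.log n ^ 2 := by
  rw [← card_edge] at hm
  have hL := half_le_log hn
  have hn' : (2 : ℝ) ≤ n := by exact_mod_cast hn
  have hall : (0 : ℝ) < Fintype.card (Ordering n) := by exact_mod_cast Fintype.card_pos
  rw [Finset.expect_eq_sum_div_card, Finset.card_univ, div_le_iff₀ hall]
  have h1 : ∀ σ : Ordering n, (totalTime (firstEdges σ m) : ℝ) ≤
      21 * (n + 1) + ∑ i ∈ Finset.range (Fintype.card (Edge n)), (cost i σ : ℝ) := by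
    intro σ
    rw [totalTime_firstEdges σ hm]
    push_cast
    refine add_le_add (by exact_mod_cast totalTime_nil_le n) ?_
    exact Finset.sum_le_sum_of_subset_of_nonneg (Finset.range_mono hm) fun i _ _ =>
      Nat.cast_nonneg _
  refine (Finset.sum_le_sum fun σ _ => h1 σ).trans ?_
  rw [Finset.sum_add_distrib, Finset.sum_const, Finset.card_univ, nsmul_eq_mul, Finset.sum_comm]
  have h2 : ∑ i ∈ Finset.range (Fintype.card (Edge n)), ∑ σ : Ordering n, (cost i σ : ℝ) ≤
      2100000 * (n : ℝ) ^ 2 * Real.log n ^ 2 * Fintype.card (Ordering n) := by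
    calc _ ≤ ∑ i ∈ Finset.range (Fintype.card (Edge n)),
          costBound n i * Fintype.card (Ordering n) := by
          refine Finset.sum_le_sum fun i hi => ?_
          have := sum_cost_le hn (Finset.mem_range.1 hi)
          push_cast at this
          exact this
      _ = (∑ i ∈ Finset.range (Fintype.card (Edge n)), costBound n i) *
          Fintype.card (Ordering n) := (Finset.sum_mul _ _ _).symm
      _ ≤ _ := by
          gcongr
          exact sum_costBound_le hn
  have h3 : 21 * ((n : ℝ) + 1) ≤ 100000 * n ^ 2 * Real.log n ^ 2 := by
    have hL2 : 1 ≤ 4 * Real.log n ^ 2 := by nlinarith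
    have h4 : (n : ℝ) ^ 2 * 1 ≤ n ^ 2 * (4 * Real.log n ^ 2) := by gcongr
    nlinarith
  calc _ ≤ (Fintype.card (Ordering n) : ℝ) * (100000 * n ^ 2 * Real.log n ^ 2) +
        2100000 * (n : ℝ) ^ 2 * Real.log n ^ 2 * Fintype.card (Ordering n) := by gcongr
    _ = _ := by ring

end Expectation

end SDFS2

theorem mainTheorem6 :
    -- after every insertion, the tree is a DFS tree of the present graph
    (∀ (n : ℕ) (l : List (SDFS2.Edge n)), l.Nodup →
      SDFS2.IsDFSTree (SDFS2.graph l) none (SDFS2.tree l)) ∧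
    -- there is a rebuilding only on the insertion of a cross edge, and only of the bristles
    (∃ K : ℕ, ∀ (n : ℕ) (l : List (SDFS2.Edge n)) (e : SDFS2.Edge n), (e :: l).Nodup →
      (¬ SDFS2.IsCross (SDFS2.tree l) (some e.1.1) (some e.1.2) →
        SDFS2.tree (l ++ [e]) = SDFS2.tree l ∧ SDFS2.insertTime l e ≤ K) ∧
      (SDFS2.IsCross (SDFS2.tree l) (some e.1.1) (some e.1.2) →
        SDFS2.stick (SDFS2.tree l) ⊆ SDFS2.stick (SDFS2.tree (l ++ [e])) ∧
        (∀ u ∈ SDFS2.stick (SDFS2.tree l), ∀ v,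
          SDFS2.tree l v = some u ↔ SDFS2.tree (l ++ [e]) v = some u) ∧
        SDFS2.insertTime l e ≤ K * ((SDFS2.bristles (SDFS2.tree l)).ncard +
          {f ∈ (SDFS2.graph (l ++ [e])).edgeSet |
            ∀ v ∈ f, v ∈ SDFS2.bristles (SDFS2.tree l)}.ncard))) ∧
    -- expected total time for the first `m` edges of a uniformly random ordering of all edges
    (∃ C : ℝ, ∀ n : ℕ, 2 ≤ n → ∀ m : ℕ, m ≤ n.choose 2 →
      Finset.expect (Finset.univ : Finset (SDFS2.Ordering n))
        (fun σ => (SDFS2.totalTime (SDFS2.firstEdges σ m) : ℝ))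
        ≤ C * (n : ℝ) ^ 2 * Real.log n ^ 2) := by
  refine ⟨fun n l hl => SDFS2.tree_isDFSTree hl, ⟨11, fun n l e hl => ?_⟩, ?_⟩
  · have hl' : (l ++ [e]).Nodup := by
      rw [List.nodup_cons] at hl
      exact hl.2.append (List.nodup_singleton e) (by simpa using hl.1)
    refine ⟨fun hc => ?_, fun hc => ?_⟩
    · obtain ⟨h1, h2⟩ := SDFS2.insert_of_not_cross hl' hc
      exact ⟨h1, by omega⟩
    · obtain ⟨h1, h2⟩ := SDFS2.stick_subset_of_cross hl' hc
      exact ⟨h1, h2, SDFS2.insertTime_le_of_cross hl' hc⟩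
  · exact ⟨2200000, fun n hn m hm => SDFS2.expect_totalTime_le hn hm⟩
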